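/- A (nontrivial) $3$-net in the complex projective plane $\mathbb{P}^2$ consists of a finite set of lines, partitioned into three classes $\mathcal{A}_1,\mathcal{A}_2,\mathcal{A}_3$ with more than one line each, and a finite set $\mathcal{X}$ of points such that - for all $i\neq j$, $l\in\mathcal{A}_i$ and $l'\in\mathcal{A}_j$, the intersection point of $l$ and $l'$ belongs to $\mathcal{X}$; - for every $X\in\mathcal{X}$ and every $i$ there is exactly one line $l\in\mathcal{A}_i$ passing through $X$. The net realizes an Abelian group $H$ if there are bijections $\varphi_i\colon H\to\mathcal{A}_i$ $(i=1,2,3)$ such that, for all $a,b\in H$, the line of $\mathcal{A}_3$ through the point $\varphi_1(a)\cap\varphi_2(b)$ is $\varphi_3(a+b)$. A class is a pencil if all its lines pass through a common point. Let $H$ be a finite Abelian group. (i) Suppose that $H$ has an element of order $\geq 10$. Then $H$ is realized by some $3$-net in $\mathbb{P}^2$ if and only if $H$ has at most two invariant factors, that is, $H\cong\mathbb{Z}/d_1\oplus\cdots\oplus\mathbb{Z}/d_r$ with $r\leq 2$, all $d_i>1$, and $d_1\mid\cdots\mid d_r$. (ii) Suppose that $H$ has an element of order $\geq 7$. Then $H$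 is realized by some $3$-net in $\mathbb{P}^2$ at least one class of which is a pencil if and only if $H$ is cyclic. -/

import Mathlib

/-- A point of the complex projective plane, with homogeneous coordinates `(x : y : z)`. -/
abbrev PlanePoint : Type := Projectivization ℂ (Fin 3 → ℂ)

/-- A line of the complex projective plane, given by the coefficients `(a : b : c)`, not all zero
and up to a common nonzero factor, of its equation `a x + b y + c z = 0`. -/
abbrev PlaneLine : Type := Projectivization ℂ (Fin 3 → ℂ)

/-- The point `(x : y : z)` lies on the line `(a : b : c)`, that is `x a + y b + z c = 0`. -/
def LiesOn (p : PlanePoint) (l : PlaneLine) : Prop := Projectivization.orthogonal p l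

/-- A nontrivial `k`-net in the complex projective plane: a finite set of lines, partitioned into
`k` classes, and a finite set of points. -/
structure PlaneNet (k : ℕ) where
  /-- The classes of lines. -/
  cls : Fin k → Set PlaneLine
  /-- The points of the net. -/
  pts : Set PlanePoint
  three_le : 3 ≤ k
  finite_cls : ∀ i, (cls i).Finite
  finite_pts : pts.Finite
  disjoint_cls : ∀ i j, i ≠ j → Disjoint (cls i) (cls j)
  /-- Lines of different classes meet in a point of the net (they are different lines, so there is
  exactly one point of the plane on both). -/
  meet : ∀ i j, i ≠ j → ∀ l ∈ cls i, ∀ l' ∈ cls j, ∃ p ∈ pts, LiesOn p l ∧ LiesOn p l'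
  /-- Each point of the net lies on exactly one line of each class. -/
  unique_line : ∀ p ∈ pts, ∀ i, ∃! l, l ∈ cls i ∧ LiesOn p l
  /-- The order `m` of the net, which is the common number of lines in a class, satisfies `m > 1`. -/
  nontrivial_cls : ∀ i, (cls i).Nontrivial

/-- The `i`-th class of the net is a pencil: its lines all pass through one point of the plane. -/
def PlaneNet.IsPencil {k : ℕ} (N : PlaneNet k) (i : Fin k) : Prop :=
  ∃ p : PlanePoint, ∀ l ∈ N.cls i, LiesOn p l

/-- A 3-net realizes the Abelian group `H`: its three classes can be identified with `H` by
bijections such that the line of the third class through the point of the net in which line `a` of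
the first class and line `b` of the second class meet is line `a + b`. -/
def PlaneNet.Realizes (N : PlaneNet 3) (H : Type*) [AddCommGroup H] : Prop :=
  ∃ φ : ∀ i : Fin 3, H ≃ N.cls i, ∀ a b : H, ∃ p ∈ N.pts,
    LiesOn p (φ 0 a) ∧ LiesOn p (φ 1 b) ∧ LiesOn p (φ 2 (a + b))

/-- `d 0 ∣ d 1 ∣ ⋯ ∣ d (r - 1)` are the invariant factors of the finite Abelian group `H`: they are
greater than `1` and `H` is isomorphic to the direct sum of the cyclic groups `ℤ/d i`. -/
def IsInvariantFactors (H : Type*) [AddCommGroup H] {r : ℕ} (d : Fin r → ℕ) : Prop :=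
  (∀ i, 1 < d i) ∧ (∀ i j, i ≤ j → d i ∣ d j) ∧ Nonempty (H ≃+ ((i : Fin r) → ZMod (d i)))

/-! The argument takes place in the dual plane. Lines become vectors, concurrence becomes the
vanishing of `det3`, and negating the labels of the third class turns a net into a `DualNet`: points
`p a`, `q b`, `r c` that are collinear when `a + b + c = 0`.

A pencil becomes a class on a line. With that line at infinity the class is a set of directions, and
the other two classes are affine families such that the vector joining `q j` to `r (-(i + j))` is
parallel to `p i`. A Fourier transform in `j` shows that only injective characters can contribute,
apart from the trivial one. As the families are not constant, `H` has an injective character and is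
cyclic (`exists_injective_addChar`, `DualNet.isAddCyclic_of_collinear`). Conversely, by Menelaus, a
cyclic group of roots of unity can be placed on the three sides of a triangle.

For the necessity in (i), let `C` be generated by an element of order at least ten and suppose that
`H` is not cyclic. Each subnet on cosets of `C` lies on a cubic: take a cubic through nine of its
points and propagate by the theorem of Chasles (`chasles`, `DualNet.exists_cubicForm`). If the cubic
contained a line, a class of the subnet would be collinear (`DualNet.exists_collinear_of_line`), the
Fourier argument would spread this to the whole class (`DualNet.last_eq_zero_of_restrict`), and `H`
would be cyclic. So these cubics contain no line and have a Weierstrass form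
(`Lineless.hasWeierForm`). Two of them that share a coset of at least ten points coincide
(`cubicForm_eq_mul_weierForm`), and by changing cosets the whole net is seen to lie on one cubic.
Collinear points add up to zero there, so `H` embeds into the group of nonsingular points
(`DualNet.exists_hom`). This group has at most `2 (p ^ 2 - 1)` nonzero elements killed by a prime
`p` (`shortCurve.card_torsion_le`), while three invariant factors would produce `p ^ 3 - 1` of them.

For the sufficiency, the `n`-torsion of a smooth cubic contains `(ℤ/n)²`
(`shortCurve.exists_torsion_equiv`). Three translates of a finite group of points, by amounts of sum
zero that are generic otherwise, form a dual net (`exists_dualNet_of_hom`). -/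

/-- The determinant of three vectors of `ℂ³`. -/
def det3 (u v w : Fin 3 → ℂ) : ℂ :=
  u 0 * (v 1 * w 2 - v 2 * w 1) - u 1 * (v 0 * w 2 - v 2 * w 0) + u 2 * (v 0 * w 1 - v 1 * w 0)

/-! ### Determinants of three vectors -/

theorem dot3 (u v : Fin 3 → ℂ) : u ⬝ᵥ v = u 0 * v 0 + u 1 * v 1 + u 2 * v 2 := by
  simp [dotProduct, Fin.sum_univ_three]

theorem det3_eq_det (u v w : Fin 3 → ℂ) : det3 u v w = (Matrix.of ![u, v, w]).det := by
  rw [Matrix.det_fin_three]; simp [det3]; ring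

theorem det3_rotate (u v w : Fin 3 → ℂ) : det3 v w u = det3 u v w := by
  simp only [det3]; ring

theorem det3_swap (u v w : Fin 3 → ℂ) : det3 v u w = -det3 u v w := by
  simp only [det3]; ring

/-- Three vectors have determinant zero exactly when some nonzero vector is orthogonal to them. -/
theorem det3_eq_zero_iff (u v w : Fin 3 → ℂ) :
    det3 u v w = 0 ↔ ∃ x : Fin 3 → ℂ, x ≠ 0 ∧ u ⬝ᵥ x = 0 ∧ v ⬝ᵥ x = 0 ∧ w ⬝ᵥ x = 0 := by
  rw [det3_eq_det, ← Matrix.exists_mulVec_eq_zero_iff]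
  refine exists_congr fun x => and_congr_right fun _ => ?_
  rw [funext_iff, Fin.forall_fin_succ, Fin.forall_fin_succ, Fin.forall_fin_one]
  simp [Matrix.mulVec]

/-- Three vectors have determinant zero exactly when they are linearly dependent. -/
theorem det3_eq_zero_iff_dep (u v w : Fin 3 → ℂ) :
    det3 u v w = 0 ↔ ∃ x : Fin 3 → ℂ, x ≠ 0 ∧ ∀ i, x 0 * u i + x 1 * v i + x 2 * w i = 0 := by
  rw [det3_eq_det, ← Matrix.exists_vecMul_eq_zero_iff]
  refine exists_congr fun x => and_congr_right fun _ => ?_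
  rw [funext_iff]
  refine forall_congr' fun i => ?_
  change x ⬝ᵥ (fun j => ![u, v, w] j i) = 0 ↔ _
  rw [dot3]
  rfl

/-! ### Dual nets -/

/-- The configuration dual to a 3-net realizing `H`: three families of points, labelled so that the
points with labels of sum zero are collinear, such that no line contains points of different
families of which two belong to one family. -/
structure DualNet {H : Type*} [AddCommGroup H] (p q r : H → Fin 3 → ℂ) : Prop where
  coll : ∀ a b c, a + b + c = 0 → det3 (p a) (q b) (r c) = 0
  ppq : ∀ a a' b, a ≠ a' → det3 (p a) (p a') (q b) ≠ 0
  ppr : ∀ a a' b, a ≠ a' → det3 (p a) (p a') (r b) ≠ 0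
  qqp : ∀ a a' b, a ≠ a' → det3 (q a) (q a') (p b) ≠ 0
  qqr : ∀ a a' b, a ≠ a' → det3 (q a) (q a') (r b) ≠ 0
  rrp : ∀ a a' b, a ≠ a' → det3 (r a) (r a') (p b) ≠ 0
  rrq : ∀ a a' b, a ≠ a' → det3 (r a) (r a') (q b) ≠ 0

namespace DualNet

variable {H : Type*} [AddCommGroup H] {p q r : H → Fin 3 → ℂ}

theorem rotate (N : DualNet p q r) : DualNet q r p where
  coll a b c h := by
    rw [det3_rotate]
    exact N.coll c a b (by rw [← h]; abel)
  ppq := N.qqr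
  ppr := N.qqp
  qqp := N.rrq
  qqr := N.rrp
  rrp := N.ppq
  rrq := N.ppr

theorem swap (N : DualNet p q r) : DualNet q p r where
  coll a b c h := by
    rw [det3_swap, N.coll b a c (by rw [← h]; abel), neg_zero]
  ppq := N.qqp
  ppr := N.qqr
  qqp := N.ppq
  qqr := N.ppr
  rrp := N.rrq
  rrq := N.rrp

/-- Restriction of a dual net to cosets of the image of an injective homomorphism. -/
theorem restrict (N : DualNet p q r) {K : Type*} [AddCommGroup K] (f : K →+ H)
    (hf : Function.Injective f) {α β γ : H} (h : α + β + γ = 0) :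
    DualNet (fun k => p (α + f k)) (fun k => q (β + f k)) (fun k => r (γ + f k)) where
  coll a b c hs := N.coll _ _ _ (by
    have : f a + f b + f c = 0 := by rw [← map_add, ← map_add, hs, map_zero]
    calc α + f a + (β + f b) + (γ + f c) = (α + β + γ) + (f a + f b + f c) := by abel
      _ = 0 := by rw [h, this, add_zero])
  ppq a a' b hne := N.ppq _ _ _ (by simpa using hf.ne hne)
  ppr a a' b hne := N.ppr _ _ _ (by simpa using hf.ne hne)
  qqp a a' b hne := N.qqp _ _ _ (by simpa using hf.ne hne)
  qqr a a' b hne := N.qqr _ _ _ (by simpa using hf.ne hne)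
  rrp a a' b hne := N.rrp _ _ _ (by simpa using hf.ne hne)
  rrq a a' b hne := N.rrq _ _ _ (by simpa using hf.ne hne)

/-- Dual nets are preserved by maps that multiply determinants by a nonzero factor. -/
theorem map (N : DualNet p q r) (A : (Fin 3 → ℂ) → Fin 3 → ℂ) (d : ℂ) (hd : d ≠ 0)
    (hA : ∀ u v w, det3 (A u) (A v) (A w) = d * det3 u v w) :
    DualNet (fun k => A (p k)) (fun k => A (q k)) (fun k => A (r k)) where
  coll a b c hs := by rw [hA, N.coll a b c hs, mul_zero]
  ppq a a' b hne := by rw [hA]; exact mul_ne_zero hd (N.ppq _ _ _ hne)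
  ppr a a' b hne := by rw [hA]; exact mul_ne_zero hd (N.ppr _ _ _ hne)
  qqp a a' b hne := by rw [hA]; exact mul_ne_zero hd (N.qqp _ _ _ hne)
  qqr a a' b hne := by rw [hA]; exact mul_ne_zero hd (N.qqr _ _ _ hne)
  rrp a a' b hne := by rw [hA]; exact mul_ne_zero hd (N.rrp _ _ _ hne)
  rrq a a' b hne := by rw [hA]; exact mul_ne_zero hd (N.rrq _ _ _ hne)

/-- A third point collinear with `p a` and `q b` has the label that makes the sum zero. -/
theorem det3_ne_zero (N : DualNet p q r) {a b c : H} (h : a + b + c ≠ 0) :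
    det3 (p a) (q b) (r c) ≠ 0 := by
  intro h0
  have h1 : det3 (p a) (q b) (r (-(a + b))) = 0 := N.coll _ _ _ (by abel)
  have hne : c ≠ -(a + b) := by
    rintro rfl; exact h (by abel)
  have h2 := N.rrp _ _ a hne
  have h3 := N.rrq _ _ b hne
  rw [det3_eq_zero_iff] at h0 h1
  obtain ⟨x, hx, hx1, hx2, hx3⟩ := h0
  obtain ⟨y, hy, hy1, hy2, hy3⟩ := h1
  apply h2
  by_contra h2'
  -- all four vectors are orthogonal to `x` since `p a` and `q b` are independent
  by_cases hya : r (-(a + b)) ⬝ᵥ x = 0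
  · exact h2 ((det3_eq_zero_iff _ _ _).2 ⟨x, hx, hx3, hya, hx1⟩)
  · obtain ⟨z, hz, hz'⟩ := (det3_eq_zero_iff_dep _ _ _).1
      ((det3_eq_zero_iff (p a) (q b) (r (-(a + b)))).2 ⟨y, hy, hy1, hy2, hy3⟩)
    have e : z 2 * (r (-(a + b)) ⬝ᵥ x) = 0 := by
      have e0 := hz' 0
      have e1 := hz' 1
      have e2 := hz' 2
      rw [dot3] at hx1 hx2 ⊢
      linear_combination x 0 * e0 + x 1 * e1 + x 2 * e2 - z 0 * hx1 - z 1 * hx2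
    have z2 : z 2 = 0 := (mul_eq_zero.1 e).resolve_right hya
    -- `p a` and `q b` are dependent
    have hb : det3 (p a) (q b) (r (c)) = 0 ∧ det3 (r c) (r (-(a + b))) (p a) = 0 ∨
        det3 (r c) (r (-(a + b))) (q b) = 0 := by
      by_cases z1 : z 1 = 0
      · have z0 : z 0 ≠ 0 := by
          intro z0; exact hz (by ext i; fin_cases i <;> simp [z0, z1, z2])
        left
        have hp : ∀ i, p a i = 0 := fun i => by
          have := hz' i
          rw [z1, z2, zero_mul, zero_mul, add_zero, add_zero] at this
          exact (mul_eq_zero.1 this).resolve_left z0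
        simp [det3, hp]
      · by_cases z0 : z 0 = 0
        · have hp : ∀ i, q b i = 0 := fun i => by
            have := hz' i
            rw [z0, z2, zero_mul, zero_mul, zero_add, add_zero] at this
            exact (mul_eq_zero.1 this).resolve_left z1
          right; simp [det3, hp]
        · exfalso
          have hp : ∀ i, p a i = -(z 1 / z 0) * q b i := fun i => by
            have := hz' i
            rw [z2] at this
            field_simp
            linear_combination this
          -- The nonzero element `a + b + c` supplies the second label that `ppq` needs.
          obtain ⟨a', ha'⟩ : ∃ a', a' ≠ a := ⟨a + (a + b + c), by simpa using h⟩
          apply N.ppq a a' b ha'.symm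
          simp only [det3, hp]; ring
    rcases hb with hb | hb
    · exact h2 hb.2
    · exact h3 hb

end DualNet

/-! ### Translation between nets and dual nets -/

/-- If `u`, `v`, `w` are dependent and `u`, `w` are independent, then what is orthogonal to `u` and
`w` is orthogonal to `v`. -/
theorem dot_eq_zero_of_det3_eq_zero {u v w y : Fin 3 → ℂ} (h : det3 u v w = 0)
    (hind : LinearIndependent ℂ ![u, w]) (hu : u ⬝ᵥ y = 0) (hw : w ⬝ᵥ y = 0) : v ⬝ᵥ y = 0 := by
  obtain ⟨z, hz, hz'⟩ := (det3_eq_zero_iff_dep _ _ _).1 h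
  by_contra hv
  have e : z 1 * (v ⬝ᵥ y) = 0 := by
    have e0 := hz' 0
    have e1 := hz' 1
    have e2 := hz' 2
    rw [dot3] at hu hw ⊢
    linear_combination y 0 * e0 + y 1 * e1 + y 2 * e2 - z 0 * hu - z 2 * hw
  have z1 : z 1 = 0 := (mul_eq_zero.1 e).resolve_right hv
  rw [LinearIndependent.pair_iff] at hind
  obtain ⟨z0, z2⟩ := hind (z 0) (z 2) (by
    ext i; simpa [z1] using hz' i)
  exact hz (by ext i; fin_cases i <;> simp [z0, z1, z2])

theorem linearIndependent_rep_of_ne {u v : PlaneLine} (h : u ≠ v) :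
    LinearIndependent ℂ ![u.rep, v.rep] := by
  have := (Projectivization.independent_pair_iff_ne u v).2 h
  rw [Projectivization.independent_iff] at this
  have e : Projectivization.rep ∘ ![u, v] = ![u.rep, v.rep] := by
    ext i; fin_cases i <;> rfl
  rw [e] at this
  exact this

theorem liesOn_mk_iff {x : Fin 3 → ℂ} (hx : x ≠ 0) (l : PlaneLine) :
    LiesOn (Projectivization.mk ℂ x hx) l ↔ l.rep ⬝ᵥ x = 0 := by
  conv_lhs => rw [← l.mk_rep]
  rw [LiesOn, Projectivization.orthogonal_mk, dotProduct_comm]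

theorem liesOn_mk_mk_iff {x y : Fin 3 → ℂ} (hx : x ≠ 0) (hy : y ≠ 0) :
    LiesOn (Projectivization.mk ℂ x hx) (Projectivization.mk ℂ y hy) ↔ y ⬝ᵥ x = 0 := by
  rw [LiesOn, Projectivization.orthogonal_mk, dotProduct_comm]

theorem liesOn_iff (x : PlanePoint) (l : PlaneLine) : LiesOn x l ↔ l.rep ⬝ᵥ x.rep = 0 := by
  conv_lhs => rw [← x.mk_rep]
  rw [liesOn_mk_iff]

/-- Two lines of one class of a net and a line of another class are not concurrent. -/
theorem PlaneNet.det3_ne_zero (N : PlaneNet 3) {i j : Fin 3} (hij : i ≠ j) {l l' m : PlaneLine}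
    (hl : l ∈ N.cls i) (hl' : l' ∈ N.cls i) (hm : m ∈ N.cls j) (hne : l ≠ l') :
    det3 l.rep l'.rep m.rep ≠ 0 := by
  intro h
  have hlm : l ≠ m := fun e => Set.disjoint_left.1 (N.disjoint_cls i j hij) hl (e ▸ hm)
  obtain ⟨y, hy, hy1, hy2⟩ := N.meet i j hij l hl m hm
  have hy3 := dot_eq_zero_of_det3_eq_zero h (linearIndependent_rep_of_ne hlm)
    ((liesOn_iff _ _).1 hy1) ((liesOn_iff _ _).1 hy2)
  exact hne ((N.unique_line y hy i).unique ⟨hl, hy1⟩ ⟨hl', (liesOn_iff _ _).2 hy3⟩)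

/-- The dual net of a net that realizes a group. -/
theorem PlaneNet.Realizes.exists_dualNet {H : Type*} [AddCommGroup H] {N : PlaneNet 3}
    (h : N.Realizes H) : ∃ P : Fin 3 → H → Fin 3 → ℂ, DualNet (P 0) (P 1) (P 2) ∧
      ∀ i, N.IsPencil i → ∃ x : Fin 3 → ℂ, x ≠ 0 ∧ ∀ a, P i a ⬝ᵥ x = 0 := by
  obtain ⟨φ, hφ⟩ := h
  -- Negating the labels of the third class turns the rule "line `a + b`" into the symmetric
  -- condition of sum zero.
  let σ : Fin 3 → H → H := fun i a => if i = 2 then -a else a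
  have hσ : ∀ i a a', a ≠ a' → (φ i (σ i a) : PlaneLine) ≠ φ i (σ i a') := by
    intro i a a' hne e
    have e1 := (φ i).injective (Subtype.ext e)
    simp only [σ] at e1
    split_ifs at e1
    · exact hne (neg_injective e1)
    · exact hne e1
  have key : ∀ i j, i ≠ j → ∀ a a' b, a ≠ a' → det3 (φ i (σ i a) : PlaneLine).rep
      (φ i (σ i a') : PlaneLine).rep (φ j (σ j b) : PlaneLine).rep ≠ 0 :=
    fun i j hij a a' b hne => N.det3_ne_zero hij (φ i _).2 (φ i _).2 (φ j _).2 (hσ i a a' hne)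
  refine ⟨fun i a => (φ i (σ i a) : PlaneLine).rep, ⟨?_, key 0 1 (by decide), key 0 2 (by decide),
    key 1 0 (by decide), key 1 2 (by decide), key 2 0 (by decide), key 2 1 (by decide)⟩, ?_⟩
  · intro a b c habc
    obtain ⟨x, -, h0, h1, h2⟩ := hφ a b
    have hc : -c = a + b := by
      rw [neg_eq_iff_add_eq_zero, ← habc]; abel
    rw [det3_eq_zero_iff]
    refine ⟨x.rep, x.rep_nonzero, ?_, ?_, ?_⟩
    · simpa [σ] using (liesOn_iff _ _).1 h0
    · simpa [σ] using (liesOn_iff _ _).1 h1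
    · simpa [σ, hc] using (liesOn_iff _ _).1 h2
  · rintro i ⟨x, hx⟩
    exact ⟨x.rep, x.rep_nonzero, fun a => (liesOn_iff _ _).1 (hx _ (φ i _).2)⟩

theorem ne_zero_of_det3_ne_zero {u v w : Fin 3 → ℂ} (h : det3 u v w ≠ 0) : u ≠ 0 := by
  rintro rfl; exact h (by simp [det3])

theorem det3_smul_eq_zero {u v w : Fin 3 → ℂ} {c : ℂ} (h : u = c • v) : det3 u v w = 0 := by
  subst h; simp only [det3, Pi.smul_apply, smul_eq_mul]; ring

/-- A nontrivial finite group with a dual net is realized by a net. -/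
theorem DualNet.exists_realizes {H : Type*} [AddCommGroup H] [Finite H] [Nontrivial H]
    {P : Fin 3 → H → Fin 3 → ℂ} (D : DualNet (P 0) (P 1) (P 2)) :
    ∃ N : PlaneNet 3, N.Realizes H ∧
      ∀ i, (∃ x : Fin 3 → ℂ, x ≠ 0 ∧ ∀ a, P i a ⬝ᵥ x = 0) → N.IsPencil i := by
  classical
  have key : ∀ i j, i ≠ j → ∀ a a' b, a ≠ a' → det3 (P i a) (P i a') (P j b) ≠ 0 := by
    intro i j hij
    fin_cases i <;> fin_cases j <;> first | exact absurd rfl hij | skip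
    · exact D.ppq
    · exact D.ppr
    · exact D.qqp
    · exact D.qqr
    · exact D.rrp
    · exact D.rrq
  have hP0 : ∀ i a, P i a ≠ 0 := by
    intro i a
    obtain ⟨a', ha'⟩ := exists_ne a
    obtain ⟨j, hj⟩ := exists_ne i
    exact ne_zero_of_det3_ne_zero (key i j hj.symm a a' 0 ha'.symm)
  let L : Fin 3 → H → PlaneLine := fun i a => Projectivization.mk ℂ (P i a) (hP0 i a)
  have hLinj : ∀ i, Function.Injective (L i) := by
    intro i a a' e
    by_contra hne
    obtain ⟨j, hj⟩ := exists_ne i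
    obtain ⟨c, hc⟩ := (Projectivization.mk_eq_mk_iff' ℂ _ _ _ _).1 e
    exact key i j hj.symm a a' 0 hne (det3_smul_eq_zero hc.symm)
  have hLne : ∀ i j, i ≠ j → ∀ a b, L i a ≠ L j b := by
    intro i j hij a b e
    obtain ⟨a', ha'⟩ := exists_ne a
    obtain ⟨c, hc⟩ := (Projectivization.mk_eq_mk_iff' ℂ _ _ _ _).1 e
    apply key i j hij a' a b ha'
    rw [← det3_rotate]
    exact det3_smul_eq_zero hc.symm
  have hX : ∀ ab : H × H, ∃ x : Fin 3 → ℂ, x ≠ 0 ∧ P 0 ab.1 ⬝ᵥ x = 0 ∧ P 1 ab.2 ⬝ᵥ x = 0 ∧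
      P 2 (-(ab.1 + ab.2)) ⬝ᵥ x = 0 := fun ab =>
    (det3_eq_zero_iff _ _ _).1 (D.coll _ _ _ (by abel))
  choose X hX0 hX1 hX2 hX3 using hX
  let Y : H × H → PlanePoint := fun ab => Projectivization.mk ℂ (X ab) (hX0 ab)
  -- The labels of the three lines through the point `Y ab`. Any two of them determine the third,
  -- which is why every pair of lines of different classes meets in a point `Y ab`.
  let idx : Fin 3 → H × H → H := fun i ab => ![ab.1, ab.2, -(ab.1 + ab.2)] i
  have hidx : ∀ i ab, LiesOn (Y ab) (L i (idx i ab)) := by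
    intro i ab
    rw [liesOn_mk_mk_iff]
    fin_cases i
    · exact hX1 ab
    · exact hX2 ab
    · exact hX3 ab
  have huniq : ∀ i ab a, LiesOn (Y ab) (L i a) → a = idx i ab := by
    intro i ab a ha
    by_contra hne
    obtain ⟨j, hj⟩ := exists_ne i
    apply key i j hj.symm a (idx i ab) (idx j ab) hne
    rw [det3_eq_zero_iff]
    exact ⟨X ab, hX0 ab, (liesOn_mk_mk_iff _ _).1 ha, (liesOn_mk_mk_iff _ _).1 (hidx i ab),
      (liesOn_mk_mk_iff _ _).1 (hidx j ab)⟩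
  have hsolve : ∀ i j, i ≠ j → ∀ a b, ∃ ab, idx i ab = a ∧ idx j ab = b := by
    intro i j hij a b
    fin_cases i <;> fin_cases j <;> first | exact absurd rfl hij | skip
    · exact ⟨(a, b), rfl, rfl⟩
    · exact ⟨(a, -a - b), rfl, by simp [idx]⟩
    · exact ⟨(b, a), rfl, rfl⟩
    · exact ⟨(-a - b, a), rfl, by simp [idx]⟩
    · exact ⟨(b, -a - b), by simp [idx], rfl⟩
    · exact ⟨(-a - b, b), by simp [idx], rfl⟩
  let N : PlaneNet 3 :=
    { cls := fun i => Set.range (L i)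
      pts := Set.range Y
      three_le := le_rfl
      finite_cls := fun i => Set.finite_range _
      finite_pts := Set.finite_range _
      disjoint_cls := by
        intro i j hij
        rw [Set.disjoint_left]
        rintro _ ⟨a, rfl⟩ ⟨b, hb⟩
        exact hLne i j hij a b hb.symm
      meet := by
        rintro i j hij _ ⟨a, rfl⟩ _ ⟨b, rfl⟩
        obtain ⟨ab, rfl, rfl⟩ := hsolve i j hij a b
        exact ⟨Y ab, ⟨ab, rfl⟩, hidx i ab, hidx j ab⟩
      unique_line := by
        rintro _ ⟨ab, rfl⟩ i
        refine ⟨L i (idx i ab), ⟨⟨_, rfl⟩, hidx i ab⟩, ?_⟩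
        rintro _ ⟨⟨a, rfl⟩, ha⟩
        rw [huniq i ab a ha]
      nontrivial_cls := by
        intro i
        obtain ⟨a, b, hab⟩ := exists_pair_ne H
        exact ⟨_, ⟨a, rfl⟩, _, ⟨b, rfl⟩, (hLinj i).ne hab⟩ }
  let e : ∀ i, H ≃ N.cls i := fun i => Equiv.ofInjective (L i) (hLinj i)
  refine ⟨N, ⟨fun i => if i = 2 then (Equiv.neg H).trans (e i) else e i, fun a b =>
    ⟨Y (a, b), ⟨_, rfl⟩, hidx 0 (a, b), hidx 1 (a, b), hidx 2 (a, b)⟩⟩, ?_⟩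
  rintro i ⟨x, hx, hx'⟩
  refine ⟨Projectivization.mk ℂ x hx, ?_⟩
  rintro _ ⟨a, rfl⟩
  exact (liesOn_mk_mk_iff _ _).2 (hx' a)

/-! ### Fourier analysis: a class on a line forces the group to be cyclic -/

section Fourier

variable {K : Type*} [AddCommGroup K] [Fintype K]

/-- The unnormalized Fourier coefficient of `f` at the character `θ`. -/
noncomputable def fourierCoef (f : K → ℂ) (θ : AddChar K ℂ) : ℂ := ∑ j, θ (-j) * f j

theorem fourierCoef_shift (f : K → ℂ) (θ : AddChar K ℂ) (i : K) :
    fourierCoef (fun j => f (i + j)) θ = θ i * fourierCoef f θ := by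
  rw [fourierCoef, fourierCoef, Finset.mul_sum]
  refine Fintype.sum_equiv (Equiv.addLeft i) _ _ fun j => ?_
  rw [Equiv.coe_addLeft, ← mul_assoc, ← AddChar.map_add_eq_mul]
  rw [neg_add, add_neg_cancel_left]

theorem fourierCoef_inversion (f : K → ℂ) (k : K) :
    ∑ θ : AddChar K ℂ, fourierCoef f θ * θ k = Fintype.card K * f k := by
  classical
  simp only [fourierCoef, Finset.sum_mul]
  rw [Finset.sum_comm]
  have : ∀ j, ∑ θ : AddChar K ℂ, θ (-j) * f j * θ k = if k = j then Fintype.card K * f k else 0 := by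
    intro j
    have h1 : ∀ θ : AddChar K ℂ, θ (-j) * f j * θ k = θ (k - j) * f j := by
      intro θ
      rw [sub_eq_add_neg, AddChar.map_add_eq_mul]; ring
    simp only [h1]
    rw [← Finset.sum_mul, AddChar.sum_apply_eq_ite]
    by_cases hkj : k = j
    · simp [hkj]
    · simp [hkj, sub_eq_zero]
  simp only [this, Finset.sum_ite_eq, Finset.mem_univ, if_true]

theorem fourierCoef_char (ψ θ : AddChar K ℂ) :
    fourierCoef (fun j => ψ j) θ = if ψ = θ then (Fintype.card K : ℂ) else 0 := by
  classical
  have h1 : fourierCoef (fun j => ψ j) θ = ∑ j, (ψ * θ⁻¹) j := by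
    refine Finset.sum_congr rfl fun j _ => ?_
    rw [AddChar.mul_apply, AddChar.inv_apply, mul_comm]
  rw [h1, AddChar.sum_eq_ite, ← AddChar.one_eq_zero]
  simp only [mul_inv_eq_one]

/-- The relation between the Fourier coefficients of two planar families of points, such that the
lines joining them have given directions. -/
theorem fourierCoef_rel {x y X Y u v : K → ℂ}
    (h : ∀ i j, u i * (y j - Y (i + j)) = v i * (x j - X (i + j))) (θ : AddChar K ℂ) (i : K) :
    u i * (fourierCoef y θ - θ i * fourierCoef Y θ) =
      v i * (fourierCoef x θ - θ i * fourierCoef X θ) := by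
  rw [← fourierCoef_shift, ← fourierCoef_shift]
  simp only [fourierCoef, ← Finset.sum_sub_distrib, Finset.mul_sum]
  refine Finset.sum_congr rfl fun j _ => ?_
  linear_combination θ (-j) * h i j

theorem eq_const_of_fourierCoef_eq_zero {f : K → ℂ} (h : ∀ θ : AddChar K ℂ, θ ≠ 1 → fourierCoef f θ = 0)
    (j k : K) : f j = f k := by
  have h1 : ∀ k, Fintype.card K * f k = fourierCoef f 1 := by
    intro k
    rw [← fourierCoef_inversion, Finset.sum_eq_single 1]
    · simp
    · intro θ _ hθ; rw [h θ hθ, zero_mul]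
    · simp
  exact mul_left_cancel₀ (Nat.cast_ne_zero.2 Fintype.card_ne_zero) ((h1 j).trans (h1 k).symm)

/-- Let `θ` be nontrivial with `θ a = θ b`, `a ≠ b`. The relations at `i` and at `i + (a - b)`
involve the same vector, the difference of the coefficients of `(x, y)` and `θ i` times those of
`(X, Y)`, but independent directions `(u, v)`, so this vector is zero for all `i`. Comparing `i = 0`
with some `θ i ≠ 1` then makes all coefficients at `θ` vanish. A nonconstant family therefore needs
a coefficient at an injective nontrivial character. -/
theorem exists_injective_addChar {x y X Y u v : K → ℂ}
    (h : ∀ i j, u i * (y j - Y (i + j)) = v i * (x j - X (i + j)))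
    (huv : ∀ i j, i ≠ j → u i * v j - u j * v i ≠ 0)
    (hxy : ∃ j k, x j ≠ x k ∨ y j ≠ y k) :
    ∃ χ : AddChar K ℂ, Function.Injective χ ∧ χ ≠ 1 ∧
      (fourierCoef x χ ≠ 0 ∨ fourierCoef y χ ≠ 0) := by
  by_contra! hcon
  have key : ∀ θ : AddChar K ℂ, θ ≠ 1 → fourierCoef x θ = 0 ∧ fourierCoef y θ = 0 := by
    intro θ hθ
    by_cases hinj : Function.Injective θ
    · exact hcon θ hinj hθ
    · obtain ⟨a, b, hab, hne⟩ : ∃ a b, θ a = θ b ∧ a ≠ b := by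
        simpa [Function.Injective] using hinj
      have hker : θ (a - b) = 1 := by
        have h1 := θ.map_add_eq_mul (a - b) b
        rw [sub_add_cancel, hab] at h1
        have h2 : θ b ≠ 0 := by
          intro h0
          have := θ.map_add_eq_mul b (-b)
          rw [h0, zero_mul, add_neg_cancel, AddChar.map_zero_eq_one] at this
          exact one_ne_zero this
        field_simp at h1
        exact h1.symm
      have hz : ∀ i, fourierCoef x θ - θ i * fourierCoef X θ = 0 ∧
          fourierCoef y θ - θ i * fourierCoef Y θ = 0 := by
        intro i
        have e1 := fourierCoef_rel h θ i
        have e2 := fourierCoef_rel h θ (i + (a - b))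
        rw [AddChar.map_add_eq_mul, hker, mul_one] at e2
        have hd := huv i (i + (a - b)) (by simpa [sub_eq_zero] using hne)
        constructor
        · refine (mul_eq_zero.1 ?_).resolve_left hd
          linear_combination u (i + (a - b)) * e1 - u i * e2
        · refine (mul_eq_zero.1 ?_).resolve_left hd
          linear_combination v (i + (a - b)) * e1 - v i * e2
      obtain ⟨i, hi⟩ : ∃ i, θ i ≠ 1 := by
        by_contra! hall
        exact hθ (by ext i; simpa using hall i)
      have h0 := hz 0
      have h1 := hz i
      rw [AddChar.map_zero_eq_one] at h0
      have hi' : θ i - 1 ≠ 0 := sub_ne_zero.2 hi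
      constructor
      · have : fourierCoef X θ = 0 := by
          refine (mul_eq_zero.1 ?_).resolve_left hi'
          linear_combination h0.1 - h1.1
        linear_combination h0.1 + this
      · have : fourierCoef Y θ = 0 := by
          refine (mul_eq_zero.1 ?_).resolve_left hi'
          linear_combination h0.2 - h1.2
        linear_combination h0.2 + this
  obtain ⟨j, k, hjk⟩ := hxy
  rcases hjk with hjk | hjk
  · exact hjk (eq_const_of_fourierCoef_eq_zero (fun θ hθ => (key θ hθ).1) j k)
  · exact hjk (eq_const_of_fourierCoef_eq_zero (fun θ hθ => (key θ hθ).2) j k)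

/-- A finite group inside the multiplicative group of a field is cyclic. -/
theorem isAddCyclic_of_injective_addChar {χ : AddChar K ℂ} (hχ : Function.Injective χ) :
    IsAddCyclic K := by
  have : IsCyclic (Multiplicative K) := by
    refine isCyclic_of_injective_ringHom (χ.toMonoidHom) ?_
    intro a b hab
    exact hχ hab
  exact isCyclic_multiplicative_iff.1 this

end Fourier

/-- The linear map with given rows. -/
def rowMap (e f g v : Fin 3 → ℂ) : Fin 3 → ℂ := ![e ⬝ᵥ v, f ⬝ᵥ v, g ⬝ᵥ v]

theorem det3_rowMap (e f g u v w : Fin 3 → ℂ) :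
    det3 (rowMap e f g u) (rowMap e f g v) (rowMap e f g w) = det3 e f g * det3 u v w := by
  simp [det3, rowMap, dot3]; ring

theorem exists_det3_ne_zero {l : Fin 3 → ℂ} (hl : l ≠ 0) : ∃ e f, det3 e f l ≠ 0 := by
  by_contra! h
  have h0 := h ![0, 1, 0] ![0, 0, 1]
  have h1 := h ![1, 0, 0] ![0, 0, 1]
  have h2 := h ![1, 0, 0] ![0, 1, 0]
  simp [det3] at h0 h1 h2
  exact hl (by ext i; fin_cases i <;> assumption)

namespace DualNet

variable {H : Type*} [AddCommGroup H] {p q r : H → Fin 3 → ℂ}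

/-- Expansion along the last column: two points at infinity not collinear with a third are different
directions, and the third point is affine. -/
theorem last_ne_zero {u v w : Fin 3 → ℂ} (hu : u 2 = 0) (hv : v 2 = 0) (h : det3 u v w ≠ 0) :
    w 2 ≠ 0 ∧ u 0 * v 1 - v 0 * u 1 ≠ 0 := by
  have e : det3 u v w = w 2 * (u 0 * v 1 - v 0 * u 1) := by
    simp only [det3, hu, hv]; ring
  rw [e] at h
  exact ⟨left_ne_zero_of_mul h, right_ne_zero_of_mul h⟩

/-- Points of the second and third family, in affine coordinates, joined by lines through points at
infinity. -/
theorem affine_rel {u v w : Fin 3 → ℂ} (hu : u 2 = 0) (hv : v 2 ≠ 0) (hw : w 2 ≠ 0)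
    (h : det3 u v w = 0) :
    u 0 * (v 1 / v 2 - w 1 / w 2) = u 1 * (v 0 / v 2 - w 0 / w 2) := by
  have e : det3 u v w = u 0 * (v 1 * w 2 - v 2 * w 1) - u 1 * (v 0 * w 2 - v 2 * w 0) := by
    simp only [det3, hu]; ring
  rw [e] at h
  field_simp
  linear_combination h

theorem affine_ne (N : DualNet p q r) {a b : H} (hne : a ≠ b) (ha : q a 2 ≠ 0) (hb : q b 2 ≠ 0) :
    q a 0 / q a 2 ≠ q b 0 / q b 2 ∨ q a 1 / q a 2 ≠ q b 1 / q b 2 := by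
  by_contra! h
  obtain ⟨h0, h1⟩ := h
  apply N.qqp a b 0 hne
  have e : q a = (q a 2 / q b 2) • q b := by
    ext i
    fin_cases i
    · simp; field_simp at h0 ⊢; linear_combination h0
    · simp; field_simp at h1 ⊢; linear_combination h1
    · simp; field_simp
  exact det3_smul_eq_zero e

/-- A group with a dual net one class of which is on a line is cyclic. -/
theorem isAddCyclic_of_collinear [Finite H] [Nontrivial H] (N : DualNet p q r) {l : Fin 3 → ℂ}
    (hl : l ≠ 0) (hp : ∀ a, p a ⬝ᵥ l = 0) : IsAddCyclic H := by
  cases nonempty_fintype H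
  obtain ⟨e, f, hef⟩ := exists_det3_ne_zero hl
  have N' := N.map (rowMap e f l) _ hef (det3_rowMap e f l)
  have hp' : ∀ a, rowMap e f l (p a) 2 = 0 := fun a => by
    simp [rowMap, dotProduct_comm l, hp]
  set p' : H → Fin 3 → ℂ := fun a => rowMap e f l (p a)
  set q' : H → Fin 3 → ℂ := fun a => rowMap e f l (q a)
  set r' : H → Fin 3 → ℂ := fun a => rowMap e f l (r a)
  obtain ⟨g, hg⟩ := exists_ne (0 : H)
  have hq' : ∀ b, q' b 2 ≠ 0 := fun b => (last_ne_zero (hp' g) (hp' 0) (N'.ppq g 0 b hg)).1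
  have hr' : ∀ b, r' b 2 ≠ 0 := fun b => (last_ne_zero (hp' g) (hp' 0) (N'.ppr g 0 b hg)).1
  -- The third family is indexed by the negative of its label, so that collinear triples have
  -- indices `i`, `j`, `i + j`.
  obtain ⟨χ, hχ, -⟩ := exists_injective_addChar (x := fun b => q' b 0 / q' b 2)
    (y := fun b => q' b 1 / q' b 2) (X := fun b => r' (-b) 0 / r' (-b) 2)
    (Y := fun b => r' (-b) 1 / r' (-b) 2) (u := fun a => p' a 0) (v := fun a => p' a 1)
    (fun i j => affine_rel (hp' i) (hq' j) (hr' _) (N'.coll _ _ _ (by abel)))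
    (fun i j hij => (last_ne_zero (hp' i) (hp' j) (N'.ppq i j 0 hij)).2)
    ⟨g, 0, N'.affine_ne hg (hq' _) (hq' _)⟩
  exact isAddCyclic_of_injective_addChar hχ

end DualNet

/-! ### Collinearity spreads from a coset to the whole class -/

section Fourier

variable {K : Type*} [AddCommGroup K] [Fintype K]

theorem sum_addChar_triple {χ : AddChar K ℂ} (h1 : χ ≠ 1) (h2 : χ * χ ≠ 1) {g : AddChar K ℂ → ℂ}
    (hg : ∀ θ, θ ≠ 1 → θ ≠ χ → θ ≠ χ⁻¹ → g θ = 0) : ∑ θ, g θ = g 1 + g χ + g χ⁻¹ := by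
  classical
  have h3 : χ ≠ χ⁻¹ := fun h => h2 (by nth_rewrite 2 [h]; exact mul_inv_cancel χ)
  rw [← Finset.sum_subset (Finset.subset_univ {1, χ, χ⁻¹}), Finset.sum_insert, Finset.sum_pair h3,
    add_assoc]
  · simp [h1, h1.symm]
  · intro θ _ hθ
    simp only [Finset.mem_insert, Finset.mem_singleton, not_or] at hθ
    exact hg θ hθ.1 hθ.2.1 hθ.2.2

/-- Linear independence of characters, phrased through Fourier coefficients so that it can be used
when some of `1`, `ψ`, `χ`, `χ * ψ` coincide. -/
theorem fourierCoef_four {a b c d : ℂ} {ψ χ : AddChar K ℂ}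
    (h : ∀ i, a - b * ψ i - c * χ i + d * (χ i * ψ i) = 0) (θ : AddChar K ℂ) :
    a * (if 1 = θ then 1 else 0) - b * (if ψ = θ then 1 else 0) - c * (if χ = θ then 1 else 0) +
      d * (if χ * ψ = θ then 1 else 0) = 0 := by
  have e : a * fourierCoef (fun j => (1 : AddChar K ℂ) j) θ - b * fourierCoef (fun j => ψ j) θ -
      c * fourierCoef (fun j => χ j) θ + d * fourierCoef (fun j => (χ * ψ) j) θ = 0 := by
    simp only [fourierCoef, Finset.mul_sum, ← Finset.sum_sub_distrib, ← Finset.sum_add_distrib]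
    refine Finset.sum_eq_zero fun j _ => ?_
    rw [AddChar.mul_apply, AddChar.one_apply]
    linear_combination θ (-j) * h j
  have hc : ∀ φ : AddChar K ℂ, fourierCoef (fun j => φ j) θ =
      Fintype.card K * if φ = θ then 1 else 0 := fun φ => by simp [fourierCoef_char]
  simp only [hc] at e
  have hn : (Fintype.card K : ℂ) ≠ 0 := Nat.cast_ne_zero.2 Fintype.card_ne_zero
  refine (mul_eq_zero.1 ?_).resolve_left hn
  linear_combination e

/-- Two vectors of the plane orthogonal to the same nonzero vector are proportional. -/
theorem cross_eq_zero_of_orth {u v a b c d : ℂ} (h : u ≠ 0 ∨ v ≠ 0) (h1 : u * a = v * b)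
    (h2 : u * c = v * d) : b * c - a * d = 0 := by
  rcases h with h | h
  · refine (mul_eq_zero.1 ?_).resolve_left h
    linear_combination b * h2 - d * h1
  · refine (mul_eq_zero.1 ?_).resolve_left h
    linear_combination a * h2 - c * h1

theorem eq_zero_of_cross {ex ey gx gy a b : ℂ} (hD : ex * gy - gx * ey ≠ 0)
    (h1 : ex * b - ey * a = 0) (h2 : gx * b - gy * a = 0) : a = 0 ∧ b = 0 := by
  constructor
  · refine (mul_eq_zero.1 ?_).resolve_left hD
    linear_combination gx * h1 - ex * h2
  · refine (mul_eq_zero.1 ?_).resolve_left hD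
    linear_combination gy * h1 - ey * h2

/-- The Fourier coefficients of two families of points, such that the lines joining them have
directions that are parametrized by a character `χ`. -/
theorem fourierCoef_of_directions {ex ey gx gy a b c d : ℂ} {χ ψ : AddChar K ℂ} (h1 : χ ≠ 1)
    (h2 : χ * χ ≠ 1) (hD : ex * gy - gx * ey ≠ 0)
    (h : ∀ i, (ex - χ i * gx) * (b - ψ i * d) - (ey - χ i * gy) * (a - ψ i * c) = 0) :
    (ψ = 1 → a = c ∧ b = d) ∧
    (ψ = χ → ∃ t, a = t * ex ∧ b = t * ey ∧ c = t * gx ∧ d = t * gy) ∧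
    (ψ = χ⁻¹ → ∃ t, a = t * gx ∧ b = t * gy ∧ c = t * ex ∧ d = t * ey) ∧
    (ψ ≠ 1 → ψ ≠ χ → ψ ≠ χ⁻¹ → a = 0 ∧ b = 0 ∧ c = 0 ∧ d = 0) := by
  -- Expanded, the cross product is a combination of `1`, `ψ`, `χ`, `χ * ψ`. The four claims
  -- correspond to the possible coincidences among these characters.
  have h' : ∀ i, (ex * b - ey * a) - (ex * d - ey * c) * ψ i - (gx * b - gy * a) * χ i +
      (gx * d - gy * c) * (χ i * ψ i) = 0 := fun i => by linear_combination h i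
  have F := fourierCoef_four h'
  refine ⟨?_, ?_, ?_, ?_⟩
  · rintro rfl
    have F1 := F 1
    have F2 := F χ
    simp only [mul_one, if_true, h1, h1.symm, if_false, mul_zero] at F1 F2
    have := eq_zero_of_cross hD (a := a - c) (b := b - d) (by linear_combination F1)
      (by linear_combination -F2)
    exact ⟨sub_eq_zero.1 this.1, sub_eq_zero.1 this.2⟩
  · rintro rfl
    have hm : ψ * ψ ≠ ψ := fun h => h1 (mul_eq_left.1 h)
    have F1 := F 1
    have F2 := F ψ
    have F3 := F (ψ * ψ)
    simp only [mul_one, if_true, h1, h1.symm, h2, h2.symm, hm, hm.symm, if_false, mul_zero]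
      at F1 F2 F3
    refine ⟨(a * gy - gx * b) / (ex * gy - gx * ey), ?_, ?_, ?_, ?_⟩ <;> rw [div_mul_eq_mul_div, eq_div_iff hD]
    · linear_combination gx * F1
    · linear_combination gy * F1
    · linear_combination -gx * F2 - ex * F3
    · linear_combination -gy * F2 - ey * F3
  · intro hψ
    have hm : χ * ψ = 1 := by rw [hψ, mul_inv_cancel]
    have h3 : ψ ≠ 1 := by rw [hψ]; simpa using h1
    have h4 : χ ≠ ψ := fun h => h2 (by nth_rewrite 2 [h]; exact hm)
    have F1 := F 1
    have F2 := F χ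
    have F3 := F ψ
    simp only [hm, mul_one, if_true, h1, h1.symm, h3, h3.symm, h4, h4.symm, if_false, mul_zero]
      at F1 F2 F3
    refine ⟨(ex * b - ey * a) / (ex * gy - gx * ey), ?_, ?_, ?_, ?_⟩ <;> rw [div_mul_eq_mul_div, eq_div_iff hD]
    · linear_combination ex * F2
    · linear_combination ey * F2
    · linear_combination -ex * F1 - gx * F3
    · linear_combination -ey * F1 - gy * F3
  · intro h3 h4 h5
    have h6 : χ * ψ ≠ 1 := fun h => h5 (eq_inv_of_mul_eq_one_right h)
    have h7 : χ * ψ ≠ χ := fun h => h3 (mul_eq_left.1 h)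
    have h8 : χ * ψ ≠ ψ := fun h => h1 (mul_eq_right.1 h)
    have F1 := F 1
    have F2 := F χ
    have F3 := F ψ
    have F4 := F (χ * ψ)
    simp only [mul_one, if_true, h1, h1.symm, h3, h3.symm, h4, h4.symm, h6, h6.symm, h7, h7.symm,
      h8, h8.symm, if_false, mul_zero] at F1 F2 F3 F4
    have A := eq_zero_of_cross hD (a := a) (b := b) (by linear_combination F1)
      (by linear_combination -F2)
    have B := eq_zero_of_cross hD (a := c) (b := d) (by linear_combination -F3)
      (by linear_combination F4)
    exact ⟨A.1, A.2, B.1, B.2⟩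

/-- Two planar families of points, such that the lines joining them have directions that are
parametrized by a character `χ`, are themselves parametrized by `χ`. -/
theorem exists_param {x y X Y u v : K → ℂ} {ex ey gx gy : ℂ} {χ : AddChar K ℂ} (h1 : χ ≠ 1)
    (h2 : χ * χ ≠ 1) (hD : ex * gy - gx * ey ≠ 0)
    (h : ∀ i j, u i * (y j - Y (i + j)) = v i * (x j - X (i + j)))
    (huv : ∀ i, u i ≠ 0 ∨ v i ≠ 0)
    (hdir : ∀ i, u i * (ey - χ i * gy) = v i * (ex - χ i * gx)) :
    ∃ ox oy s t, ∀ j, x j = ox + s * χ j * ex + t * χ (-j) * gx ∧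
      y j = oy + s * χ j * ey + t * χ (-j) * gy ∧
      X j = ox + s * χ j * gx + t * χ (-j) * ex ∧
      Y j = oy + s * χ j * gy + t * χ (-j) * ey := by
  -- At every frequency `ψ` the vector of coefficients is parallel to `e - χ i • g`. Hence only the
  -- frequencies `1`, `χ`, `χ⁻¹` survive, and inversion gives the parametrization.
  have key := fun ψ => fourierCoef_of_directions (ψ := ψ) h1 h2 hD
    (fun i => cross_eq_zero_of_orth (huv i) (hdir i) (fourierCoef_rel h ψ i))
  obtain ⟨k1, k2⟩ := (key 1).1 rfl
  obtain ⟨s, s1, s2, s3, s4⟩ := (key χ).2.1 rfl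
  obtain ⟨t, t1, t2, t3, t4⟩ := (key χ⁻¹).2.2.1 rfl
  have k3 := fun ψ => (key ψ).2.2.2
  have hn : (Fintype.card K : ℂ) ≠ 0 := Nat.cast_ne_zero.2 Fintype.card_ne_zero
  have inv : ∀ f : K → ℂ, (∀ θ : AddChar K ℂ, θ ≠ 1 → θ ≠ χ → θ ≠ χ⁻¹ → fourierCoef f θ = 0) →
      ∀ j, f j = (fourierCoef f 1 + fourierCoef f χ * χ j + fourierCoef f χ⁻¹ * χ (-j)) /
        Fintype.card K := by
    intro f hf j
    rw [eq_div_iff hn, mul_comm, ← fourierCoef_inversion, sum_addChar_triple h1 h2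
      (fun θ a b c => by rw [hf θ a b c, zero_mul])]
    simp [AddChar.inv_apply]
  refine ⟨fourierCoef x 1 / Fintype.card K, fourierCoef y 1 / Fintype.card K,
    s / Fintype.card K, t / Fintype.card K, fun j => ⟨?_, ?_, ?_, ?_⟩⟩
  · rw [inv x (fun θ a b c => (k3 θ a b c).1), s1, t1]; ring
  · rw [inv y (fun θ a b c => (k3 θ a b c).2.1), s2, t2]; ring
  · rw [inv X (fun θ a b c => (k3 θ a b c).2.2.1), s3, t3, k1]; ring
  · rw [inv Y (fun θ a b c => (k3 θ a b c).2.2.2), s4, t4, k2]; ring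

end Fourier

/-- The vectors that parametrize the directions are independent. -/
theorem cross_ne_zero_of_directions {K : Type*} [AddCommGroup K] {u v : K → ℂ} {ex ey gx gy : ℂ} {χ : AddChar K ℂ}
    (hχ : Function.Injective χ) {g₁ g₂ g₃ : K} (h12 : g₁ ≠ g₂) (h13 : g₁ ≠ g₃) (h23 : g₂ ≠ g₃)
    (hE : ex ≠ 0 ∨ ey ≠ 0) (huv : ∀ i j, i ≠ j → u i * v j - u j * v i ≠ 0)
    (hdir : ∀ i, u i * (ey - χ i * gy) = v i * (ex - χ i * gx)) : ex * gy - gx * ey ≠ 0 := by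
  -- If `e` and `g` were dependent, each nonzero `e - χ i • g` would be parallel to `e`. By `B` this
  -- vector is nonzero for at most one `i`, as the directions differ. By `C` it is zero for at most
  -- one `i`, as `χ` is injective. Three indices are too many.
  intro hD
  have A : ∀ i, (ex - χ i * gx ≠ 0 ∨ ey - χ i * gy ≠ 0) → u i * ey = v i * ex := by
    intro i hi
    have h1 := hdir i
    rcases hi with hi | hi
    · rw [← sub_eq_zero]
      refine (mul_eq_zero.1 ?_).resolve_left hi
      linear_combination ex * h1 + u i * χ i * hD
    · rw [← sub_eq_zero]
      refine (mul_eq_zero.1 ?_).resolve_left hi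
      linear_combination ey * h1 + v i * χ i * hD
  have B : ∀ i j, i ≠ j → (ex - χ i * gx ≠ 0 ∨ ey - χ i * gy ≠ 0) →
      ¬ (ex - χ j * gx ≠ 0 ∨ ey - χ j * gy ≠ 0) := by
    intro i j hij hi hj
    have h1 := A i hi
    have h2 := A j hj
    apply huv i j hij
    rcases hE with hE | hE
    · refine (mul_eq_zero.1 ?_).resolve_left hE
      linear_combination u j * h1 - u i * h2
    · refine (mul_eq_zero.1 ?_).resolve_left hE
      linear_combination v j * h1 - v i * h2
  have C : ∀ i j, i ≠ j → ex - χ i * gx = 0 ∧ ey - χ i * gy = 0 →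
      (ex - χ j * gx ≠ 0 ∨ ey - χ j * gy ≠ 0) := by
    intro i j hij hi
    by_contra! hj
    have hne : χ i - χ j ≠ 0 := sub_ne_zero.2 (hχ.ne hij)
    have hgx : gx = 0 := by
      refine (mul_eq_zero.1 ?_).resolve_left hne
      linear_combination hj.1 - hi.1
    have hgy : gy = 0 := by
      refine (mul_eq_zero.1 ?_).resolve_left hne
      linear_combination hj.2 - hi.2
    rw [hgx, hgy] at hi
    simp at hi
    rcases hE with hE | hE
    · exact hE hi.1
    · exact hE hi.2
  by_cases c1 : ex - χ g₁ * gx = 0 ∧ ey - χ g₁ * gy = 0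
  · exact B g₂ g₃ h23 (C g₁ g₂ h12 c1) (C g₁ g₃ h13 c1)
  · have c1' : ex - χ g₁ * gx ≠ 0 ∨ ey - χ g₁ * gy ≠ 0 := by
      by_contra! h; exact c1 h
    have c2 : ex - χ g₂ * gx = 0 ∧ ey - χ g₂ * gy = 0 := by
      by_contra! h
      exact B g₁ g₂ h12 c1' (by by_contra! h'; exact h h'.1 h'.2)
    exact B g₁ g₃ h13 c1' (C g₂ g₃ h23 c2)

open Polynomial in
/-- A Laurent polynomial of degree between `-2` and `2` with five nonzero roots is zero. -/
theorem laurent_coeffs_eq_zero {c : Fin 5 → ℂ} {z : Fin 5 → ℂ} (hz : Function.Injective z)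
    (h : ∀ k, c 4 * z k ^ 4 + c 3 * z k ^ 3 + c 2 * z k ^ 2 + c 1 * z k + c 0 = 0) :
    c 4 = 0 ∧ c 3 = 0 ∧ c 1 = 0 ∧ c 0 = 0 := by
  set P : ℂ[X] := C (c 4) * X ^ 4 + C (c 3) * X ^ 3 + C (c 2) * X ^ 2 + C (c 1) * X + C (c 0)
    with hP
  have hdeg : P.natDegree ≤ 4 := by rw [hP]; compute_degree
  have h0 : P = 0 := by
    refine Polynomial.eq_zero_of_natDegree_lt_card_of_eval_eq_zero P hz (fun k => ?_) ?_
    · simpa [hP] using h k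
    · simpa using Nat.lt_succ_of_le hdeg
  have hc : ∀ n, P.coeff n = 0 := fun n => by rw [h0, coeff_zero]
  have c4 := hc 4
  have c3 := hc 3
  have c1 := hc 1
  have c0 := hc 0
  simp [hP, coeff_X, coeff_C] at c4 c3 c1 c0
  exact ⟨c4, c3, c1, c0⟩

namespace DualNet

variable {H : Type*} [AddCommGroup H] {p q r : H → Fin 3 → ℂ}

/-- If one class of a subnet of order at least five is on the line at infinity, then so is the whole
class. -/
theorem last_eq_zero_of_restrict (N : DualNet p q r) {K : Type*} [AddCommGroup K] [Finite K]
    (f : K →+ H) (hf : Function.Injective f) {g : K} (hg : 5 ≤ addOrderOf g)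
    (hp : ∀ k, p (f k) 2 = 0) (a : H) : p a 2 = 0 := by
  cases nonempty_fintype K
  have hsmul : ∀ m n : ℕ, m < 5 → n < 5 → m • g = n • g → m = n := by
    intro m n hm hn h
    exact nsmul_injOn_Iio_addOrderOf (by simp; omega) (by simp; omega) h
  have hg0 : g ≠ 0 := fun h => by
    have := hsmul 1 0 (by norm_num) (by norm_num) (by simp [h]); omega
  have hfg : f g ≠ f 0 := hf.ne hg0
  have hq : ∀ b, q b 2 ≠ 0 := fun b => (last_ne_zero (hp g) (hp 0) (N.ppq _ _ b hfg)).1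
  have hr : ∀ b, r b 2 ≠ 0 := fun b => (last_ne_zero (hp g) (hp 0) (N.ppr _ _ b hfg)).1
  have rel : ∀ (b : H) (i j : K),
      p (f i) 0 * (q (b + f j) 1 / q (b + f j) 2 - r (-(b + f (i + j))) 1 / r (-(b + f (i + j))) 2) =
      p (f i) 1 * (q (b + f j) 0 / q (b + f j) 2 - r (-(b + f (i + j))) 0 / r (-(b + f (i + j))) 2) :=
    fun b i j => affine_rel (hp i) (hq _) (hr _) (N.coll _ _ _ (by rw [map_add]; abel))
  have hdet : ∀ i j, i ≠ j → p (f i) 0 * p (f j) 1 - p (f j) 0 * p (f i) 1 ≠ 0 :=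
    fun i j hij => (last_ne_zero (hp i) (hp j) (N.ppq _ _ 0 (hf.ne hij))).2
  have hne : ∀ (b : H), ∃ j k : K, q (b + f j) 0 / q (b + f j) 2 ≠ q (b + f k) 0 / q (b + f k) 2 ∨
      q (b + f j) 1 / q (b + f j) 2 ≠ q (b + f k) 1 / q (b + f k) 2 :=
    fun b => ⟨g, 0, N.affine_ne (by simpa using hfg) (hq _) (hq _)⟩
  have huv : ∀ i, p (f i) 0 ≠ 0 ∨ p (f i) 1 ≠ 0 := by
    intro i
    by_contra! h
    obtain ⟨j, hj⟩ : ∃ j, j ≠ i := ⟨i + g, by simpa using hg0⟩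
    exact hdet i j hj.symm (by rw [h.1, h.2]; ring)
  obtain ⟨χ, hχ, hχ1, hE⟩ := exists_injective_addChar (x := fun j => q (0 + f j) 0 / q (0 + f j) 2)
    (y := fun j => q (0 + f j) 1 / q (0 + f j) 2) (X := fun j => r (-(0 + f j)) 0 / r (-(0 + f j)) 2)
    (Y := fun j => r (-(0 + f j)) 1 / r (-(0 + f j)) 2) (u := fun i => p (f i) 0)
    (v := fun i => p (f i) 1) (rel 0) hdet (hne 0)
  have hdir := fourierCoef_rel (x := fun j => q (0 + f j) 0 / q (0 + f j) 2)
    (y := fun j => q (0 + f j) 1 / q (0 + f j) 2) (X := fun j => r (-(0 + f j)) 0 / r (-(0 + f j)) 2)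
    (Y := fun j => r (-(0 + f j)) 1 / r (-(0 + f j)) 2) (u := fun i => p (f i) 0)
    (v := fun i => p (f i) 1) (rel 0) χ
  generalize fourierCoef (fun j => q (0 + f j) 0 / q (0 + f j) 2) χ = ex at hE hdir
  generalize fourierCoef (fun j => q (0 + f j) 1 / q (0 + f j) 2) χ = ey at hE hdir
  generalize fourierCoef (fun j => r (-(0 + f j)) 0 / r (-(0 + f j)) 2) χ = gx at hdir
  generalize fourierCoef (fun j => r (-(0 + f j)) 1 / r (-(0 + f j)) 2) χ = gy at hdir
  have hχz : Function.Injective fun k : Fin 5 => χ ((k : ℕ) • g) := by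
    intro k l hkl
    exact Fin.ext (hsmul k l k.2 l.2 (hχ hkl))
  have hχ2 : χ * χ ≠ 1 := by
    intro h
    have h1 : χ (2 • g) = χ (0 • g) := by
      rw [two_nsmul, AddChar.map_add_eq_mul, ← AddChar.mul_apply, h]; simp
    have := hsmul 2 0 (by norm_num) (by norm_num) (hχ h1)
    omega
  have hD : ex * gy - gx * ey ≠ 0 := cross_ne_zero_of_directions hχ (g₁ := 0) (g₂ := g)
    (g₃ := 2 • g) hg0.symm
    (fun h => by have := hsmul 0 2 (by norm_num) (by norm_num) (by simpa using h); omega)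
    (fun h => by have := hsmul 1 2 (by norm_num) (by norm_num) (by simpa using h); omega)
    hE hdet hdir
  -- The character `χ` and the vectors `e`, `g` were found on the coset of `0`. They serve every
  -- coset, because the directions `p (f i)` are the same for all `b`; only the center and the
  -- scalars `s`, `t` change.
  have param := fun b => exists_param (x := fun j => q (b + f j) 0 / q (b + f j) 2)
    (y := fun j => q (b + f j) 1 / q (b + f j) 2) (X := fun j => r (-(b + f j)) 0 / r (-(b + f j)) 2)
    (Y := fun j => r (-(b + f j)) 1 / r (-(b + f j)) 2) (u := fun i => p (f i) 0)
    (v := fun i => p (f i) 1) hχ1 hχ2 hD (rel b) huv hdir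
  obtain ⟨ox, oy, s, t, hQ⟩ := param 0
  obtain ⟨ox', oy', s', t', hR⟩ := param (0 + a)
  -- neither family is constant
  have hst : s ≠ 0 ∨ t ≠ 0 := by
    by_contra! h
    obtain ⟨j, k, hjk⟩ := hne 0
    have h1 := hQ j
    have h2 := hQ k
    simp only [h.1, h.2, zero_mul, add_zero] at h1 h2
    rcases hjk with hjk | hjk
    · exact hjk (h1.1.trans h2.1.symm)
    · exact hjk (h1.2.1.trans h2.2.1.symm)
  have hst' : s' ≠ 0 ∨ t' ≠ 0 := by
    by_contra! h
    obtain ⟨j, k, hjk⟩ := hne (0 + a)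
    have h1 := hR j
    have h2 := hR k
    simp only [h.1, h.2, zero_mul, add_zero] at h1 h2
    rcases hjk with hjk | hjk
    · exact hjk (h1.1.trans h2.1.symm)
    · exact hjk (h1.2.1.trans h2.2.1.symm)
  set u := p a 0 with hu
  set v := p a 1 with hv
  set w := p a 2 with hw
  have hzinv : ∀ j, χ j * χ (-j) = 1 := fun j => by
    rw [← AddChar.map_add_eq_mul, add_neg_cancel, AddChar.map_zero_eq_one]
  -- The collinearity of `p a = (u : v : w)` with points of two parametrized cosets is a Laurent
  -- polynomial in `χ j` with exponents from `-2` to `2`.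
  have hline : ∀ j : K,
      (ox + s * χ j * ex + t * χ (-j) * gx) * w * (oy' + s' * χ j * gy + t' * χ (-j) * ey) -
      (oy + s * χ j * ey + t * χ (-j) * gy) * w * (ox' + s' * χ j * gx + t' * χ (-j) * ex) +
      u * ((oy + s * χ j * ey + t * χ (-j) * gy) - (oy' + s' * χ j * gy + t' * χ (-j) * ey)) -
      v * ((ox + s * χ j * ex + t * χ (-j) * gx) - (ox' + s' * χ j * gx + t' * χ (-j) * ex)) = 0 := by
    intro j
    obtain ⟨e1, e2, -, -⟩ := hQ j
    obtain ⟨-, -, e3, e4⟩ := hR j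
    have h0 := N.coll a (0 + f j) (-(0 + a + f j)) (by abel)
    rw [← e1, ← e2, ← e3, ← e4]
    have := hq (0 + f j)
    have := hr (-(0 + a + f j))
    simp only [det3] at h0
    field_simp
    linear_combination h0
  -- The multiples `k • g` with `k < 5` give five different zeros; this is where order at least five
  -- is needed. Coefficients are listed from the lowest exponent up.
  obtain ⟨c4, c3, c1, c0⟩ := laurent_coeffs_eq_zero (c := ![
    w * (t * t') * (gx * ey - gy * ex),
    w * t' * (ox * ey - oy * ex) + w * t * (gx * oy' - gy * ox') + u * (t * gy - t' * ey) -
      v * (t * gx - t' * ex),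
    w * (ox * oy' - oy * ox' + (s * t') * (ex * ey - ey * ex) + (t * s') * (gx * gy - gy * gx)) +
      u * (oy - oy') - v * (ox - ox'),
    w * s' * (ox * gy - oy * gx) + w * s * (ex * oy' - ey * ox') + u * (s * ey - s' * gy) -
      v * (s * ex - s' * gx),
    w * (s * s') * (ex * gy - ey * gx)]) hχz (by
      intro k
      have h1 := hline ((k : ℕ) • g)
      have h2 := hzinv ((k : ℕ) • g)
      generalize χ ((k : ℕ) • g) = z at h1 h2
      generalize χ (-((k : ℕ) • g)) = y at h1 h2
      have hz : z ≠ 0 := left_ne_zero_of_mul_eq_one h2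
      have hy : y = 1 / z := by field_simp; linear_combination h2
      subst hy
      simp only [Matrix.cons_val]
      field_simp at h1
      linear_combination h1)
  simp only [Matrix.cons_val] at c4 c3 c1 c0
  -- If `w ≠ 0`, the extreme coefficients give `s * s' = 0` and `t * t' = 0`. Then `q (0 + f j)`
  -- runs along a line in direction `g` or `e`, and a second coefficient puts `p a` on that line,
  -- which `qqp` forbids.
  by_contra hw0
  have hs : s * s' = 0 := by
    refine (mul_eq_zero.1 ?_).resolve_left hD
    refine (mul_eq_zero.1 ?_).resolve_left hw0
    linear_combination c4
  have ht : t * t' = 0 := by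
    refine (mul_eq_zero.1 ?_).resolve_left hD
    refine (mul_eq_zero.1 ?_).resolve_left hw0
    linear_combination -c0
  -- the points of one class are on a line through `p a`
  have hcon : ∀ (d e : ℂ) (τ : K → ℂ), d * (v - w * oy) - e * (u - w * ox) = 0 →
      (∀ j, q (0 + f j) 0 / q (0 + f j) 2 = ox + τ j * d) →
      (∀ j, q (0 + f j) 1 / q (0 + f j) 2 = oy + τ j * e) → False := by
    intro d e τ h0 h1 h2
    apply N.qqp (0 + f g) (0 + f 0) a (by simpa using hfg)
    have a1 := h1 g
    have a2 := h2 g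
    have b1 := h1 0
    have b2 := h2 0
    rw [div_eq_iff (hq _)] at a1 a2 b1 b2
    simp only [det3, a1, a2, b1, b2, ← hu, ← hv, ← hw]
    linear_combination -(q (0 + f g) 2) * (q (0 + f 0) 2) * (τ g - τ 0) * h0
  rcases mul_eq_zero.1 hs with hs | hs
  · have ht0 : t ≠ 0 := hst.resolve_left (not_not.2 hs)
    have ht' : t' = 0 := (mul_eq_zero.1 ht).resolve_left ht0
    have hs' : s' ≠ 0 := hst'.resolve_right (not_not.2 ht')
    refine hcon gx gy (fun j => t * χ (-j)) ?_ (fun j => ?_) fun j => ?_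
    · refine (mul_eq_zero.1 ?_).resolve_left hs'
      rw [hs] at c3
      linear_combination c3
    · rw [(hQ j).1, hs]; ring
    · rw [(hQ j).2.1, hs]; ring
  · have ht' : t' ≠ 0 := hst'.resolve_left (not_not.2 hs)
    have ht0 : t = 0 := (mul_eq_zero.1 ht).resolve_right ht'
    refine hcon ex ey (fun j => s * χ j) ?_ (fun j => ?_) fun j => ?_
    · refine (mul_eq_zero.1 ?_).resolve_left ht'
      rw [ht0] at c1
      linear_combination c1
    · rw [(hQ j).1, ht0]; ring
    · rw [(hQ j).2.1, ht0]; ring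

/-- A group with a dual net is cyclic if a class of a subnet of order at least five is on a line. -/
theorem isAddCyclic_of_collinear_coset [Finite H] (N : DualNet p q r) {K : Type*} [AddCommGroup K]
    [Finite K] (f : K →+ H) (hf : Function.Injective f) {g : K} (hg : 5 ≤ addOrderOf g) {α : H}
    {l : Fin 3 → ℂ} (hl : l ≠ 0) (hp : ∀ k, p (α + f k) ⬝ᵥ l = 0) : IsAddCyclic H := by
  have hg0 : f g ≠ 0 := by
    rw [← map_zero f]
    refine hf.ne ?_
    rintro rfl
    simp at hg
  have : Nontrivial H := ⟨_, _, hg0⟩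
  -- Relabelling by `α` and `-α` moves the collinear coset to the subgroup itself.
  have N1 := N.restrict (AddMonoidHom.id H) Function.injective_id (α := α) (β := 0) (γ := -α)
    (by abel)
  obtain ⟨e, e', he⟩ := exists_det3_ne_zero hl
  have N2 := N1.map (rowMap e e' l) _ he (det3_rowMap e e' l)
  have h2 := N2.last_eq_zero_of_restrict f hf hg (fun k => by
    simpa [rowMap, dotProduct_comm l] using hp k)
  refine N1.isAddCyclic_of_collinear hl fun a => ?_
  simpa [rowMap, dotProduct_comm l] using h2 a

end DualNet

/-! ### Cubic forms and the theorem of Chasles -/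

/-- The ternary cubic form with given coefficients. -/
def cubicForm (c : Fin 10 → ℂ) (v : Fin 3 → ℂ) : ℂ :=
  c 0 * v 0 ^ 3 + c 1 * (v 0 ^ 2 * v 1) + c 2 * (v 0 ^ 2 * v 2) + c 3 * (v 0 * v 1 ^ 2) +
    c 4 * (v 0 * v 1 * v 2) + c 5 * (v 0 * v 2 ^ 2) + c 6 * v 1 ^ 3 + c 7 * (v 1 ^ 2 * v 2) +
    c 8 * (v 1 * v 2 ^ 2) + c 9 * v 2 ^ 3

/-- The ternary quadratic form with given coefficients. -/
def quadForm (c : Fin 6 → ℂ) (v : Fin 3 → ℂ) : ℂ :=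
  c 0 * v 0 ^ 2 + c 1 * (v 0 * v 1) + c 2 * (v 0 * v 2) + c 3 * v 1 ^ 2 + c 4 * (v 1 * v 2) +
    c 5 * v 2 ^ 2

/-- The cross product. -/
def cross (u v : Fin 3 → ℂ) : Fin 3 → ℂ :=
  ![u 1 * v 2 - u 2 * v 1, u 2 * v 0 - u 0 * v 2, u 0 * v 1 - u 1 * v 0]

theorem cross_dot (u v w : Fin 3 → ℂ) : cross u v ⬝ᵥ w = det3 u v w := by
  rw [dot3]; simp [cross, det3]; ring

theorem vec_eq (v : Fin 3 → ℂ) :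
    v = v 0 • ![1, 0, 0] + v 1 • ![0, 1, 0] + v 2 • ![0, 0, 1] := by
  ext i; fin_cases i <;> simp

theorem linearMap_apply (A : (Fin 3 → ℂ) →ₗ[ℂ] (Fin 3 → ℂ)) (v : Fin 3 → ℂ) (i : Fin 3) :
    A v i = v 0 * A ![1, 0, 0] i + v 1 * A ![0, 1, 0] i + v 2 * A ![0, 0, 1] i := by
  calc A v i = A (v 0 • ![1, 0, 0] + v 1 • ![0, 1, 0] + v 2 • ![0, 0, 1]) i := by rw [← vec_eq v]
    _ = _ := by
      rw [map_add, map_add, map_smul, map_smul, map_smul]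
      simp only [Pi.add_apply, Pi.smul_apply, smul_eq_mul]

/-- Substituting linear forms into a cubic form gives a cubic form. -/
theorem exists_cubicForm_comp (c : Fin 10 → ℂ) (A : (Fin 3 → ℂ) →ₗ[ℂ] (Fin 3 → ℂ)) :
    ∃ c', ∀ v, cubicForm c' v = cubicForm c (A v) := by
  set a := A ![1, 0, 0]
  set b := A ![0, 1, 0]
  set d := A ![0, 0, 1]
  let F := cubicForm c
  -- The coefficients are recovered by polarization, from values at sums and differences of the
  -- columns `a`, `b`, `d`.
  refine ⟨![F a, (F (a + b) - F (a - b)) / 2 - F b, (F (a + d) - F (a - d)) / 2 - F d,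
    (F (a + b) + F (a - b)) / 2 - F a,
    F (a + b + d) - F (a + b) - F (a + d) - F (b + d) + F a + F b + F d,
    (F (a + d) + F (a - d)) / 2 - F a, F b, (F (b + d) - F (b - d)) / 2 - F d,
    (F (b + d) + F (b - d)) / 2 - F b, F d], fun v => ?_⟩
  simp only [F, cubicForm, linearMap_apply A v, Pi.add_apply, Pi.sub_apply, Matrix.cons_val]
  ring

theorem exists_quadForm_comp (c : Fin 6 → ℂ) (A : (Fin 3 → ℂ) →ₗ[ℂ] (Fin 3 → ℂ)) :
    ∃ c', ∀ v, quadForm c' v = quadForm c (A v) := by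
  set a := A ![1, 0, 0]
  set b := A ![0, 1, 0]
  set d := A ![0, 0, 1]
  let F := quadForm c
  refine ⟨![F a, F (a + b) - F a - F b, F (a + d) - F a - F d, F b, F (b + d) - F b - F d, F d],
    fun v => ?_⟩
  simp only [F, quadForm, linearMap_apply A v, Pi.add_apply, Matrix.cons_val]
  ring

/-- The coefficients of a cubic form are determined by its values. -/
theorem eq_zero_of_cubicForm_eq_zero {c : Fin 10 → ℂ} (h : ∀ v, cubicForm c v = 0) : c = 0 := by
  have h1 := h ![1, 0, 0]
  have h2 := h ![0, 1, 0]
  have h3 := h ![0, 0, 1]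
  have h4 := h ![1, 1, 0]
  have h5 := h ![1, -1, 0]
  have h6 := h ![1, 0, 1]
  have h7 := h ![1, 0, -1]
  have h8 := h ![0, 1, 1]
  have h9 := h ![0, 1, -1]
  have h10 := h ![1, 1, 1]
  simp [cubicForm] at h1 h2 h3
  simp [cubicForm, h1, h2, h3] at h4 h5 h6 h7 h8 h9 h10
  have e1 : c 1 = 0 := by linear_combination h4 / 2 - h5 / 2
  have e3 : c 3 = 0 := by linear_combination h4 / 2 + h5 / 2
  have e2 : c 2 = 0 := by linear_combination h6 / 2 - h7 / 2
  have e5 : c 5 = 0 := by linear_combination h6 / 2 + h7 / 2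
  have e7 : c 7 = 0 := by linear_combination h8 / 2 - h9 / 2
  have e8 : c 8 = 0 := by linear_combination h8 / 2 + h9 / 2
  have e4 : c 4 = 0 := by linear_combination h10 - e1 - e2 - e3 - e5 - e7 - e8
  ext i; fin_cases i <;> assumption

/-- There is a cubic through any nine points. -/
theorem exists_cubicForm_through (w : Fin 9 → Fin 3 → ℂ) :
    ∃ c, c ≠ 0 ∧ ∀ i, cubicForm c (w i) = 0 := by
  let L : (Fin 10 → ℂ) →ₗ[ℂ] (Fin 9 → ℂ) :=
    { toFun := fun c i => cubicForm c (w i)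
      map_add' := by intro c d; ext i; simp [cubicForm]; ring
      map_smul' := by intro t c; ext i; simp [cubicForm]; ring }
  have h : LinearMap.ker L ≠ ⊥ := LinearMap.ker_ne_bot_of_finrank_lt (by simp)
  obtain ⟨c, hc, hc0⟩ := (Submodule.ne_bot_iff _).1 h
  exact ⟨c, hc0, fun i => congrFun (LinearMap.mem_ker.1 hc) i⟩

/-- A linear change of coordinates with given rows. -/
theorem exists_equiv_rows {e f g : Fin 3 → ℂ} (h : det3 e f g ≠ 0) :
    ∃ A : (Fin 3 → ℂ) ≃ₗ[ℂ] (Fin 3 → ℂ), ∀ v, A v = rowMap e f g v := by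
  let L : (Fin 3 → ℂ) →ₗ[ℂ] (Fin 3 → ℂ) :=
    { toFun := rowMap e f g
      map_add' := by intro v w; simp [rowMap, dotProduct_add]
      map_smul' := by intro t v; simp [rowMap, dotProduct_smul] }
  have hinj : Function.Injective L := by
    rw [← LinearMap.ker_eq_bot, LinearMap.ker_eq_bot']
    intro v hv
    by_contra hv0
    apply h
    rw [det3_eq_zero_iff]
    exact ⟨v, hv0, congrFun hv 0, congrFun hv 1, congrFun hv 2⟩
  exact ⟨LinearEquiv.ofInjectiveEndo L hinj, fun v => rfl⟩

/-- A linear change of coordinates with given columns. -/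
theorem exists_equiv_columns {e f g : Fin 3 → ℂ} (h : det3 e f g ≠ 0) :
    ∃ A : (Fin 3 → ℂ) ≃ₗ[ℂ] (Fin 3 → ℂ), ∀ v, A v = v 0 • e + v 1 • f + v 2 • g := by
  let L : (Fin 3 → ℂ) →ₗ[ℂ] (Fin 3 → ℂ) :=
    { toFun := fun v => v 0 • e + v 1 • f + v 2 • g
      map_add' := by intro v w; simp only [Pi.add_apply]; module
      map_smul' := by
        intro t v; simp only [Pi.smul_apply, smul_eq_mul, RingHom.id_apply]; module }
  have hinj : Function.Injective L := by
    rw [← LinearMap.ker_eq_bot, LinearMap.ker_eq_bot']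
    intro v hv
    by_contra hv0
    apply h
    rw [det3_eq_zero_iff_dep]
    refine ⟨v, hv0, fun i => ?_⟩
    simpa [L] using congrFun hv i
  exact ⟨LinearEquiv.ofInjectiveEndo L hinj, fun v => rfl⟩

/-- A cubic form that vanishes on a line is divisible by the equation of the line. -/
theorem exists_cubicForm_eq_mul {c : Fin 10 → ℂ} {l : Fin 3 → ℂ} (hl : l ≠ 0)
    (h : ∀ v, l ⬝ᵥ v = 0 → cubicForm c v = 0) :
    ∃ k, ∀ v, cubicForm c v = (l ⬝ᵥ v) * quadForm k v := by
  obtain ⟨e, f, hef⟩ := exists_det3_ne_zero hl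
  obtain ⟨A, hA⟩ := exists_equiv_rows hef
  obtain ⟨c', hc'⟩ := exists_cubicForm_comp c A.symm.toLinearMap
  have hz : ∀ x y, cubicForm c' ![x, y, 0] = 0 := by
    intro x y
    rw [hc']
    apply h
    have := congrFun (hA (A.symm ![x, y, 0])) 2
    rw [A.apply_symm_apply] at this
    simpa [rowMap] using this.symm
  -- Four values on the line `z = 0` suffice to kill the coefficients of `x³`, `x²y`, `xy²`, `y³`;
  -- every other monomial is divisible by `z`.
  have h1 := hz 1 0
  have h2 := hz 0 1
  have h3 := hz 1 1
  have h4 := hz 1 (-1)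
  simp [cubicForm] at h1 h2
  simp [cubicForm, h1, h2] at h3 h4
  have e1 : c' 1 = 0 := by linear_combination h3 / 2 - h4 / 2
  have e3 : c' 3 = 0 := by linear_combination h3 / 2 + h4 / 2
  obtain ⟨k, hk⟩ := exists_quadForm_comp ![c' 2, c' 4, c' 5, c' 7, c' 8, c' 9] A.toLinearMap
  refine ⟨k, fun v => ?_⟩
  have h5 := hc' (A v)
  simp only [LinearEquiv.coe_coe, A.symm_apply_apply] at h5
  have h6 : A v 2 = l ⬝ᵥ v := by rw [hA]; simp [rowMap]
  rw [hk, ← h5, ← h6]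
  simp [cubicForm, quadForm, h1, h2, e1, e3]
  ring

/-- A quadratic form that vanishes on a line is divisible by the equation of the line. -/
theorem exists_quadForm_eq_mul {c : Fin 6 → ℂ} {l : Fin 3 → ℂ} (hl : l ≠ 0)
    (h : ∀ v, l ⬝ᵥ v = 0 → quadForm c v = 0) :
    ∃ m : Fin 3 → ℂ, ∀ v, quadForm c v = (l ⬝ᵥ v) * (m ⬝ᵥ v) := by
  obtain ⟨e, f, hef⟩ := exists_det3_ne_zero hl
  obtain ⟨A, hA⟩ := exists_equiv_rows hef
  obtain ⟨c', hc'⟩ := exists_quadForm_comp c A.symm.toLinearMap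
  have hz : ∀ x y, quadForm c' ![x, y, 0] = 0 := by
    intro x y
    rw [hc']
    apply h
    have := congrFun (hA (A.symm ![x, y, 0])) 2
    rw [A.apply_symm_apply] at this
    simpa [rowMap] using this.symm
  have h1 := hz 1 0
  have h2 := hz 0 1
  have h3 := hz 1 1
  simp [quadForm] at h1 h2
  simp [quadForm, h1, h2] at h3
  refine ⟨c' 2 • e + c' 4 • f + c' 5 • l, fun v => ?_⟩
  have h5 := hc' (A v)
  simp only [LinearEquiv.coe_coe, A.symm_apply_apply] at h5
  rw [← h5, hA]
  simp [quadForm, h1, h2, h3, rowMap, add_dotProduct]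
  ring

/-- Cramer's rule; the coefficient of `w` vanishes by `hx`. -/
theorem eq_comb_of_det3_eq_zero {u v w x : Fin 3 → ℂ} (h : det3 u v w ≠ 0) (hx : det3 u v x = 0) :
    ∃ s t : ℂ, x = s • u + t • v := by
  refine ⟨det3 x v w / det3 u v w, det3 u x w / det3 u v w, ?_⟩
  ext i
  simp only [Pi.add_apply, Pi.smul_apply, smul_eq_mul]
  field_simp
  fin_cases i
  · simp only [Fin.zero_eta, det3] at hx ⊢
    linear_combination w 0 * hx
  · simp only [Fin.mk_one, det3] at hx ⊢
    linear_combination w 1 * hx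
  · simp only [Fin.reduceFinMk, det3] at hx ⊢
    linear_combination w 2 * hx

/-- A cubic form with four zeros on a line vanishes on the line. -/
theorem cubicForm_eq_zero_on_line {c : Fin 10 → ℂ} {u v : Fin 3 → ℂ} {s t s' t' : ℂ}
    (hu : cubicForm c u = 0) (hv : cubicForm c v = 0) (h : cubicForm c (s • u + t • v) = 0)
    (h' : cubicForm c (s' • u + t' • v) = 0) (hs : s ≠ 0) (ht : t ≠ 0) (hs' : s' ≠ 0) (ht' : t' ≠ 0)
    (hne : s * t' - s' * t ≠ 0) (x y : ℂ) : cubicForm c (x • u + y • v) = 0 := by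
  have key : ∀ x y : ℂ, cubicForm c (x • u + y • v) = x * y *
      (x * ((cubicForm c (u + v) - cubicForm c (u - v)) / 2) +
        y * ((cubicForm c (u + v) + cubicForm c (u - v)) / 2)) := by
    intro x y
    have e : cubicForm c (x • u + y • v) = x ^ 3 * cubicForm c u + y ^ 3 * cubicForm c v +
        x ^ 2 * y * ((cubicForm c (u + v) - cubicForm c (u - v)) / 2 - cubicForm c v) +
        x * y ^ 2 * ((cubicForm c (u + v) + cubicForm c (u - v)) / 2 - cubicForm c u) := by
      simp only [cubicForm, Pi.add_apply, Pi.sub_apply, Pi.smul_apply, smul_eq_mul]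
      ring
    rw [e, hu, hv]; ring
  rw [key] at h h' ⊢
  generalize (cubicForm c (u + v) - cubicForm c (u - v)) / 2 = B at *
  generalize (cubicForm c (u + v) + cubicForm c (u - v)) / 2 = C at *
  have h1 := (mul_eq_zero.1 h).resolve_left (mul_ne_zero hs ht)
  have h2 := (mul_eq_zero.1 h').resolve_left (mul_ne_zero hs' ht')
  have hB : B = 0 := by
    refine (mul_eq_zero.1 ?_).resolve_left hne
    linear_combination t' * h1 - t * h2
  have hC : C = 0 := by
    refine (mul_eq_zero.1 ?_).resolve_left hne
    linear_combination s * h2 - s' * h1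
  rw [hB, hC]; ring

/-- A quadratic form with three zeros on a line vanishes on the line. -/
theorem quadForm_eq_zero_on_line {c : Fin 6 → ℂ} {u v : Fin 3 → ℂ} {s t : ℂ}
    (hu : quadForm c u = 0) (hv : quadForm c v = 0) (h : quadForm c (s • u + t • v) = 0)
    (hs : s ≠ 0) (ht : t ≠ 0) (x y : ℂ) : quadForm c (x • u + y • v) = 0 := by
  have key : ∀ x y : ℂ, quadForm c (x • u + y • v) = x * y *
      (quadForm c (u + v) - quadForm c u - quadForm c v) := by
    intro x y
    have e : quadForm c (x • u + y • v) = x ^ 2 * quadForm c u + y ^ 2 * quadForm c v +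
        x * y * (quadForm c (u + v) - quadForm c u - quadForm c v) := by
      simp only [quadForm, Pi.add_apply, Pi.smul_apply, smul_eq_mul]
      ring
    rw [e, hu, hv]; ring
  rw [key] at h ⊢
  rw [(mul_eq_zero.1 h).resolve_left (mul_ne_zero hs ht), mul_zero]

theorem cross_ne_zero {u v w : Fin 3 → ℂ} (h : det3 u v w ≠ 0) : cross u v ≠ 0 := by
  intro h0
  rw [← cross_dot, h0, zero_dotProduct] at h
  exact h rfl

/-- The theorem of Chasles: let two triples of lines meet in nine points; a cubic through eight of
them passes through the ninth. The rows are `a`, `b`, `c`. -/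
theorem chasles {F : Fin 10 → ℂ} {a b c : Fin 3 → Fin 3 → ℂ}
    (ra : det3 (a 0) (a 1) (a 2) = 0) (rb : det3 (b 0) (b 1) (b 2) = 0)
    (rc : det3 (c 0) (c 1) (c 2) = 0) (col : ∀ j, det3 (a j) (b j) (c j) = 0)
    (hab : ∀ j, det3 (a 0) (a 1) (b j) ≠ 0) (hac : ∀ j, det3 (a 0) (a 1) (c j) ≠ 0)
    (hbc : ∀ j, det3 (b 0) (b 1) (c j) ≠ 0) (hca : det3 (c 0) (c 1) (a 0) ≠ 0)
    (ma : ∀ i j, i ≠ j → det3 (a i) (b i) (a j) ≠ 0)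
    (mb : ∀ i, i ≠ 2 → det3 (a i) (b i) (b 2) ≠ 0)
    (Fa : ∀ j, cubicForm F (a j) = 0) (Fb : ∀ j, cubicForm F (b j) = 0)
    (Fc : ∀ j, j ≠ 2 → cubicForm F (c j) = 0) : cubicForm F (c 2) = 0 := by
  -- Let `M` be the product of the three column lines. A suitable `F - κ • M` vanishes at a fourth
  -- point of row `a`, hence on that row. The quotient conic vanishes at three points of row `b`,
  -- hence on that row. The last factor is linear, vanishes at `c 0` and `c 1`, and therefore at `c
  -- 2`.
  obtain ⟨s, t, hst⟩ := eq_comb_of_det3_eq_zero (hab 0) ra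
  have lin : ∀ (x y : Fin 3 → ℂ) (s t : ℂ) (u v : Fin 3 → ℂ),
      det3 x y (s • u + t • v) = s * det3 x y u + t * det3 x y v := by
    intro x y s t u v
    simp only [det3, Pi.add_apply, Pi.smul_apply, smul_eq_mul]; ring
  have rep : ∀ x y : Fin 3 → ℂ, det3 x y x = 0 ∧ det3 x y y = 0 := by
    intro x y
    constructor <;> · simp only [det3]; ring
  have ht : t ≠ 0 := by
    rintro rfl
    have := ma 0 2 (by decide)
    rw [hst, lin, (rep _ _).1] at this
    simp at this
  have hs : s ≠ 0 := by
    rintro rfl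
    have := ma 1 2 (by decide)
    rw [hst, lin, (rep _ _).1] at this
    simp at this
  -- the cubic form of the three columns
  obtain ⟨M, hM⟩ : ∃ M : Fin 10 → ℂ, ∀ v, cubicForm M v =
      det3 (a 0) (b 0) v * det3 (a 1) (b 1) v * det3 (a 2) (b 2) v := by
    let f := cross (a 0) (b 0)
    let g := cross (a 1) (b 1)
    let h := cross (a 2) (b 2)
    refine ⟨![f 0 * g 0 * h 0, f 0 * g 0 * h 1 + f 0 * g 1 * h 0 + f 1 * g 0 * h 0,
      f 0 * g 0 * h 2 + f 0 * g 2 * h 0 + f 2 * g 0 * h 0,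
      f 0 * g 1 * h 1 + f 1 * g 0 * h 1 + f 1 * g 1 * h 0,
      f 0 * g 1 * h 2 + f 0 * g 2 * h 1 + f 1 * g 0 * h 2 + f 1 * g 2 * h 0 + f 2 * g 0 * h 1 +
        f 2 * g 1 * h 0,
      f 0 * g 2 * h 2 + f 2 * g 0 * h 2 + f 2 * g 2 * h 0, f 1 * g 1 * h 1,
      f 1 * g 1 * h 2 + f 1 * g 2 * h 1 + f 2 * g 1 * h 1,
      f 1 * g 2 * h 2 + f 2 * g 1 * h 2 + f 2 * g 2 * h 1, f 2 * g 2 * h 2], fun v => ?_⟩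
    rw [← cross_dot, ← cross_dot, ← cross_dot]
    simp only [cubicForm, dot3, Matrix.cons_val]
    ring
  have Ma : ∀ j, cubicForm M (a j) = 0 := by
    intro j; rw [hM]; fin_cases j <;> simp [(rep _ _).1]
  have Mb : ∀ j, cubicForm M (b j) = 0 := by
    intro j; rw [hM]; fin_cases j <;> simp [(rep _ _).2]
  have Mc : ∀ j, cubicForm M (c j) = 0 := by
    intro j
    rw [hM]
    have := col j
    fin_cases j <;> simp at this <;> simp [this]
  -- The fourth point of row `a` is the harmonic conjugate of `a 2` with respect to `a 0` and `a 1`.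
  -- It is on none of the columns, so `κ` can be chosen to make `F - κ • M` vanish there.
  have Md : cubicForm M (1 • a 0 + (-(t / s)) • a 1) ≠ 0 := by
    have e := (rep (a 2) (b 2)).1
    conv at e in (occs := 2) a 2 => rw [hst]
    rw [lin] at e
    rw [hM, show (1 : ℕ) • a 0 = (1 : ℂ) • a 0 by simp, lin, lin, lin, (rep _ _).1, (rep _ _).1]
    have e2 : 1 * det3 (a 2) (b 2) (a 0) + -(t / s) * det3 (a 2) (b 2) (a 1) =
        2 * det3 (a 2) (b 2) (a 0) := by
      field_simp
      linear_combination -e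
    rw [e2]
    refine mul_ne_zero (mul_ne_zero ?_ ?_) ?_
    · simpa [hs, ht] using ma 0 1 (by decide)
    · simpa using ma 1 0 (by decide)
    · simpa using ma 2 0 (by decide)
  rw [show (1 : ℕ) • a 0 = (1 : ℂ) • a 0 by simp] at Md
  set d := (1 : ℂ) • a 0 + (-(t / s)) • a 1 with hd
  set κ := cubicForm F d / cubicForm M d with hκ
  have hG : ∀ v, cubicForm (F - κ • M) v = cubicForm F v - κ * cubicForm M v := by
    intro v; simp [cubicForm]; ring
  set G := F - κ • M
  have Gd : cubicForm G d = 0 := by rw [hG, hκ]; field_simp; ring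
  have Gline : ∀ v, cross (a 0) (a 1) ⬝ᵥ v = 0 → cubicForm G v = 0 := by
    intro v hv
    rw [cross_dot] at hv
    obtain ⟨x, y, rfl⟩ := eq_comb_of_det3_eq_zero (hab 0) hv
    refine cubicForm_eq_zero_on_line (s := s) (t := t) (s' := 1) (t' := -(t / s)) ?_ ?_ ?_ ?_ hs ht
      one_ne_zero (by simp [hs, ht]) ?_ x y
    · rw [hG, Fa, Ma]; ring
    · rw [hG, Fa, Ma]; ring
    · rw [← hst, hG, Fa, Ma]; ring
    · exact Gd
    · field_simp; ring_nf; simpa using ht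
  obtain ⟨k, hk⟩ := exists_cubicForm_eq_mul (cross_ne_zero (hab 0)) Gline
  simp only [cross_dot] at hk
  have kz : ∀ v, det3 (a 0) (a 1) v ≠ 0 → cubicForm F v = 0 → cubicForm M v = 0 →
      quadForm k v = 0 := by
    intro v h1 h2 h3
    have := hk v
    rw [hG, h2, h3, mul_zero, sub_zero] at this
    exact (mul_eq_zero.1 this.symm).resolve_left h1
  obtain ⟨s', t', hst'⟩ := eq_comb_of_det3_eq_zero (hbc 0) rb
  have ht' : t' ≠ 0 := by
    rintro rfl
    have := mb 0 (by decide)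
    rw [hst', lin, (rep _ _).2] at this
    simp at this
  have hs' : s' ≠ 0 := by
    rintro rfl
    have := mb 1 (by decide)
    rw [hst', lin, (rep _ _).2] at this
    simp at this
  have kline : ∀ v, cross (b 0) (b 1) ⬝ᵥ v = 0 → quadForm k v = 0 := by
    intro v hv
    rw [cross_dot] at hv
    obtain ⟨x, y, rfl⟩ := eq_comb_of_det3_eq_zero (hbc 0) hv
    refine quadForm_eq_zero_on_line (s := s') (t := t') (kz _ (hab 0) (Fb 0) (Mb 0))
      (kz _ (hab 1) (Fb 1) (Mb 1)) ?_ hs' ht' x y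
    rw [← hst']
    exact kz _ (hab 2) (Fb 2) (Mb 2)
  obtain ⟨m, hm⟩ := exists_quadForm_eq_mul (cross_ne_zero (hbc 0)) kline
  simp only [cross_dot] at hm
  have mz : ∀ j, j ≠ 2 → m ⬝ᵥ c j = 0 := by
    intro j hj
    have := kz _ (hac j) (Fc j hj) (Mc j)
    rw [hm] at this
    exact (mul_eq_zero.1 this).resolve_left (hbc j)
  obtain ⟨x, y, hxy⟩ := eq_comb_of_det3_eq_zero hca rc
  have m2 : m ⬝ᵥ c 2 = 0 := by
    rw [hxy, dotProduct_add, dotProduct_smul, dotProduct_smul, mz 0 (by decide), mz 1 (by decide)]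
    simp
  have := hk (c 2)
  rw [hm, m2, hG, Mc 2] at this
  linear_combination this

theorem det3_ne_zero_rotate {u v w : Fin 3 → ℂ} (h : det3 u v w ≠ 0) : det3 v w u ≠ 0 := by
  rwa [det3_rotate]

theorem det3_ne_zero_swap {u v w : Fin 3 → ℂ} (h : det3 u v w ≠ 0) : det3 v u w ≠ 0 := by
  rwa [det3_swap, neg_ne_zero]

/-! ### The cubic through a cyclic dual net -/

namespace DualNet

variable {H : Type*} [AddCommGroup H] {p q r : H → Fin 3 → ℂ}

/-- A cubic through eight of the nine points of a dual net given by two triples of lines passes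
through the ninth. -/
theorem cubicForm_eq_zero_of_grid (N : DualNet p q r) {F : Fin 10 → ℂ} {a b c : Fin 3 → H}
    (ha : Function.Injective a) (hb : Function.Injective b) (hc : Function.Injective c)
    (hs : ∀ i j k, i ≠ j → j ≠ k → i ≠ k → a i + b j + c k = 0)
    (Fp : ∀ i, i ≠ 2 → cubicForm F (p (a i)) = 0) (Fq : ∀ i, cubicForm F (q (b i)) = 0)
    (Fr : ∀ i, cubicForm F (r (c i)) = 0) : cubicForm F (p (a 2)) = 0 := by
  have z : ∀ i j k, i ≠ j → j ≠ k → i ≠ k → det3 (p (a i)) (q (b j)) (r (c k)) = 0 :=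
    fun i j k h1 h2 h3 => N.coll _ _ _ (hs i j k h1 h2 h3)
  have nb : ∀ i k m, i ≠ k → i ≠ m → m ≠ k → det3 (p (a i)) (q (b i)) (r (c k)) ≠ 0 := by
    intro i k m h1 h2 h3
    refine N.det3_ne_zero fun h => hb.ne h2 ?_
    have := hs i m k h2 h3 h1
    have e : b i = -(a i + c k) := by rw [eq_neg_iff_add_eq_zero, ← h]; abel
    rw [e, eq_comm, eq_neg_iff_add_eq_zero, ← this]; abel
  have nc : ∀ i j m, i ≠ j → i ≠ m → j ≠ m → det3 (p (a i)) (q (b j)) (r (c i)) ≠ 0 := by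
    intro i j m h1 h2 h3
    refine N.det3_ne_zero fun h => hc.ne h2 ?_
    have := hs i j m h1 h3 h2
    have e : c i = -(a i + b j) := by rw [eq_neg_iff_add_eq_zero, ← h]; abel
    rw [e, eq_comm, eq_neg_iff_add_eq_zero, ← this]; abel
  have na : ∀ i j m, i ≠ j → i ≠ m → m ≠ j → det3 (p (a i)) (q (b j)) (r (c j)) ≠ 0 := by
    intro i j m h1 h2 h3
    refine N.det3_ne_zero fun h => hc.ne h3.symm ?_
    have := hs i j m h1 h3.symm h2
    have e : c j = -(a i + b j) := by rw [eq_neg_iff_add_eq_zero, ← h]; abel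
    rw [e, eq_comm, eq_neg_iff_add_eq_zero, ← this]; abel
  -- A Latin square with `p` on the diagonal. Each row and each column has one point of every family
  -- with three different indices, so the six collinear triples given by the permutations of the
  -- indices are its rows and columns.
  refine chasles (F := F) (a := ![p (a 0), r (c 2), q (b 1)]) (b := ![q (b 2), p (a 1), r (c 0)])
    (c := ![r (c 1), q (b 0), p (a 2)]) ?_ ?_ ?_ ?_ ?_ ?_ ?_ ?_ ?_ ?_ ?_ ?_ ?_
  · have := z 0 1 2 (by decide) (by decide) (by decide)
    simp only [det3, Matrix.cons_val] at this ⊢; linear_combination -this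
  · have := z 1 2 0 (by decide) (by decide) (by decide)
    simp only [det3, Matrix.cons_val] at this ⊢; linear_combination -this
  · have := z 2 0 1 (by decide) (by decide) (by decide)
    simp only [det3, Matrix.cons_val] at this ⊢; linear_combination -this
  · intro j
    have h0 := z 0 2 1 (by decide) (by decide) (by decide)
    have h1 := z 1 0 2 (by decide) (by decide) (by decide)
    have h2 := z 2 1 0 (by decide) (by decide) (by decide)
    fin_cases j
    · exact h0
    · change det3 (r (c 2)) (p (a 1)) (q (b 0)) = 0
      rwa [← det3_rotate]
    · change det3 (q (b 1)) (r (c 0)) (p (a 2)) = 0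
      rwa [det3_rotate]
  · intro j
    fin_cases j
    · change det3 (p (a 0)) (r (c 2)) (q (b 2)) ≠ 0
      exact det3_ne_zero_swap (det3_ne_zero_rotate
        (det3_ne_zero_rotate (na 0 2 1 (by decide) (by decide) (by decide))))
    · exact det3_ne_zero_rotate (N.ppr _ _ _ (ha.ne (by decide)))
    · exact det3_ne_zero_rotate (det3_ne_zero_rotate (N.rrp _ _ _ (hc.ne (by decide))))
  · intro j
    fin_cases j
    · exact det3_ne_zero_rotate (det3_ne_zero_rotate (N.rrp _ _ _ (hc.ne (by decide))))
    · change det3 (p (a 0)) (r (c 2)) (q (b 0)) ≠ 0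
      exact det3_ne_zero_swap (det3_ne_zero_rotate
        (det3_ne_zero_rotate (nb 0 2 1 (by decide) (by decide) (by decide))))
    · exact det3_ne_zero_rotate (N.ppr _ _ _ (ha.ne (by decide)))
  · intro j
    fin_cases j
    · change det3 (q (b 2)) (p (a 1)) (r (c 1)) ≠ 0
      exact det3_ne_zero_swap (nc 1 2 0 (by decide) (by decide) (by decide))
    · exact det3_ne_zero_rotate (N.qqp _ _ _ (hb.ne (by decide)))
    · exact det3_ne_zero_rotate (det3_ne_zero_rotate (N.ppq _ _ _ (ha.ne (by decide))))
  · change det3 (r (c 1)) (q (b 0)) (p (a 0)) ≠ 0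
    exact det3_ne_zero_rotate (det3_ne_zero_rotate
      (det3_ne_zero_swap (nb 0 1 2 (by decide) (by decide) (by decide))))
  · intro i j hij
    have h1 : det3 (p (a 0)) (q (b 2)) (r (c 2)) ≠ 0 :=
      na 0 2 1 (by decide) (by decide) (by decide)
    have h2 : det3 (r (c 2)) (p (a 1)) (q (b 1)) ≠ 0 :=
      det3_ne_zero_rotate (det3_ne_zero_rotate (nb 1 2 0 (by decide) (by decide) (by decide)))
    have h3 : det3 (q (b 1)) (r (c 0)) (p (a 0)) ≠ 0 :=
      det3_ne_zero_rotate (nc 0 1 2 (by decide) (by decide) (by decide))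
    fin_cases i <;> fin_cases j <;> first | exact absurd rfl hij | skip
    · exact h1
    · exact det3_ne_zero_rotate (det3_ne_zero_rotate (N.qqp _ _ _ (hb.ne (by decide))))
    · exact det3_ne_zero_rotate (det3_ne_zero_rotate (N.ppr _ _ _ (ha.ne (by decide))))
    · exact h2
    · exact h3
    · exact det3_ne_zero_rotate (det3_ne_zero_rotate (N.rrq _ _ _ (hc.ne (by decide))))
  · intro i hi
    have h1 : det3 (p (a 0)) (q (b 2)) (r (c 0)) ≠ 0 :=
      nc 0 2 1 (by decide) (by decide) (by decide)
    fin_cases i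
    · exact h1
    · exact det3_ne_zero_rotate (N.rrp _ _ _ (hc.ne (by decide)))
    · exact absurd rfl hi
  · intro j
    fin_cases j
    exacts [Fp 0 (by decide), Fr 2, Fq 1]
  · intro j
    fin_cases j
    exacts [Fq 2, Fp 1 (by decide), Fr 0]
  · intro j hj
    fin_cases j
    exacts [Fr 1, Fq 0, absurd rfl hj]

/-- One step of the propagation of a cubic along a cyclic dual net. -/
theorem cubicForm_eq_zero_step (N : DualNet p q r) {F : Fin 10 → ℂ} {g : H} {x y : ℕ}
    (hx : x • g ≠ 0) (hy : y • g ≠ 0) (hxy : x • g ≠ y • g) (i j : ℕ)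
    (p0 : cubicForm F (p (i • g)) = 0) (p1 : cubicForm F (p ((i + x) • g)) = 0)
    (q0 : cubicForm F (q (j • g)) = 0) (q1 : cubicForm F (q ((j + x) • g)) = 0)
    (q2 : cubicForm F (q ((j + y) • g)) = 0)
    (r0 : cubicForm F (r (-((i + j + x) • g))) = 0)
    (r1 : cubicForm F (r (-((i + j + y) • g))) = 0)
    (r2 : cubicForm F (r (-((i + j + x + y) • g))) = 0) : cubicForm F (p ((i + y) • g)) = 0 := by
  have hinj : Function.Injective ![0, x • g, y • g] := by
    intro s t h
    fin_cases s <;> fin_cases t <;> simp [hx, hy, hxy, hx.symm, hy.symm, hxy.symm] at h ⊢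
  -- The labels are translates of one triple `S`. The shift of the third family makes distinct
  -- entries of `S` add up to zero.
  let S := ![0, x • g, y • g]
  have key := N.cubicForm_eq_zero_of_grid (F := F) (a := fun k => i • g + S k)
    (b := fun k => j • g + S k) (c := fun k => S k + -((i + j + x + y) • g))
    (fun s t h => hinj (add_left_cancel h)) (fun s t h => hinj (add_left_cancel h))
    (fun s t h => hinj (add_right_cancel h)) ?_ ?_ ?_ ?_
  · simpa [S, add_smul] using key
  · have : S 0 + S 1 + S 2 = (x + y) • g := by simp [S, add_smul]
    intro s t u h1 h2 h3
    have e : S s + S t + S u = (x + y) • g := by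
      rw [← this]
      fin_cases s <;> fin_cases t <;> fin_cases u <;>
        first | exact absurd rfl h1 | exact absurd rfl h2 | exact absurd rfl h3 | skip
      all_goals simp only [Fin.zero_eta, Fin.mk_one, Fin.reduceFinMk] <;> abel
    calc i • g + S s + (j • g + S t) + (S u + -((i + j + x + y) • g))
        = (S s + S t + S u) + (i • g + j • g - (i + j + x + y) • g) := by abel
      _ = 0 := by rw [e]; simp only [add_smul]; abel
  · intro k hk
    fin_cases k
    · simpa [S] using p0
    · simpa [S, add_smul] using p1
    · exact absurd rfl hk
  · intro k
    fin_cases k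
    · simpa [S] using q0
    · simpa [S, add_smul] using q1
    · simpa [S, add_smul] using q2
  · intro k
    fin_cases k
    · simpa [S] using r2
    · convert r1 using 3
      simp [S, add_smul]; abel
    · convert r0 using 3
      simp [S, add_smul]

/-- The same step for the third family. -/
theorem cubicForm_eq_zero_step_last (N : DualNet p q r) {F : Fin 10 → ℂ} {g : H} {x y : ℕ}
    (hx : x • g ≠ 0) (hy : y • g ≠ 0) (hxy : x • g ≠ y • g) (i j : ℕ)
    (p0 : cubicForm F (p (i • g)) = 0) (p1 : cubicForm F (p ((i + x) • g)) = 0)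
    (p2 : cubicForm F (p ((i + y) • g)) = 0)
    (q0 : cubicForm F (q (j • g)) = 0) (q1 : cubicForm F (q ((j + x) • g)) = 0)
    (q2 : cubicForm F (q ((j + y) • g)) = 0)
    (r0 : cubicForm F (r (-((i + j + x) • g))) = 0)
    (r1 : cubicForm F (r (-((i + j + y) • g))) = 0) :
    cubicForm F (r (-((i + j + x + y) • g))) = 0 := by
  have hinj : Function.Injective ![0, x • g, y • g] := by
    intro s t h
    fin_cases s <;> fin_cases t <;> simp [hx, hy, hxy, hx.symm, hy.symm, hxy.symm] at h ⊢
  let S := ![y • g, x • g, 0]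
  have hS : Function.Injective S := by
    have : S = ![0, x • g, y • g] ∘ Fin.rev := by
      ext k; fin_cases k <;> simp [S, Fin.rev]
    rw [this]
    exact hinj.comp Fin.rev_injective
  have key := N.rotate.rotate.cubicForm_eq_zero_of_grid (F := F)
    (a := fun k => S k + -((i + j + x + y) • g))
    (b := fun k => i • g + S k) (c := fun k => j • g + S k)
    (fun s t h => hS (add_right_cancel h)) (fun s t h => hS (add_left_cancel h))
    (fun s t h => hS (add_left_cancel h)) ?_ ?_ ?_ ?_
  · simpa [S] using key
  · have : S 0 + S 1 + S 2 = (x + y) • g := by simp [S, add_smul]; abel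
    intro s t u h1 h2 h3
    have e : S s + S t + S u = (x + y) • g := by
      rw [← this]
      fin_cases s <;> fin_cases t <;> fin_cases u <;>
        first | exact absurd rfl h1 | exact absurd rfl h2 | exact absurd rfl h3 | skip
      all_goals simp only [Fin.zero_eta, Fin.mk_one, Fin.reduceFinMk] <;> abel
    calc S s + -((i + j + x + y) • g) + (i • g + S t) + (j • g + S u)
        = (S s + S t + S u) + (i • g + j • g - (i + j + x + y) • g) := by abel
      _ = 0 := by rw [e]; simp only [add_smul]; abel
  · intro k hk
    fin_cases k
    · convert r0 using 3
      simp [S, add_smul]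
    · convert r1 using 3
      simp [S, add_smul]; abel
    · exact absurd rfl hk
  · intro k
    fin_cases k
    · simpa [S, add_smul] using p2
    · simpa [S, add_smul] using p1
    · simpa [S] using p0
  · intro k
    fin_cases k
    · simpa [S, add_smul] using q2
    · simpa [S, add_smul] using q1
    · simpa [S] using q0

/-- The points of a cyclic dual net of order at least four lie on a cubic. -/
theorem exists_cubicForm (N : DualNet p q r) {g : H} (hg : 4 ≤ addOrderOf g)
    (hgen : ∀ a, a ∈ AddSubgroup.zmultiples g) (hfin : addOrderOf g ≠ 0) :
    ∃ F, F ≠ 0 ∧ ∀ a, cubicForm F (p a) = 0 ∧ cubicForm F (q a) = 0 ∧ cubicForm F (r a) = 0 := by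
  have hsm : ∀ m : ℕ, 0 < m → m < 4 → m • g ≠ 0 := by
    intro m h0 h4 h
    have := Nat.le_of_dvd h0 (addOrderOf_dvd_iff_nsmul_eq_zero.2 h)
    omega
  have h1 := hsm 1 (by norm_num) (by norm_num)
  have h2 := hsm 2 (by norm_num) (by norm_num)
  have h3 := hsm 3 (by norm_num) (by norm_num)
  have h12 : 1 • g ≠ 2 • g := by
    intro h; apply h1; rw [two_nsmul, one_nsmul] at h; rw [one_nsmul]; simpa using h.symm
  have h13 : 1 • g ≠ 3 • g := by
    intro h; apply h2
    rw [show 3 = 1 + 2 by norm_num, add_nsmul] at h; simpa using h.symm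
  -- Nine points impose nine linear conditions on ten coefficients. These nine are chosen so that
  -- the later points of the net are reached successively, each as the ninth point of a grid.
  obtain ⟨F, hF, hz⟩ := exists_cubicForm_through ![p (0 • g), p (1 • g), p (2 • g), p (3 • g),
    q (0 • g), q (1 • g), q (2 • g), r (-(1 • g)), r (-(2 • g))]
  refine ⟨F, hF, ?_⟩
  let P := fun i : ℕ => cubicForm F (p (i • g)) = 0
  let Q := fun i : ℕ => cubicForm F (q (i • g)) = 0
  let R := fun i : ℕ => cubicForm F (r (-(i • g))) = 0
  have P0 : P 0 := hz 0
  have P1 : P 1 := hz 1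
  have P2 : P 2 := hz 2
  have P3 : P 3 := hz 3
  have Q0 : Q 0 := hz 4
  have Q1 : Q 1 := hz 5
  have Q2 : Q 2 := hz 6
  have R1 : R 1 := hz 7
  have R2 : R 2 := hz 8
  have R3 : R 3 := N.cubicForm_eq_zero_step_last h1 h2 h12 0 0 P0 P1 P2 Q0 Q1 Q2 R1 R2
  have R4 : R 4 := N.cubicForm_eq_zero_step_last h1 h2 h12 1 0 P1 P2 P3 Q0 Q1 Q2 R2 R3
  have Q3 : Q 3 := N.swap.cubicForm_eq_zero_step h1 h2 h12 1 0 Q1 Q2 P0 P1 P2 R2 R3 R4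
  have R5 : R 5 := N.cubicForm_eq_zero_step_last h1 h2 h12 1 1 P1 P2 P3 Q1 Q2 Q3 R3 R4
  -- Each round gains one index in `P` and in `Q`, and two in `R`. The index `0` of `R` is not
  -- available at the start.
  have ind : ∀ k : ℕ, (∀ i ≤ k + 3, P i) ∧ (∀ i ≤ k + 3, Q i) ∧
      ∀ i, 1 ≤ i → i ≤ 2 * k + 5 → R i := by
    intro k
    induction k with
    | zero =>
      refine ⟨?_, ?_, ?_⟩
      · intro i hi; interval_cases i <;> assumption
      · intro i hi; interval_cases i <;> assumption
      · intro i hi hi'; interval_cases i <;> assumption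
    | succ k ih =>
      obtain ⟨hP, hQ, hR⟩ := ih
      have P4 : P (k + 1 + 3) := N.cubicForm_eq_zero_step h1 h3 h13 (k + 1) k
        (hP _ (by omega)) (hP _ (by omega)) (hQ _ (by omega)) (hQ _ (by omega)) (hQ _ (by omega))
        (hR _ (by omega) (by omega)) (hR _ (by omega) (by omega)) (hR _ (by omega) (by omega))
      have Q4 : Q (k + 1 + 3) := N.swap.cubicForm_eq_zero_step h1 h3 h13 (k + 1) k
        (hQ _ (by omega)) (hQ _ (by omega)) (hP _ (by omega)) (hP _ (by omega)) (hP _ (by omega))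
        (hR _ (by omega) (by omega)) (hR _ (by omega) (by omega)) (hR _ (by omega) (by omega))
      have hP' : ∀ i ≤ k + 1 + 3, P i := by
        intro i hi
        rcases Nat.lt_or_ge i (k + 1 + 3) with h | h
        · exact hP i (by omega)
        · rwa [show i = k + 1 + 3 by omega]
      have hQ' : ∀ i ≤ k + 1 + 3, Q i := by
        intro i hi
        rcases Nat.lt_or_ge i (k + 1 + 3) with h | h
        · exact hQ i (by omega)
        · rwa [show i = k + 1 + 3 by omega]
      have R6 : R (k + 2 + (k + 1) + 1 + 2) := N.cubicForm_eq_zero_step_last h1 h2 h12 (k + 2) (k + 1)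
        (hP' _ (by omega)) (hP' _ (by omega)) (hP' _ (by omega)) (hQ' _ (by omega))
        (hQ' _ (by omega)) (hQ' _ (by omega)) (hR _ (by omega) (by omega))
        (hR _ (by omega) (by omega))
      have R7 : R (k + 2 + (k + 2) + 1 + 2) := by
        refine N.cubicForm_eq_zero_step_last h1 h2 h12 (k + 2) (k + 2)
          (hP' _ (by omega)) (hP' _ (by omega)) (hP' _ (by omega)) (hQ' _ (by omega))
          (hQ' _ (by omega)) (hQ' _ (by omega)) (hR _ (by omega) (by omega)) ?_
        rwa [show k + 2 + (k + 2) + 2 = k + 2 + (k + 1) + 1 + 2 by omega]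
      refine ⟨hP', hQ', fun i hi hi' => ?_⟩
      rcases Nat.lt_or_ge i (2 * k + 6) with h | h
      · exact hR i hi (by omega)
      · rcases Nat.lt_or_ge i (2 * k + 7) with h' | h'
        · rwa [show i = k + 2 + (k + 1) + 1 + 2 by omega]
        · rwa [show i = k + 2 + (k + 2) + 1 + 2 by omega]
  have nat : ∀ a, ∃ m : ℕ, 1 ≤ m ∧ a = m • g := by
    intro a
    obtain ⟨z, rfl⟩ := AddSubgroup.mem_zmultiples_iff.1 (hgen a)
    obtain ⟨m, hm⟩ := Int.eq_ofNat_of_zero_le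
      (Int.emod_nonneg z (Int.natCast_ne_zero.2 hfin))
    -- Adding the order makes the representative positive, as `R` is known from index `1` on only.
    refine ⟨m + addOrderOf g, by omega, ?_⟩
    rw [add_smul, addOrderOf_nsmul_eq_zero, add_zero, ← natCast_zsmul, ← hm, mod_addOrderOf_zsmul]
  intro a
  obtain ⟨m, hm, rfl⟩ := nat a
  obtain ⟨m', hm', he⟩ := nat (-(m • g))
  obtain ⟨hP, hQ, hR⟩ := ind (m + m')
  refine ⟨hP m (by omega), hQ m (by omega), ?_⟩
  rw [← neg_neg (m • g), he]
  exact hR m' hm' (by omega)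

end DualNet

/-! ### Cubics that contain a line -/

theorem exists_ne_ne_of_two_lt_card {H : Type*} [Fintype H] (h : 2 < Fintype.card H) (x y : H) :
    ∃ b, b ≠ x ∧ b ≠ y := by
  classical
  obtain ⟨b, -, hb⟩ := Finset.exists_mem_notMem_of_card_lt_card
    (s := {x, y}) (t := Finset.univ) (lt_of_le_of_lt Finset.card_le_two (by simpa using h))
  simp only [Finset.mem_insert, Finset.mem_singleton, not_or] at hb
  exact ⟨b, hb⟩

theorem Set.Subsingleton.exists_forall_eq {H : Type*} [Nonempty H] {S : Set H}
    (h : S.Subsingleton) : ∃ x, ∀ y ∈ S, y = x := by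
  rcases S.eq_empty_or_nonempty with rfl | ⟨x, hx⟩
  · exact ⟨Classical.arbitrary H, by simp⟩
  · exact ⟨x, fun y hy => h hy hx⟩

namespace DualNet

variable {H : Type*} [AddCommGroup H] {p q r : H → Fin 3 → ℂ}

/-- A quadratic form that vanishes on the three points of a line of the net vanishes on the line. -/
theorem quadForm_eq_zero_on_line (N : DualNet p q r) [Nontrivial H] {k : Fin 6 → ℂ} {a b c : H}
    (h : a + b + c = 0) (ha : quadForm k (p a) = 0) (hb : quadForm k (q b) = 0)
    (hc : quadForm k (r c) = 0) : ∃ m : Fin 3 → ℂ, m ≠ 0 ∧ ∀ v, m ⬝ᵥ v = 0 → quadForm k v = 0 := by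
  obtain ⟨a', ha'⟩ := exists_ne a
  obtain ⟨b', hb'⟩ := exists_ne b
  have hd : det3 (p a) (q b) (p a') ≠ 0 := det3_ne_zero_rotate (N.ppq _ _ _ ha')
  obtain ⟨s, t, hst⟩ := eq_comb_of_det3_eq_zero hd (N.coll a b c h)
  refine ⟨cross (p a) (q b), cross_ne_zero hd, fun v hv => ?_⟩
  rw [cross_dot] at hv
  obtain ⟨x, y, rfl⟩ := eq_comb_of_det3_eq_zero hd hv
  refine _root_.quadForm_eq_zero_on_line (s := s) (t := t) ha hb (hst ▸ hc) ?_ ?_ x y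
  · rintro rfl
    rw [zero_smul, zero_add] at hst
    exact det3_ne_zero_swap (det3_ne_zero_rotate (N.qqr _ _ c hb')) (det3_smul_eq_zero hst)
  · rintro rfl
    rw [zero_smul, add_zero] at hst
    exact det3_ne_zero_swap (det3_ne_zero_rotate (N.ppr _ _ c ha')) (det3_smul_eq_zero hst)

theorem not_orthogonal {u v w m : Fin 3 → ℂ} (hm : m ≠ 0) (h : det3 u v w ≠ 0) (hu : u ⬝ᵥ m = 0)
    (hv : v ⬝ᵥ m = 0) : w ⬝ᵥ m ≠ 0 :=
  fun hw => h ((det3_eq_zero_iff _ _ _).2 ⟨m, hm, hu, hv, hw⟩)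

/-- If the cubic through the points of a net contains a line, some class is collinear. -/
theorem exists_collinear_of_line (N : DualNet p q r) [Fintype H] (hcard : 4 ≤ Fintype.card H)
    {F : Fin 10 → ℂ} (hF : F ≠ 0) (Fp : ∀ a, cubicForm F (p a) = 0)
    (Fq : ∀ a, cubicForm F (q a) = 0) (Fr : ∀ a, cubicForm F (r a) = 0) {l : Fin 3 → ℂ}
    (hl : l ≠ 0) (hFl : ∀ v, l ⬝ᵥ v = 0 → cubicForm F v = 0) :
    ∃ m : Fin 3 → ℂ, m ≠ 0 ∧
      ((∀ a, p a ⬝ᵥ m = 0) ∨ (∀ a, q a ⬝ᵥ m = 0) ∨ (∀ a, r a ⬝ᵥ m = 0)) := by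
  classical
  obtain ⟨k, hk⟩ := exists_cubicForm_eq_mul hl hFl
  have : Nontrivial H := Fintype.one_lt_card_iff_nontrivial.1 (by omega)
  by_cases hkl : ∃ m : Fin 3 → ℂ, m ≠ 0 ∧ ∀ v, m ⬝ᵥ v = 0 → quadForm k v = 0
  -- The cubic is a product of three lines. By pigeonhole each class has two points on one of them,
  -- and a line with two points of one class has no point of another. So the three classes use three
  -- different lines, and each class stays on its own.
  · obtain ⟨m, hm, hkm⟩ := hkl
    obtain ⟨s, hs⟩ := exists_quadForm_eq_mul hm hkm
    have hs0 : s ≠ 0 := by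
      rintro rfl
      exact hF (eq_zero_of_cubicForm_eq_zero fun v => by rw [hk, hs]; simp)
    let L := ![l, m, s]
    have hL : ∀ i, L i ≠ 0 := by intro i; fin_cases i <;> assumption
    have cover : ∀ v, cubicForm F v = 0 → ∃ i, v ⬝ᵥ L i = 0 := by
      intro v hv
      rw [hk, hs] at hv
      rcases mul_eq_zero.1 hv with h | h
      · exact ⟨0, by rw [dotProduct_comm]; exact h⟩
      · rcases mul_eq_zero.1 h with h | h
        · exact ⟨1, by rw [dotProduct_comm]; exact h⟩
        · exact ⟨2, by rw [dotProduct_comm]; exact h⟩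
    have two : ∀ p : H → Fin 3 → ℂ, (∀ a, cubicForm F (p a) = 0) →
        ∃ i a a', a ≠ a' ∧ p a ⬝ᵥ L i = 0 ∧ p a' ⬝ᵥ L i = 0 := by
      intro p hp
      choose f hf using fun a => cover (p a) (hp a)
      obtain ⟨a, a', hne, he⟩ := Fintype.exists_ne_map_eq_of_card_lt f (by simp; omega)
      exact ⟨f a, a, a', hne, hf a, he ▸ hf a'⟩
    obtain ⟨i, a, a', ha, ha1, ha2⟩ := two p Fp
    obtain ⟨j, b, b', hb, hb1, hb2⟩ := two q Fq
    obtain ⟨t, c, c', hc, hc1, hc2⟩ := two r Fr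
    have hqp : ∀ x, p x ⬝ᵥ L j ≠ 0 := fun x => not_orthogonal (hL j) (N.qqp b b' x hb) hb1 hb2
    have hrp : ∀ x, p x ⬝ᵥ L t ≠ 0 := fun x => not_orthogonal (hL t) (N.rrp c c' x hc) hc1 hc2
    have hrq : ∀ x, q x ⬝ᵥ L t ≠ 0 := fun x => not_orthogonal (hL t) (N.rrq c c' x hc) hc1 hc2
    have hij : i ≠ j := by rintro rfl; exact hqp a ha1
    have hit : i ≠ t := by rintro rfl; exact hrp a ha1
    have hjt : j ≠ t := by rintro rfl; exact hrq b hb1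
    refine ⟨L i, hL i, Or.inl fun x => ?_⟩
    obtain ⟨e, he⟩ := cover (p x) (Fp x)
    have h1 : e ≠ j := by rintro rfl; exact hqp x he
    have h2 : e ≠ t := by rintro rfl; exact hrp x he
    have : e = i := by omega
    exact this ▸ he
  -- A conic that contains no line cannot pass through all three points of a collinear triple, so
  -- each such triple has a point on `l`.
  · have hline : ∀ a b c, a + b + c = 0 → p a ⬝ᵥ l ≠ 0 → q b ⬝ᵥ l ≠ 0 → r c ⬝ᵥ l = 0 := by
      intro a b c h h1 h2
      by_contra h3
      have kz : ∀ v, cubicForm F v = 0 → v ⬝ᵥ l ≠ 0 → quadForm k v = 0 := by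
        intro v hv hvl
        rw [hk, dotProduct_comm] at hv
        exact (mul_eq_zero.1 hv).resolve_left hvl
      exact hkl (N.quadForm_eq_zero_on_line h (kz _ (Fp a) h1) (kz _ (Fq b) h2) (kz _ (Fr c) h3))
    refine ⟨l, hl, ?_⟩
    -- A class with two points on `l` keeps the other classes off `l`, and so lies on `l`
    -- completely. If no class has two points there, a triple that avoids the at most three points
    -- on `l` gives a contradiction.
    by_cases hp : {a | p a ⬝ᵥ l = 0}.Subsingleton
    · by_cases hq : {a | q a ⬝ᵥ l = 0}.Subsingleton
      · by_cases hr : {a | r a ⬝ᵥ l = 0}.Subsingleton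
        · obtain ⟨a0, ha0⟩ := hp.exists_forall_eq
          obtain ⟨b0, hb0⟩ := hq.exists_forall_eq
          obtain ⟨c0, hc0⟩ := hr.exists_forall_eq
          obtain ⟨a, ha⟩ := exists_ne a0
          obtain ⟨b, hb, hb'⟩ := exists_ne_ne_of_two_lt_card (by omega) b0 (-a - c0)
          have h1 := hc0 (-a - b) (hline a b (-a - b) (by abel) (fun h => ha (ha0 a h))
            (fun h => hb (hb0 b h)))
          exact absurd (by rw [← h1]; abel) hb'
        · right; right
          obtain ⟨c, hc, c', hc', hne⟩ := Set.not_subsingleton_iff.1 hr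
          intro x
          exact hline (-x) 0 x (by abel) (not_orthogonal hl (N.rrp c c' _ hne) hc hc')
            (not_orthogonal hl (N.rrq c c' _ hne) hc hc')
      · right; left
        obtain ⟨c, hc, c', hc', hne⟩ := Set.not_subsingleton_iff.1 hq
        intro x
        by_contra hx
        exact not_orthogonal hl (N.qqr c c' 0 hne) hc hc' (hline (-x) x 0 (by abel)
          (not_orthogonal hl (N.qqp c c' _ hne) hc hc') hx)
    · left
      obtain ⟨c, hc, c', hc', hne⟩ := Set.not_subsingleton_iff.1 hp
      intro x
      by_contra hx
      exact not_orthogonal hl (N.ppr c c' 0 hne) hc hc' (hline x (-x) 0 (by abel) hx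
        (not_orthogonal hl (N.ppq c c' _ hne) hc hc'))

/-- A finite group with a dual net is cyclic if one of the cubics through a cyclic subnet contains
a line. -/
theorem isAddCyclic_of_line [Finite H] (N : DualNet p q r) {K : Type*} [AddCommGroup K]
    [Finite K] (f : K →+ H) (hf : Function.Injective f) {g : K} (hg : 5 ≤ addOrderOf g)
    {α β γ : H} (h : α + β + γ = 0) {F : Fin 10 → ℂ} (hF : F ≠ 0)
    (Fp : ∀ k, cubicForm F (p (α + f k)) = 0) (Fq : ∀ k, cubicForm F (q (β + f k)) = 0)
    (Fr : ∀ k, cubicForm F (r (γ + f k)) = 0) {l : Fin 3 → ℂ}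
    (hl : l ≠ 0) (hFl : ∀ v, l ⬝ᵥ v = 0 → cubicForm F v = 0) : IsAddCyclic H := by
  have := Fintype.ofFinite K
  have hcard : 4 ≤ Fintype.card K := by
    have := addOrderOf_le_card_univ (x := g)
    omega
  obtain ⟨m, hm, h1 | h1 | h1⟩ :=
    (N.restrict f hf h).exists_collinear_of_line hcard hF Fp Fq Fr hl hFl
  · exact N.isAddCyclic_of_collinear_coset f hf hg hm h1
  · exact N.rotate.isAddCyclic_of_collinear_coset f hf hg hm h1
  · exact N.rotate.rotate.isAddCyclic_of_collinear_coset f hf hg hm h1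

end DualNet

/-! ### Common points of two plane cubics -/

open Polynomial in
/-- A ternary cubic form as a polynomial in its last variable. -/
noncomputable def cubicPoly {R : Type*} [CommRing R] (c : Fin 10 → R) (x y : R) : R[X] :=
  C (c 9) * X ^ 3 + C (c 5 * x + c 8 * y) * X ^ 2 +
    C (c 2 * x ^ 2 + c 4 * (x * y) + c 7 * y ^ 2) * X +
    C (c 0 * x ^ 3 + c 1 * (x ^ 2 * y) + c 3 * (x * y ^ 2) + c 6 * y ^ 3)

section
open Polynomial

theorem natDegree_cubicPoly_le {R : Type*} [CommRing R] (c : Fin 10 → R) (x y : R) :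
    (cubicPoly c x y).natDegree ≤ 3 := by
  unfold cubicPoly; compute_degree

theorem coeff_three_cubicPoly {R : Type*} [CommRing R] (c : Fin 10 → R) (x y : R) :
    (cubicPoly c x y).coeff 3 = c 9 := by
  unfold cubicPoly; compute_degree!

theorem natDegree_cubicPoly {c : Fin 10 → ℂ} (h : c 9 ≠ 0) (x y : ℂ) :
    (cubicPoly c x y).natDegree = 3 :=
  le_antisymm (natDegree_cubicPoly_le c x y)
    (le_natDegree_of_ne_zero (by rwa [coeff_three_cubicPoly]))

theorem map_cubicPoly {R S : Type*} [CommRing R] [CommRing S] (φ : R →+* S) (c : Fin 10 → R)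
    (x y : R) : (cubicPoly c x y).map φ = cubicPoly (fun i => φ (c i)) (φ x) (φ y) := by
  simp [cubicPoly]

theorem eval_cubicPoly (c : Fin 10 → ℂ) (x y z : ℂ) :
    (cubicPoly c x y).eval z = cubicForm c ![x, y, z] := by
  simp [cubicPoly, cubicForm]; ring

/-- A polynomial without zeros is constant. -/
theorem eval_eq_eval_of_forall_ne_zero {f : ℂ[X]} (h : ∀ t, f.eval t ≠ 0) (s t : ℂ) :
    f.eval s = f.eval t := by
  have hd : f.degree = 0 := by
    by_contra hd
    obtain ⟨x, hx⟩ := IsAlgClosed.exists_root f hd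
    exact h x hx
  rw [eq_C_of_degree_eq_zero hd]; simp

/-- Two plane cubics, one of which does not contain the point `(0 : 0 : 1)`, have a common point. -/
theorem exists_common_zero_aux {c d : Fin 10 → ℂ} (h : c 9 ≠ 0) :
    ∃ v : Fin 3 → ℂ, v ≠ 0 ∧ cubicForm c v = 0 ∧ cubicForm d v = 0 := by
  -- The resultant with respect to `z`. Without common points it is nonzero away from the origin,
  -- and restricted to a line that misses the origin it is a polynomial without zeros, hence
  -- constant. This leads to `ρ 0 0 = ρ 0 1 ≠ 0`, whereas at the origin both cubics reduce to
  -- multiples of `z³`. Homogeneity of the resultant is not needed.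
  let ρ : ℂ → ℂ → ℂ := fun x y => resultant (cubicPoly c x y) (cubicPoly d x y) 3 3
  have hρ : ∀ x y, ρ x y = 0 → ∃ z, cubicForm c ![x, y, z] = 0 ∧ cubicForm d ![x, y, z] = 0 := by
    intro x y h0
    have e := resultant_eq_prod_eval (cubicPoly c x y) (cubicPoly d x y) 3
      (natDegree_cubicPoly_le d x y) (IsAlgClosed.splits _)
    rw [natDegree_cubicPoly h] at e
    change ρ x y = _ at e
    rw [h0, eq_comm, mul_eq_zero, Multiset.prod_eq_zero_iff] at e
    have hl : (cubicPoly c x y).leadingCoeff ^ 3 ≠ 0 := by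
      rw [leadingCoeff, natDegree_cubicPoly h, coeff_three_cubicPoly]
      exact pow_ne_zero _ h
    obtain ⟨z, hz, hz'⟩ := Multiset.mem_map.1 (e.resolve_left hl)
    have := (mem_roots'.1 hz).2
    rw [IsRoot, eval_cubicPoly] at this
    rw [eval_cubicPoly] at hz'
    exact ⟨z, this, hz'⟩
  have line : ∀ x0 x1 y0 y1 : ℂ, ∃ f : ℂ[X], ∀ t, f.eval t = ρ (x0 + t * x1) (y0 + t * y1) := by
    intro x0 x1 y0 y1
    refine ⟨resultant (cubicPoly (fun i => C (c i)) (C x0 + X * C x1) (C y0 + X * C y1))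
      (cubicPoly (fun i => C (d i)) (C x0 + X * C x1) (C y0 + X * C y1)) 3 3, fun t => ?_⟩
    have e : ∀ c : Fin 10 → ℂ, (cubicPoly (fun i => C (c i)) (C x0 + X * C x1)
        (C y0 + X * C y1)).map (evalRingHom t) = cubicPoly c (x0 + t * x1) (y0 + t * y1) := by
      intro c
      rw [map_cubicPoly]
      simp only [coe_evalRingHom, eval_C, eval_add, eval_mul, eval_X]
    rw [← coe_evalRingHom, ← resultant_map_map, e, e]
  by_contra hno
  push Not at hno
  have hne : ∀ x y, (x ≠ 0 ∨ y ≠ 0) → ρ x y ≠ 0 := by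
    intro x y hxy h0
    obtain ⟨z, h1, h2⟩ := hρ x y h0
    refine hno _ ?_ h1 h2
    intro h3
    have e0 := congrFun h3 0
    have e1 := congrFun h3 1
    simp at e0 e1
    tauto
  have hconst : ∀ t, t ≠ 0 → ρ t 0 = ρ 0 1 := by
    intro t ht
    -- The line from `(t, 0)` to `(0, 1)`, which avoids the origin for `t ≠ 0`.
    obtain ⟨f, hf⟩ := line t (-t) 0 1
    have := eval_eq_eval_of_forall_ne_zero (f := f) (fun s => ?_) 0 1
    · simpa [hf] using this
    · rw [hf]
      apply hne
      by_cases hs : s = 0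
      · left; simpa [hs] using ht
      · right; simpa using hs
  have h00 : ρ 0 0 = ρ 0 1 := by
    obtain ⟨f, hf⟩ := line 0 1 0 0
    have : f - C (ρ 0 1) = 0 := by
      refine eq_zero_of_infinite_isRoot _ (Set.Infinite.mono (s := {0}ᶜ) ?_
        (Set.finite_singleton (0 : ℂ)).infinite_compl)
      intro t ht
      simp [hf, hconst t ht]
    have e := congrArg (eval 0) this
    simpa [hf, sub_eq_zero] using e
  refine hne 0 1 (by simp) (h00 ▸ ?_)
  have e : ∀ c : Fin 10 → ℂ, cubicPoly c 0 0 = C (c 9) * X ^ 3 := by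
    intro c; simp [cubicPoly]
  change resultant (cubicPoly c 0 0) (cubicPoly d 0 0) 3 3 = 0
  rw [e, e]
  rw [resultant_C_mul_left, resultant_C_mul_right, resultant_X_pow_left _ _ _ (by simp)]
  simp

end

/-- Two plane cubics have a common point. -/
theorem exists_common_zero {c : Fin 10 → ℂ} (h : c ≠ 0) (d : Fin 10 → ℂ) :
    ∃ v : Fin 3 → ℂ, v ≠ 0 ∧ cubicForm c v = 0 ∧ cubicForm d v = 0 := by
  obtain ⟨g, hg⟩ : ∃ g, cubicForm c g ≠ 0 := by
    by_contra h0; push Not at h0; exact h (eq_zero_of_cubicForm_eq_zero h0)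
  have hg0 : g ≠ 0 := by
    rintro rfl; simp [cubicForm] at hg
  obtain ⟨e, f, hef⟩ := exists_det3_ne_zero hg0
  obtain ⟨A, hA⟩ := exists_equiv_columns hef
  obtain ⟨c', hc⟩ := exists_cubicForm_comp c A.toLinearMap
  obtain ⟨d', hd⟩ := exists_cubicForm_comp d A.toLinearMap
  have h9 : c' 9 ≠ 0 := by
    have := hc ![0, 0, 1]
    simp [hA, cubicForm] at this
    simpa [this, cubicForm] using hg
  obtain ⟨v, hv, h1, h2⟩ := exists_common_zero_aux (d := d') h9
  exact ⟨A v, by simpa using hv, by rw [← h1, hc]; rfl, by rw [← h2, hd]; rfl⟩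

/-! ### The Hessian: a singular point or a flex -/

/-- The product of three linear forms is a cubic form. -/
theorem exists_cubicForm_eq_prod (f g h : Fin 3 → ℂ) :
    ∃ M : Fin 10 → ℂ, ∀ v, cubicForm M v = (f ⬝ᵥ v) * (g ⬝ᵥ v) * (h ⬝ᵥ v) := by
  refine ⟨![f 0 * g 0 * h 0, f 0 * g 0 * h 1 + f 0 * g 1 * h 0 + f 1 * g 0 * h 0,
    f 0 * g 0 * h 2 + f 0 * g 2 * h 0 + f 2 * g 0 * h 0,
    f 0 * g 1 * h 1 + f 1 * g 0 * h 1 + f 1 * g 1 * h 0,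
    f 0 * g 1 * h 2 + f 0 * g 2 * h 1 + f 1 * g 0 * h 2 + f 1 * g 2 * h 0 + f 2 * g 0 * h 1 +
      f 2 * g 1 * h 0,
    f 0 * g 2 * h 2 + f 2 * g 0 * h 2 + f 2 * g 2 * h 0, f 1 * g 1 * h 1,
    f 1 * g 1 * h 2 + f 1 * g 2 * h 1 + f 2 * g 1 * h 1,
    f 1 * g 2 * h 2 + f 2 * g 1 * h 2 + f 2 * g 2 * h 1, f 2 * g 2 * h 2], fun v => ?_⟩
  simp only [cubicForm, dot3, Matrix.cons_val]
  ring

theorem cubicForm_add (c d : Fin 10 → ℂ) (v : Fin 3 → ℂ) :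
    cubicForm (c + d) v = cubicForm c v + cubicForm d v := by
  simp only [cubicForm, Pi.add_apply]; ring

/-- The rows of the Hessian matrix of a cubic form. -/
def hess (c : Fin 10 → ℂ) (v : Fin 3 → ℂ) : Fin 3 → Fin 3 → ℂ :=
  ![![6 * c 0 * v 0 + 2 * c 1 * v 1 + 2 * c 2 * v 2, 2 * c 1 * v 0 + 2 * c 3 * v 1 + c 4 * v 2,
      2 * c 2 * v 0 + c 4 * v 1 + 2 * c 5 * v 2],
    ![2 * c 1 * v 0 + 2 * c 3 * v 1 + c 4 * v 2, 2 * c 3 * v 0 + 6 * c 6 * v 1 + 2 * c 7 * v 2,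
      c 4 * v 0 + 2 * c 7 * v 1 + 2 * c 8 * v 2],
    ![2 * c 2 * v 0 + c 4 * v 1 + 2 * c 5 * v 2, c 4 * v 0 + 2 * c 7 * v 1 + 2 * c 8 * v 2,
      2 * c 5 * v 0 + 2 * c 8 * v 1 + 6 * c 9 * v 2]]

/-- The entries are linear forms, so the determinant is a sum of products of three linear forms. As
a cubic form the Hessian can be intersected with the curve. -/
theorem exists_cubicForm_eq_hess (c : Fin 10 → ℂ) :
    ∃ d, ∀ v, cubicForm d v = det3 (hess c v 0) (hess c v 1) (hess c v 2) := by
  let l00 : Fin 3 → ℂ := ![6 * c 0, 2 * c 1, 2 * c 2]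
  let l01 : Fin 3 → ℂ := ![2 * c 1, 2 * c 3, c 4]
  let l02 : Fin 3 → ℂ := ![2 * c 2, c 4, 2 * c 5]
  let l11 : Fin 3 → ℂ := ![2 * c 3, 6 * c 6, 2 * c 7]
  let l12 : Fin 3 → ℂ := ![c 4, 2 * c 7, 2 * c 8]
  let l22 : Fin 3 → ℂ := ![2 * c 5, 2 * c 8, 6 * c 9]
  obtain ⟨d1, h1⟩ := exists_cubicForm_eq_prod l00 l11 l22
  obtain ⟨d2, h2⟩ := exists_cubicForm_eq_prod l01 l12 ((2 : ℂ) • l02)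
  obtain ⟨d3, h3⟩ := exists_cubicForm_eq_prod l00 l12 (-l12)
  obtain ⟨d4, h4⟩ := exists_cubicForm_eq_prod l11 l02 (-l02)
  obtain ⟨d5, h5⟩ := exists_cubicForm_eq_prod l22 l01 (-l01)
  refine ⟨d1 + d2 + d3 + d4 + d5, fun v => ?_⟩
  simp only [cubicForm_add, h1, h2, h3, h4, h5]
  simp only [dot3, det3, hess, l00, l01, l02, l11, l12, l22, Matrix.cons_val, Pi.neg_apply,
    Pi.smul_apply, smul_eq_mul]
  ring

/-- The derivative of a cubic form at `v` in the direction `u`. -/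
def cubicDeriv (c : Fin 10 → ℂ) (v u : Fin 3 → ℂ) : ℂ :=
  (3 * c 0 * v 0 ^ 2 + 2 * c 1 * v 0 * v 1 + 2 * c 2 * v 0 * v 2 + c 3 * v 1 ^ 2 +
      c 4 * v 1 * v 2 + c 5 * v 2 ^ 2) * u 0 +
    (c 1 * v 0 ^ 2 + 2 * c 3 * v 0 * v 1 + c 4 * v 0 * v 2 + 3 * c 6 * v 1 ^ 2 +
      2 * c 7 * v 1 * v 2 + c 8 * v 2 ^ 2) * u 1 +
    (c 2 * v 0 ^ 2 + c 4 * v 0 * v 1 + 2 * c 5 * v 0 * v 2 + c 7 * v 1 ^ 2 +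
      2 * c 8 * v 1 * v 2 + 3 * c 9 * v 2 ^ 2) * u 2

theorem cubicForm_smul_add_smul (c : Fin 10 → ℂ) (u v : Fin 3 → ℂ) (s t : ℂ) :
    cubicForm c (s • u + t • v) = s ^ 3 * cubicForm c u + s ^ 2 * t * cubicDeriv c u v +
      s * t ^ 2 * cubicDeriv c v u + t ^ 3 * cubicForm c v := by
  simp only [cubicForm, cubicDeriv, Pi.add_apply, Pi.smul_apply, smul_eq_mul]; ring

theorem cubicDeriv_self (c : Fin 10 → ℂ) (v : Fin 3 → ℂ) :
    cubicDeriv c v v = 3 * cubicForm c v := by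
  simp only [cubicForm, cubicDeriv]; ring

/-- A plane cubic has a singular point or a flex. -/
theorem exists_singular_or_flex {c : Fin 10 → ℂ} (h : c ≠ 0) :
    ∃ P : Fin 3 → ℂ, P ≠ 0 ∧ ((∀ u, cubicDeriv c P u = 0) ∨
      ∃ v, (∀ t : ℂ, v ≠ t • P) ∧
        ∀ s t : ℂ, cubicForm c (s • P + t • v) = t ^ 3 * cubicForm c v) := by
  obtain ⟨d, hd⟩ := exists_cubicForm_eq_hess c
  obtain ⟨P, hP, h1, h2⟩ := exists_common_zero h d
  rw [hd, det3_eq_zero_iff] at h2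
  -- `v` is in the kernel of the Hessian matrix at `P`. By Euler's relation `P` is singular if `v`
  -- is a multiple of `P`. Otherwise pairing with `P` and with `v` kills both mixed coefficients of
  -- the cubic on the line through `P` and `v`.
  obtain ⟨v, hv, e0, e1, e2⟩ := h2
  have hu : ∀ u : Fin 3 → ℂ,
      u 0 * (hess c P 0 ⬝ᵥ v) + u 1 * (hess c P 1 ⬝ᵥ v) + u 2 * (hess c P 2 ⬝ᵥ v) = 0 := by
    intro u; rw [e0, e1, e2]; ring
  refine ⟨P, hP, ?_⟩
  by_cases hvP : ∃ t : ℂ, v = t • P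
  · left
    obtain ⟨t, rfl⟩ := hvP
    have ht : t ≠ 0 := by rintro rfl; simp at hv
    intro u
    refine (mul_eq_zero.1 (?_ : 2 * t * cubicDeriv c P u = 0)).resolve_left (by simpa using ht)
    rw [← hu u]
    simp only [cubicDeriv, dot3, hess, Matrix.cons_val, Pi.smul_apply, smul_eq_mul]
    ring
  · right
    push Not at hvP
    refine ⟨v, hvP, fun s t => ?_⟩
    have d1 : cubicDeriv c P v = 0 := by
      linear_combination (exp := 1) (1 / 2 : ℂ) * hu P + (by
        simp only [cubicDeriv, dot3, hess, Matrix.cons_val]; ring :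
        cubicDeriv c P v - (1 / 2 : ℂ) * (P 0 * (hess c P 0 ⬝ᵥ v) + P 1 * (hess c P 1 ⬝ᵥ v) +
          P 2 * (hess c P 2 ⬝ᵥ v)) = 0)
    have d2 : cubicDeriv c v P = 0 := by
      linear_combination (exp := 1) (1 / 2 : ℂ) * hu v + (by
        simp only [cubicDeriv, dot3, hess, Matrix.cons_val]; ring :
        cubicDeriv c v P - (1 / 2 : ℂ) * (v 0 * (hess c P 0 ⬝ᵥ v) + v 1 * (hess c P 1 ⬝ᵥ v) +
          v 2 * (hess c P 2 ⬝ᵥ v)) = 0)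
    rw [cubicForm_smul_add_smul, h1, d1, d2]; ring

/-! ### Reduction to Weierstrass form -/

/-- The homogeneous Weierstrass form. -/
def weierForm (a b : ℂ) (v : Fin 3 → ℂ) : ℂ :=
  v 1 ^ 2 * v 2 - v 0 ^ 3 - a * (v 0 * v 2 ^ 2) - b * v 2 ^ 3

/-- A cubic form that is a multiple of a Weierstrass form in suitable coordinates. -/
def HasWeierForm (F : Fin 10 → ℂ) : Prop :=
  ∃ (A : (Fin 3 → ℂ) ≃ₗ[ℂ] (Fin 3 → ℂ)) (κ a b : ℂ), κ ≠ 0 ∧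
    ∀ v, cubicForm F (A v) = κ * weierForm a b v

/-- The cubic contains no line. -/
def Lineless (F : Fin 10 → ℂ) : Prop :=
  ∀ l : Fin 3 → ℂ, l ≠ 0 → ∃ v, l ⬝ᵥ v = 0 ∧ cubicForm F v ≠ 0

theorem HasWeierForm.of_columns {F F' : Fin 10 → ℂ} (h : HasWeierForm F') {e f g : Fin 3 → ℂ}
    (hd : det3 e f g ≠ 0)
    (hF : ∀ v, cubicForm F' v = cubicForm F (v 0 • e + v 1 • f + v 2 • g)) : HasWeierForm F := by
  obtain ⟨A, κ, a, b, hκ, hA⟩ := h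
  obtain ⟨B, hB⟩ := exists_equiv_columns hd
  exact ⟨A.trans B, κ, a, b, hκ, fun v => by rw [← hA, hF, ← hB]; rfl⟩

theorem Lineless.of_columns {F F' : Fin 10 → ℂ} (h : Lineless F) {e f g : Fin 3 → ℂ}
    (hd : det3 e f g ≠ 0)
    (hF : ∀ v, cubicForm F' v = cubicForm F (v 0 • e + v 1 • f + v 2 • g)) : Lineless F' := by
  obtain ⟨B, hB⟩ := exists_equiv_columns hd
  intro l hl
  let l' : Fin 3 → ℂ := ![l ⬝ᵥ B.symm ![1, 0, 0], l ⬝ᵥ B.symm ![0, 1, 0], l ⬝ᵥ B.symm ![0, 0, 1]]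
  have hl' : ∀ w, l' ⬝ᵥ w = l ⬝ᵥ B.symm w := by
    intro w
    have := linearMap_apply B.symm.toLinearMap w
    simp only [LinearEquiv.coe_coe] at this
    rw [dot3, dot3, this, this, this]
    simp only [l', dot3, Matrix.cons_val]
    ring
  have hl0 : l' ≠ 0 := by
    intro h0
    apply hl
    ext i
    have := hl' (B (Pi.single i 1))
    rw [h0] at this
    simpa using this.symm
  obtain ⟨v, hv, hv'⟩ := h l' hl0
  refine ⟨B.symm v, by rw [← hl', hv], ?_⟩
  rwa [hF, ← hB, B.apply_symm_apply]

theorem Lineless.ne_zero {F : Fin 10 → ℂ} (h : Lineless F) : F ≠ 0 := by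
  rintro rfl
  obtain ⟨v, -, hv⟩ := h ![1, 0, 0] (fun h => by simpa using congrFun h 0)
  simp [cubicForm] at hv

/-- Scaling `z` makes the coefficients of `y²z` and `x³` opposite. -/
theorem hasWeierForm_scale {F : Fin 10 → ℂ} (h1 : F 1 = 0) (h2 : F 2 = 0) (h3 : F 3 = 0)
    (h4 : F 4 = 0) (h6 : F 6 = 0) (h8 : F 8 = 0) (h0 : F 0 ≠ 0) (h7 : F 7 ≠ 0) :
    HasWeierForm F := by
  obtain ⟨A, hA⟩ := exists_equiv_columns (e := ![1, 0, 0]) (f := ![0, 1, 0])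
    (g := ![0, 0, -F 0 / F 7]) (by simp [det3, h0, h7])
  refine ⟨A, -F 0, F 5 * F 0 / F 7 ^ 2, -F 9 * F 0 ^ 2 / F 7 ^ 3, neg_ne_zero.2 h0, fun v => ?_⟩
  rw [hA]
  simp [cubicForm, weierForm, h1, h2, h3, h4, h6, h8]
  field_simp
  ring

/-- Shifting `x` by a multiple of `z` removes `x²z`. -/
theorem hasWeierForm_completeCube {F : Fin 10 → ℂ} (h1 : F 1 = 0) (h3 : F 3 = 0)
    (h4 : F 4 = 0) (h6 : F 6 = 0) (h8 : F 8 = 0) (h0 : F 0 ≠ 0) (h7 : F 7 ≠ 0) :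
    HasWeierForm F := by
  have key : HasWeierForm ![F 0, 0, 0, 0, 0, F 5 - F 2 ^ 2 / (3 * F 0), 0, F 7, 0,
      F 9 - F 5 * F 2 / (3 * F 0) + 2 * F 2 ^ 3 / (27 * F 0 ^ 2)] :=
    hasWeierForm_scale rfl rfl rfl rfl rfl rfl h0 h7
  refine key.of_columns (e := ![1, 0, 0]) (f := ![0, 1, 0]) (g := ![-F 2 / (3 * F 0), 0, 1])
    (by simp [det3]) fun v => ?_
  simp [cubicForm, h1, h3, h4, h6, h8]
  field_simp
  ring

/-- Shifting `y` by a combination of `x` and `z` removes `xyz` and `yz²`. -/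
theorem hasWeierForm_completeSquare {F : Fin 10 → ℂ} (h1 : F 1 = 0) (h3 : F 3 = 0)
    (h6 : F 6 = 0) (h0 : F 0 ≠ 0) (h7 : F 7 ≠ 0) : HasWeierForm F := by
  have key : HasWeierForm ![F 0, 0, F 2 - F 4 ^ 2 / (4 * F 7), 0, 0,
      F 5 - F 4 * F 8 / (2 * F 7), 0, F 7, 0, F 9 - F 8 ^ 2 / (4 * F 7)] :=
    hasWeierForm_completeCube rfl rfl rfl rfl rfl h0 h7
  refine key.of_columns (e := ![1, -F 4 / (2 * F 7), 0]) (f := ![0, 1, 0])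
    (g := ![0, -F 8 / (2 * F 7), 1]) (by simp [det3]) fun v => ?_
  simp [cubicForm, h1, h3, h6]
  field_simp
  ring

theorem exists_pow_three_eq {u : ℂ} (hu : u ≠ 0) : ∃ t, t ^ 3 = u ∧ t ≠ 0 := by
  obtain ⟨t, ht⟩ := IsAlgClosed.exists_pow_nat_eq u (n := 3) (by norm_num)
  exact ⟨t, ht, by rintro rfl; simp at ht; exact hu ht.symm⟩

/-- With `s³` and `t³` the outer coefficients, put `s x = (X + Y) / 2` and `t y = (X - Y) / 2`. The
two cubes give `(X³ + 3XY²) / 4`, and `z = s t (3X + 4Z)` is chosen so that `xyz` cancels `XY²`,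
leaving `X³ + X²Z - Y²Z`. -/
theorem hasWeierForm_node {F : Fin 10 → ℂ} (h1 : F 1 = 0) (h2 : F 2 = 0) (h3 : F 3 = 0)
    (h4 : F 4 = 1) (h5 : F 5 = 0) (h7 : F 7 = 0) (h8 : F 8 = 0) (h9 : F 9 = 0) (h0 : F 0 ≠ 0)
    (h6 : F 6 ≠ 0) : HasWeierForm F := by
  obtain ⟨s, hs, hs0⟩ := exists_pow_three_eq h0
  obtain ⟨t, ht, ht0⟩ := exists_pow_three_eq h6
  have key : HasWeierForm ![1, 0, 1, 0, 0, 0, 0, -1, 0, 0] :=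
    hasWeierForm_completeCube rfl rfl rfl rfl rfl (by simp) (by simp)
  refine key.of_columns (e := ![1 / (2 * s), 1 / (2 * t), 3 * s * t])
    (f := ![1 / (2 * s), -1 / (2 * t), 0]) (g := ![0, 0, 4 * s * t]) ?_ fun v => ?_
  · have e : det3 ![1 / (2 * s), 1 / (2 * t), 3 * s * t] ![1 / (2 * s), -1 / (2 * t), 0]
        ![0, 0, 4 * s * t] = -2 := by
      simp only [det3, Matrix.cons_val]; field_simp; ring
    rw [e]; norm_num
  · simp [cubicForm, h1, h2, h3, h4, h5, h7, h8, h9, ← hs, ← ht]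
    field_simp
    ring

/-- The terms `x²y` and `xy²` are absorbed into `z` through `xyz`. If `x³` or `y³` were missing, the
cubic would contain the line `y = 0` or `x = 0`. -/
theorem hasWeierForm_absorb_node {F : Fin 10 → ℂ} (hl : Lineless F) (h2 : F 2 = 0)
    (h4 : F 4 = 1) (h5 : F 5 = 0) (h7 : F 7 = 0) (h8 : F 8 = 0) (h9 : F 9 = 0) :
    HasWeierForm F := by
  have h0 : F 0 ≠ 0 := by
    intro h0
    obtain ⟨v, hv, hv'⟩ := hl ![0, 1, 0] (fun h => by simpa using congrFun h 1)
    have : v 1 = 0 := by rw [dot3] at hv; simpa using hv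
    exact hv' (by simp [cubicForm, h0, this, h2, h5, h9])
  have h6 : F 6 ≠ 0 := by
    intro h6
    obtain ⟨v, hv, hv'⟩ := hl ![1, 0, 0] (fun h => by simpa using congrFun h 0)
    have : v 0 = 0 := by rw [dot3] at hv; simpa using hv
    exact hv' (by simp [cubicForm, h6, this, h7, h8, h9])
  have key : HasWeierForm ![F 0, 0, 0, 0, 1, 0, F 6, 0, 0, 0] :=
    hasWeierForm_node rfl rfl rfl rfl rfl rfl rfl rfl h0 h6
  refine key.of_columns (e := ![1, 0, -F 1]) (f := ![0, 1, -F 3]) (g := ![0, 0, 1])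
    (by simp [det3]) fun v => ?_
  simp [cubicForm, h2, h4, h5, h7, h8, h9]
  ring

/-- Completing the cube in `y` removes `xy²`, and the remaining multiples of `x²` are absorbed into
`z` through `x²z`. The new coordinates exchange the roles of `x` and `y`. -/
theorem hasWeierForm_cusp {F : Fin 10 → ℂ} (hl : Lineless F) (h2 : F 2 ≠ 0)
    (h4 : F 4 = 0) (h5 : F 5 = 0) (h7 : F 7 = 0) (h8 : F 8 = 0) (h9 : F 9 = 0) :
    HasWeierForm F := by
  have h6 : F 6 ≠ 0 := by
    intro h6
    obtain ⟨v, hv, hv'⟩ := hl ![1, 0, 0] (fun h => by simpa using congrFun h 0)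
    have : v 0 = 0 := by rw [dot3] at hv; simpa using hv
    exact hv' (by simp [cubicForm, h6, this, h7, h8, h9])
  have key : HasWeierForm ![F 6, 0, 0, 0, 0, 0, 0, F 2, 0, 0] :=
    hasWeierForm_scale rfl rfl rfl rfl rfl rfl h6 h2
  set s := -F 3 / (3 * F 6) with hs
  have hs' : 3 * F 6 * s = -F 3 := by rw [hs]; field_simp
  set t := -(F 1 + 2 * F 3 * s + 3 * F 6 * s ^ 2) / F 2 with ht
  have ht' : F 2 * t = -(F 1 + 2 * F 3 * s + 3 * F 6 * s ^ 2) := by rw [ht]; field_simp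
  set w := -(F 0 + F 1 * s + F 3 * s ^ 2 + F 6 * s ^ 3 + F 2 * t * s) / F 2 with hw
  refine key.of_columns (e := ![0, 1, t]) (f := ![1, s, w + t * s])
    (g := ![0, 0, 1]) (by simp [det3]) fun v => ?_
  have hw' : F 2 * (w + t * s) = -(F 0 + F 1 * s + F 3 * s ^ 2 + F 6 * s ^ 3) := by
    rw [hw]; field_simp; ring
  simp [cubicForm, h4, h5, h7, h8, h9]
  linear_combination -(v 0 ^ 2 * v 1) * hs' - v 0 * v 1 ^ 2 * ht' - v 1 ^ 3 * hw'

/-- A binary quadratic form splits into linear forms. -/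
theorem exists_binary_factor (A B C : ℂ) :
    ∃ α β γ δ : ℂ, A = α * γ ∧ B = α * δ + β * γ ∧ C = β * δ := by
  by_cases hA : A = 0
  · exact ⟨0, 1, B, C, by simp [hA], by simp, by simp⟩
  · obtain ⟨d, hd⟩ := IsAlgClosed.exists_pow_nat_eq (B ^ 2 - 4 * A * C) (n := 2) (by norm_num)
    refine ⟨A, (B + d) / 2, 1, (B - d) / (2 * A), by simp, ?_, ?_⟩
    · field_simp; ring
    · field_simp; linear_combination hd

/-- A binary cubic form has a nontrivial zero. -/
theorem exists_binary_cubic_zero (A B C D : ℂ) : ∃ x y : ℂ, (x ≠ 0 ∨ y ≠ 0) ∧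
    A * x ^ 3 + B * (x ^ 2 * y) + C * (x * y ^ 2) + D * y ^ 3 = 0 := by
  by_cases hA : A = 0
  · exact ⟨1, 0, by simp, by simp [hA]⟩
  · obtain ⟨x, hx⟩ := IsAlgClosed.exists_root
      (Polynomial.C A * Polynomial.X ^ 3 + Polynomial.C B * Polynomial.X ^ 2 +
        Polynomial.C C * Polynomial.X + Polynomial.C D) (by
        rw [Polynomial.degree_cubic hA]; norm_num)
    refine ⟨x, 1, by simp, ?_⟩
    simpa [Polynomial.IsRoot] using hx

theorem exists_columns_form (F : Fin 10 → ℂ) {e f g : Fin 3 → ℂ} (hd : det3 e f g ≠ 0) :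
    ∃ F', ∀ v, cubicForm F' v = cubicForm F (v 0 • e + v 1 • f + v 2 • g) := by
  obtain ⟨B, hB⟩ := exists_equiv_columns hd
  obtain ⟨c, hc⟩ := exists_cubicForm_comp F B.toLinearMap
  exact ⟨c, fun v => by rw [hc, ← hB]; rfl⟩

/-- A cubic of the form `z q(x, y) + c(x, y)` in new coordinates `x`, `y`. -/
theorem exists_columns_form_eq {F : Fin 10 → ℂ} (h5 : F 5 = 0) (h8 : F 8 = 0) (h9 : F 9 = 0)
    {α β γ δ : ℂ} (hd : α * δ - β * γ ≠ 0) (A B C : ℂ)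
    (hq : ∀ x y, F 2 * (α * x + β * y) ^ 2 + F 4 * ((α * x + β * y) * (γ * x + δ * y)) +
      F 7 * (γ * x + δ * y) ^ 2 = A * x ^ 2 + B * (x * y) + C * y ^ 2) :
    ∃ F' : Fin 10 → ℂ, F' 2 = A ∧ F' 4 = B ∧ F' 5 = 0 ∧ F' 7 = C ∧ F' 8 = 0 ∧ F' 9 = 0 ∧
      ∀ v, cubicForm F' v = cubicForm F (v 0 • ![α, γ, 0] + v 1 • ![β, δ, 0] + v 2 • ![0, 0, 1]) := by
  have hd' : det3 ![α, γ, 0] ![β, δ, 0] ![0, 0, 1] ≠ 0 := by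
    simp only [det3, Matrix.cons_val]; intro h0; apply hd; linear_combination h0
  obtain ⟨c, hc⟩ := exists_columns_form F hd'
  refine ⟨![c 0, c 1, A, c 3, B, 0, c 6, C, 0, 0], rfl, rfl, rfl, rfl, rfl, rfl, fun v => ?_⟩
  have e := hc ![v 0, v 1, 0]
  have q := hq (v 0) (v 1)
  simp [cubicForm] at e
  simp [cubicForm, h5, h8, h9]
  linear_combination e - v 2 * q

/-- The cubic is `z q(x, y) + c(x, y)`. Independent linear factors of `q` give a node, a double
factor gives a cusp, and `q = 0` gives a cone, which contains a line. -/
theorem hasWeierForm_of_singular_aux {F : Fin 10 → ℂ} (hl : Lineless F) (h5 : F 5 = 0)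
    (h8 : F 8 = 0) (h9 : F 9 = 0) : HasWeierForm F := by
  obtain ⟨α, β, γ, δ, hA, hB, hC⟩ := exists_binary_factor (F 2) (F 4) (F 7)
  by_cases hd : α * δ - β * γ = 0
  · by_cases hq : F 2 = 0 ∧ F 4 = 0 ∧ F 7 = 0
    · obtain ⟨q2, q4, q7⟩ := hq
      obtain ⟨x, y, hxy, h0⟩ := exists_binary_cubic_zero (F 0) (F 1) (F 3) (F 6)
      exfalso
      obtain ⟨v, hv, hv'⟩ := hl ![y, -x, 0] (fun h => by
        have e0 := congrFun h 0
        have e1 := congrFun h 1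
        simp at e0 e1
        tauto)
      apply hv'
      have hv0 : y * v 0 = x * v 1 := by
        have : y * v 0 + -(x * v 1) = 0 := by rw [dot3] at hv; simpa using hv
        linear_combination this
      simp only [cubicForm, q2, q4, q7, h5, h8, h9]
      rcases hxy with hx | hy
      · have : v 1 = v 0 / x * y := by field_simp; linear_combination -hv0
        rw [this]; field_simp; linear_combination v 0 ^ 3 * h0
      · have : v 0 = v 1 / y * x := by field_simp; linear_combination hv0
        rw [this]; field_simp; linear_combination v 1 ^ 3 * h0
    · -- a double linear factor
      obtain ⟨α, β, κ, hab, q2, q4, q7⟩ : ∃ α β κ : ℂ, (α ≠ 0 ∨ β ≠ 0) ∧ F 2 = κ * α ^ 2 ∧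
          F 4 = 2 * κ * α * β ∧ F 7 = κ * β ^ 2 := by
        by_cases hα : α = 0
        · by_cases hβ : β = 0
          · exact absurd ⟨by simp [hA, hα], by simp [hB, hα, hβ], by simp [hC, hβ]⟩ hq
          · have hγ : γ = 0 := by simpa [hα, hβ] using hd
            refine ⟨α, β, δ / β, Or.inr hβ, ?_, ?_, ?_⟩
            · rw [hA, hα, hγ]; ring
            · rw [hB, hα, hγ]; ring
            · rw [hC]; field_simp
        · refine ⟨α, β, γ / α, Or.inl hα, ?_, ?_, ?_⟩
          · rw [hA]; field_simp
          · rw [hB]; field_simp; linear_combination hd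
          · rw [hC]; field_simp; linear_combination β * hd
      have hκ : κ ≠ 0 := by
        rintro rfl; exact hq (by simp [q2, q4, q7])
      obtain ⟨s, t, hst⟩ : ∃ s t : ℂ, α * s + β * t = 1 := by
        rcases hab with h | h
        · exact ⟨1 / α, 0, by field_simp; simp⟩
        · exact ⟨0, 1 / β, by field_simp; simp⟩
      obtain ⟨F', e2, e4, e5, e7, e8, e9, hF'⟩ := exists_columns_form_eq h5 h8 h9
        (α := s) (β := -β) (γ := t) (δ := α)
        (by rw [show s * α - -β * t = 1 by linear_combination hst]; exact one_ne_zero)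
        κ 0 0 (by
          intro x y
          rw [q2, q4, q7]
          linear_combination κ * x ^ 2 * (α * s + β * t + 1) * hst)
      have hdet : det3 ![s, t, 0] ![-β, α, 0] ![0, 0, 1] ≠ 0 := by
        simp only [det3, Matrix.cons_val]
        rw [show s * (α * 1 - 0 * 0) - t * (-β * 1 - 0 * 0) + 0 * (-β * 0 - α * 0) = 1 by
          linear_combination hst]
        exact one_ne_zero
      exact (hasWeierForm_cusp (hl.of_columns hdet hF') (e2 ▸ hκ) e4 e5 e7 e8 e9).of_columns hdet hF'
  · obtain ⟨D, hD⟩ : ∃ D, D = α * δ - β * γ := ⟨_, rfl⟩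
    rw [← hD] at hd
    have e : δ / D * (α / D) -
        -β / D * (-γ / D) = 1 / D := by
      field_simp; linear_combination -hD
    obtain ⟨F', e2, e4, e5, e7, e8, e9, hF'⟩ := exists_columns_form_eq h5 h8 h9
      (α := δ / D) (β := -β / D) (γ := -γ / D)
      (δ := α / D) (by rw [e]; exact one_div_ne_zero hd) 0 1 0 (by
        intro x y
        rw [hA, hB, hC]
        have h1 : α * (δ / D * x + -β / D * y) +
          β * (-γ / D * x + α / D * y) = x := by
          field_simp; linear_combination -x * hD
        have h2 : γ * (δ / D * x + -β / D * y) +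
          δ * (-γ / D * x + α / D * y) = y := by
          field_simp; linear_combination -y * hD
        generalize δ / D * x + -β / D * y = X at *
        generalize -γ / D * x + α / D * y = Y at *
        rw [← h1, ← h2]; ring)
    have hdet : det3 ![δ / D, -γ / D, 0]
        ![-β / D, α / D, 0] ![0, 0, 1] ≠ 0 := by
      have := one_div_ne_zero hd
      rw [← e] at this
      simp only [det3, Matrix.cons_val]
      intro h0
      apply this
      linear_combination h0
    exact (hasWeierForm_absorb_node (hl.of_columns hdet hF') e2 e4 e5 e7 e8 e9).of_columns hdet hF'

theorem hasWeierForm_of_singular {F : Fin 10 → ℂ} (hl : Lineless F) {P : Fin 3 → ℂ} (hP : P ≠ 0)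
    (h : ∀ u, cubicDeriv F P u = 0) : HasWeierForm F := by
  obtain ⟨e, f, hd⟩ := exists_det3_ne_zero hP
  obtain ⟨F', hF'⟩ := exists_columns_form F hd
  have hF0 : cubicForm F P = 0 := by
    have := cubicDeriv_self F P
    rw [h] at this
    simpa using this.symm
  have key : ∀ u t, cubicForm F (u + t • P) = cubicForm F u + t * cubicDeriv F u P := by
    intro u t
    have := cubicForm_smul_add_smul F u P 1 t
    rw [h, hF0, one_smul] at this
    linear_combination this
  -- With the singular point at `(0 : 0 : 1)` the form is affine in the last coordinate, so its
  -- terms of higher degree in `z` vanish.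
  have k1 : ∀ x y t, cubicForm F' ![x, y, t] = cubicForm F' ![x, y, 0] +
      t * (cubicForm F' ![x, y, 1] - cubicForm F' ![x, y, 0]) := by
    intro x y t
    simp only [hF', key, Matrix.cons_val]
    ring
  have a1 := k1 0 0 2
  have a2 := k1 0 0 (-1)
  have b1 := k1 1 0 2
  have c1 := k1 0 1 2
  simp [cubicForm] at a1 a2 b1 c1
  have h9 : F' 9 = 0 := by linear_combination a1 / 6
  refine (hasWeierForm_of_singular_aux (hl.of_columns hd hF') ?_ ?_ h9).of_columns hd hF'
  · linear_combination b1 / 2 - 3 * h9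
  · linear_combination c1 / 2 - 3 * h9

/-- A plane cubic without lines has a Weierstrass form. -/
theorem Lineless.hasWeierForm {F : Fin 10 → ℂ} (hl : Lineless F) : HasWeierForm F := by
  obtain ⟨P, hP, h | ⟨v, hv, h⟩⟩ := exists_singular_or_flex hl.ne_zero
  · exact hasWeierForm_of_singular hl hP h
  have hc : cross v P ≠ 0 := by
    intro h0
    have e0 := congrFun h0 0
    have e1 := congrFun h0 1
    have e2 := congrFun h0 2
    simp [cross] at e0 e1 e2
    obtain ⟨i, hi⟩ := Function.ne_iff.1 hP
    simp only [Pi.zero_apply] at hi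
    apply hv (v i / P i)
    ext j
    simp only [Pi.smul_apply, smul_eq_mul]
    field_simp
    fin_cases i <;> fin_cases j <;>
      simp only [Fin.zero_eta, Fin.mk_one, Fin.reduceFinMk] <;>
      first | ring1 | linear_combination e0 | linear_combination e1 | linear_combination e2 |
        linear_combination -e0 | linear_combination -e1 | linear_combination -e2
  obtain ⟨i, hi⟩ := Function.ne_iff.1 hc
  simp only [Pi.zero_apply] at hi
  have hd : det3 v P (Pi.single i 1) ≠ 0 := by
    rw [← cross_dot]; simpa using hi
  obtain ⟨F', hF'⟩ := exists_columns_form F hd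
  have hl' := hl.of_columns hd hF'
  -- The flex is now `(0 : 1 : 0)` and its tangent is `z = 0`, on which only `x³` remains. If `y²z`
  -- is missing as well, the flex is a singular point.
  have k : ∀ x y, cubicForm F' ![x, y, 0] = x ^ 3 * cubicForm F v := by
    intro x y
    rw [hF', ← h y x]
    congr 1
    simp [add_comm]
  have k1 := k 1 0
  have k2 := k 0 1
  have k3 := k 1 1
  have k4 := k 1 (-1)
  simp [cubicForm] at k2
  simp only [cubicForm, Matrix.cons_val] at k1 k3 k4
  have h1 : F' 1 = 0 := by linear_combination k3 / 2 - k4 / 2 - k2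
  have h3 : F' 3 = 0 := by linear_combination k3 / 2 + k4 / 2 - k1
  have h0 : F' 0 ≠ 0 := by
    intro h0
    obtain ⟨w, hw, hw'⟩ := hl' ![0, 0, 1] (fun h => by simpa using congrFun h 2)
    have : w 2 = 0 := by rw [dot3] at hw; simpa using hw
    exact hw' (by simp [cubicForm, h0, h1, h3, k2, this])
  by_cases h7 : F' 7 = 0
  · refine (hasWeierForm_of_singular hl' (P := ![0, 1, 0]) ?_ ?_).of_columns hd hF'
    · intro h; simpa using congrFun h 1
    · intro u; simp [cubicDeriv, h3, k2, h7]
  · exact (hasWeierForm_completeSquare h1 h3 k2 h0 h7).of_columns hd hF'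

/-! ### Two cubics with ten common points -/

section
open Polynomial

/-- A polynomial with prescribed zeros, some of them double. -/
theorem card_le_natDegree_of_zeros {ι : Type*} {N : ℂ[X]} (hN : N ≠ 0) (s : Finset ι) (x : ι → ℂ)
    (h1 : ∀ i ∈ s, N.IsRoot (x i))
    (h2 : ∀ i ∈ s, ∀ j ∈ s, i ≠ j → x i = x j → (X - C (x i)) ^ 2 ∣ N)
    (h3 : ∀ i ∈ s, ∀ j ∈ s, ∀ k ∈ s, x i = x j → x i = x k → i = j ∨ i = k ∨ j = k) :
    s.card ≤ N.natDegree := by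
  classical
  -- A fiber of `x` has at most two elements by `h3`, and over a fiber of two elements the root is
  -- double by `h2`.
  have hle : s.card ≤ ∑ u ∈ s.image x, N.roots.count u := by
    rw [Finset.card_eq_sum_card_image x s]
    refine Finset.sum_le_sum fun u hu => ?_
    obtain ⟨i, hi, rfl⟩ := Finset.mem_image.1 hu
    rw [count_roots]
    by_cases hc : (s.filter fun j => x j = x i).card ≤ 1
    · exact hc.trans ((rootMultiplicity_pos hN).2 (h1 i hi))
    · push Not at hc
      have hle2 : (s.filter fun j => x j = x i).card ≤ 2 := by
        by_contra h
        push Not at h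
        obtain ⟨a, b, c, ha, hb, hc, hab, hac, hbc⟩ := Finset.two_lt_card_iff.1 h
        simp only [Finset.mem_filter] at ha hb hc
        rcases h3 a ha.1 b hb.1 c hc.1 (ha.2.trans hb.2.symm) (ha.2.trans hc.2.symm) with h | h | h
        exacts [hab h, hac h, hbc h]
      obtain ⟨a, ha, b, hb, hab⟩ := Finset.one_lt_card.1 hc
      simp only [Finset.mem_filter] at ha hb
      refine hle2.trans ((le_rootMultiplicity_iff hN).2 ?_)
      rw [← ha.2]
      exact h2 a ha.1 b hb.1 hab (ha.2.trans hb.2.symm)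
  refine hle.trans (le_trans ?_ (card_roots' N))
  calc ∑ u ∈ s.image x, N.roots.count u
      ≤ ∑ u ∈ s.image x ∪ N.roots.toFinset, N.roots.count u :=
        Finset.sum_le_sum_of_subset Finset.subset_union_left
    _ = N.roots.card := Multiset.sum_count_eq_card fun u hu => by simp [Multiset.mem_toFinset.2 hu]

/-- The degrees of the two sides have different parity. -/
theorem eq_zero_of_sq_eq_cubic_mul_sq {f A B : ℂ[X]} (hf : f.natDegree = 3) (h : A ^ 2 = f * B ^ 2) :
    A = 0 ∧ B = 0 := by
  have hf0 : f ≠ 0 := by rintro rfl; simp at hf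
  have hB : B = 0 := by
    by_contra hB
    have := congrArg natDegree h
    rw [natDegree_mul hf0 (pow_ne_zero _ hB), natDegree_pow, natDegree_pow, hf] at this
    omega
  subst hB
  simpa using h

/-- A cubic that has ten points in common with a cubic in Weierstrass form is a multiple of it. -/
theorem cubicForm_eq_mul_weierForm {ι : Type*} [Fintype ι] (hι : 10 ≤ Fintype.card ι)
    {w : ι → Fin 3 → ℂ} (hw : ∀ i j, i ≠ j → cross (w i) (w j) ≠ 0) {a b : ℂ}
    (hW : ∀ i, weierForm a b (w i) = 0) {G : Fin 10 → ℂ} (hG : ∀ i, cubicForm G (w i) = 0)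
    (v : Fin 3 → ℂ) : cubicForm G v = -G 0 * weierForm a b v := by
  classical
  have hinf : ∀ i, w i 2 = 0 → w i 0 = 0 := by
    intro i hi
    have := hW i
    simpa [weierForm, hi] using this
  have hinf1 : ∀ i, w i 2 = 0 → w i 1 ≠ 0 := by
    intro i hi h1
    obtain ⟨j, hj⟩ := Fintype.exists_ne_of_one_lt_card (by omega : 1 < Fintype.card ι) i
    apply hw i j hj.symm
    simp [cross, hi, h1, hinf i hi]
  -- Eliminate `x³` with the Weierstrass equation. On the affine curve `y² = f(x)` the remainder is
  -- `A(x) + y B(x)`, and its norm `N = A² - f B²` has degree at most nine. It vanishes at the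
  -- `x`-coordinates of the common points, doubly when two of them are opposite, so ten affine
  -- points force `N = 0`.
  let c1 := G 1
  let c2 := G 2
  let c3 := G 3
  let c4 := G 4
  let c5 := G 5 - a * G 0
  let c6 := G 6
  let c7 := G 7 + G 0
  let c8 := G 8
  let c9 := G 9 - b * G 0
  have hred : ∀ v, cubicForm G v = -G 0 * weierForm a b v + (c1 * (v 0 ^ 2 * v 1) +
      c2 * (v 0 ^ 2 * v 2) + c3 * (v 0 * v 1 ^ 2) + c4 * (v 0 * v 1 * v 2) +
      c5 * (v 0 * v 2 ^ 2) + c6 * v 1 ^ 3 + c7 * (v 1 ^ 2 * v 2) + c8 * (v 1 * v 2 ^ 2) +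
      c9 * v 2 ^ 3) := by
    intro v
    simp only [cubicForm, weierForm, c1, c2, c3, c4, c5, c6, c7, c8, c9]; ring
  let f : ℂ[X] := X ^ 3 + C a * X + C b
  let A : ℂ[X] := C c3 * X * f + C c7 * f + C c2 * X ^ 2 + C c5 * X + C c9
  let B : ℂ[X] := C c6 * f + C c1 * X ^ 2 + C c4 * X + C c8
  let N : ℂ[X] := A ^ 2 - f * B ^ 2
  let s : Finset ι := Finset.univ.filter fun i => w i 2 ≠ 0
  let x : ι → ℂ := fun i => w i 0 / w i 2
  let y : ι → ℂ := fun i => w i 1 / w i 2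
  have hs : ∀ i ∈ s, w i 2 ≠ 0 := fun i hi => (Finset.mem_filter.1 hi).2
  have hf : ∀ i ∈ s, f.eval (x i) = y i ^ 2 := by
    intro i hi
    have h2 := hs i hi
    have := hW i
    simp only [weierForm] at this
    simp only [f, x, y, eval_add, eval_pow, eval_X, eval_mul, eval_C]
    field_simp
    linear_combination -this
  have hAB : ∀ i ∈ s, A.eval (x i) + y i * B.eval (x i) = 0 := by
    intro i hi
    have h2 := hs i hi
    have := hG i
    rw [hred, hW i] at this
    simp only [A, B, eval_add, eval_pow, eval_X, eval_mul, eval_C, hf i hi]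
    simp only [x, y]
    field_simp
    linear_combination this
  have hinj : ∀ i ∈ s, ∀ j ∈ s, x i = x j → y i = y j → i = j := by
    intro i hi j hj h1 h2
    have hi2 := hs i hi
    have hj2 := hs j hj
    by_contra hij
    apply hw i j hij
    simp only [x, y] at h1 h2
    rw [div_eq_div_iff hi2 hj2] at h1 h2
    have h3 : w i 0 * w j 1 - w i 1 * w j 0 = 0 := by
      refine (mul_eq_zero.1 (?_ : w i 2 * w j 2 * _ = 0)).resolve_left (mul_ne_zero hi2 hj2)
      linear_combination (w j 1 * w i 2) * h1 - (w i 2 * w j 0) * h2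
    ext k
    fin_cases k
    · simp [cross]; linear_combination h2
    · simp [cross]; linear_combination -h1
    · simpa [cross] using h3
  have hsgn : ∀ i ∈ s, ∀ j ∈ s, x i = x j → i ≠ j → y j = -y i ∧ y i ≠ 0 := by
    intro i hi j hj h hij
    have e : y i ^ 2 = y j ^ 2 := by rw [← hf i hi, ← hf j hj, h]
    have hne : y i ≠ y j := fun h' => hij (hinj i hi j hj h h')
    rcases sq_eq_sq_iff_eq_or_eq_neg.1 e with h' | h'
    · exact absurd h' hne
    · exact ⟨by rw [h', neg_neg], fun h0 => hne (by linear_combination 2 * h0 - h')⟩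
  have hroot : ∀ i ∈ s, N.IsRoot (x i) := by
    intro i hi
    simp only [N, IsRoot, eval_sub, eval_mul, eval_pow, hf i hi]
    linear_combination (A.eval (x i) - y i * B.eval (x i)) * hAB i hi
  have hfd : f.natDegree = 3 := by simp only [f]; compute_degree!
  have hN : N = 0 := by
    by_contra hN
    have hcard := card_le_natDegree_of_zeros hN s x hroot (by
      intro i hi j hj hij h
      obtain ⟨h1, h2⟩ := hsgn i hi j hj h hij
      have e1 := hAB i hi
      have e2 := hAB j hj
      rw [← h, h1] at e2
      have hA0 : A.IsRoot (x i) := by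
        simp only [IsRoot]; linear_combination e1 / 2 + e2 / 2
      have hB0 : B.IsRoot (x i) := by
        simp only [IsRoot]
        refine (mul_eq_zero.1 (?_ : y i * _ = 0)).resolve_left h2
        linear_combination e1 / 2 - e2 / 2
      exact dvd_sub (pow_dvd_pow_of_dvd (dvd_iff_isRoot.2 hA0) 2)
        (Dvd.dvd.mul_left (pow_dvd_pow_of_dvd (dvd_iff_isRoot.2 hB0) 2) f)) (by
      intro i hi j hj k hk hij hik
      by_contra! hne
      obtain ⟨h1, h2⟩ := hsgn i hi j hj hij hne.1
      obtain ⟨h3, h4⟩ := hsgn i hi k hk hik hne.2.1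
      exact hne.2.2 (hinj j hj k hk (hij.symm.trans hik) (h1.trans h3.symm)))
    have hA4 : A.natDegree ≤ 4 := by simp only [A, f]; compute_degree!
    have hB3 : B.natDegree ≤ 3 := by simp only [B, f]; compute_degree!
    have hN9 : N.natDegree ≤ 9 := by
      refine (natDegree_sub_le _ _).trans (max_le ?_ ?_)
      · exact natDegree_pow_le.trans (by omega)
      · refine natDegree_mul_le.trans ?_
        have := natDegree_pow_le (p := B) (n := 2)
        omega
    have hsum : s.card + (Finset.univ.filter fun i => ¬ w i 2 ≠ 0).card = Fintype.card ι :=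
      Finset.card_filter_add_card_filter_not (s := Finset.univ) _
    by_cases hO : ∃ i, w i 2 = 0
    · obtain ⟨i, hi⟩ := hO
      -- A common point at infinity costs one affine point, but it removes `y³` and lowers the
      -- degree of `N` to eight.
      have hc6 : c6 = 0 := by
        have := hG i
        rw [hred, hW i, hi, hinf i hi] at this
        simpa [hinf1 i hi] using this
      have hB2 : B.natDegree ≤ 2 := by
        simp only [B, hc6, C_0, zero_mul, zero_add]; compute_degree
      have hN8 : N.natDegree ≤ 8 := by
        refine (natDegree_sub_le _ _).trans (max_le ?_ ?_)
        · exact natDegree_pow_le.trans (by omega)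
        · refine natDegree_mul_le.trans ?_
          have := natDegree_pow_le (p := B) (n := 2)
          omega
      have hone : (Finset.univ.filter fun i => ¬ w i 2 ≠ 0).card ≤ 1 := by
        refine Finset.card_le_one.2 fun j hj k hk => ?_
        simp only [Finset.mem_filter, not_not] at hj hk
        by_contra hjk
        apply hw j k hjk
        simp [cross, hj.2, hk.2, hinf j hj.2, hinf k hk.2]
      omega
    · push Not at hO
      have : (Finset.univ.filter fun i => ¬ w i 2 ≠ 0).card = 0 := by simp [hO]
      omega
  obtain ⟨hA0, hB0⟩ := eq_zero_of_sq_eq_cubic_mul_sq hfd (sub_eq_zero.1 hN)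
  have b3 := congrArg (coeff · 3) hB0
  have b2 := congrArg (coeff · 2) hB0
  have b1 := congrArg (coeff · 1) hB0
  have b0 := congrArg (coeff · 0) hB0
  have hB' : B = C c6 * X ^ 3 + C c1 * X ^ 2 + C (c4 + c6 * a) * X + C (c8 + c6 * b) := by
    simp only [B, f, C_add, C_mul]; ring
  have hA' : A = C c3 * X ^ 4 + C c7 * X ^ 3 + C (c2 + c3 * a) * X ^ 2 +
      C (c5 + c3 * b + c7 * a) * X + C (c9 + c7 * b) := by
    simp only [A, f, C_add, C_mul]; ring
  have a4 := congrArg (coeff · 4) hA0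
  have a3 := congrArg (coeff · 3) hA0
  have a2 := congrArg (coeff · 2) hA0
  have a1 := congrArg (coeff · 1) hA0
  have a0 := congrArg (coeff · 0) hA0
  simp only [hA', hB', coeff_add, coeff_C_mul, coeff_X_pow, coeff_X, coeff_C, coeff_zero] at *
  norm_num at a4 a3 a2 a1 a0 b3 b2 b1 b0
  simp only [a4, b3, a3, zero_mul, add_zero] at a2 a1 a0 b1 b0
  rw [hred, a4, a3, a2, a1, a0, b3, b2, b1, b0]
  ring

end

/-! ### The group law in homogeneous coordinates -/

/-- The affine Weierstrass curve `y² = x³ + a x + b`. -/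
def shortCurve (a b : ℂ) : WeierstrassCurve.Affine ℂ := ⟨0, 0, 0, a, b⟩

namespace shortCurve

variable {a b : ℂ}

theorem equation_iff (x y : ℂ) :
    (shortCurve a b).Equation x y ↔ y ^ 2 = x ^ 3 + a * x + b := by
  rw [WeierstrassCurve.Affine.equation_iff]; simp [shortCurve]

theorem nonsingular_iff (x y : ℂ) : (shortCurve a b).Nonsingular x y ↔
    y ^ 2 = x ^ 3 + a * x + b ∧ (3 * x ^ 2 + a ≠ 0 ∨ y ≠ 0) := by
  rw [WeierstrassCurve.Affine.nonsingular_iff, equation_iff]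
  have h : y ≠ -y ↔ y ≠ 0 := by rw [ne_eq, self_eq_neg]
  simp [shortCurve, eq_comm (a := (0 : ℂ)), h]

theorem negY_eq (x y : ℂ) : (shortCurve a b).negY x y = -y := by
  simp [WeierstrassCurve.Affine.negY, shortCurve]

theorem addX_eq (x₁ x₂ l : ℂ) : (shortCurve a b).addX x₁ x₂ l = l ^ 2 - x₁ - x₂ := by
  simp [WeierstrassCurve.Affine.addX, shortCurve]

theorem negAddY_eq (x₁ x₂ y₁ l : ℂ) :
    (shortCurve a b).negAddY x₁ x₂ y₁ l = l * (l ^ 2 - x₁ - x₂ - x₁) + y₁ := by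
  rw [WeierstrassCurve.Affine.negAddY, addX_eq]

open Classical in
/-- The point of the curve with given homogeneous coordinates. -/
noncomputable def point (a b : ℂ) (w : Fin 3 → ℂ) : (shortCurve a b).Point :=
  -- The value `0` is the correct one for the point at infinity, and a default for vectors that do
  -- not represent a nonsingular point.
  if h : (shortCurve a b).Nonsingular (w 0 / w 2) (w 1 / w 2) ∧ w 2 ≠ 0 then .some _ _ h.1 else 0

open WeierstrassCurve.Affine.Point

theorem some_congr {x y x' y' : ℂ} (h : (shortCurve a b).Nonsingular x y) (hx : x = x')
    (hy : y = y') : some x y h = some x' y' (hx ▸ hy ▸ h) := by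
  subst hx hy; rfl

/-- Three different collinear points add up to zero. -/
theorem some_add_some_add_some {x₁ y₁ x₂ y₂ x₃ y₃ : ℂ} (h₁ : (shortCurve a b).Nonsingular x₁ y₁)
    (h₂ : (shortCurve a b).Nonsingular x₂ y₂) (h₃ : (shortCurve a b).Nonsingular x₃ y₃)
    (h12 : x₁ ≠ x₂ ∨ y₁ ≠ y₂) (h13 : x₁ ≠ x₃ ∨ y₁ ≠ y₃) (h23 : x₂ ≠ x₃ ∨ y₂ ≠ y₃)
    (hl : (x₂ - x₁) * (y₃ - y₁) = (x₃ - x₁) * (y₂ - y₁)) :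
    some x₁ y₁ h₁ + some x₂ y₂ h₂ + some x₃ y₃ h₃ = 0 := by
  have e₁ := ((nonsingular_iff _ _).1 h₁).1
  have e₂ := ((nonsingular_iff _ _).1 h₂).1
  have e₃ := ((nonsingular_iff _ _).1 h₃).1
  by_cases hx : x₁ = x₂
  · exfalso
    subst hx
    have hy : y₁ ≠ y₂ := by simpa using h12
    have hx3 : x₃ = x₁ := by
      have : (x₃ - x₁) * (y₂ - y₁) = 0 := by rw [← hl]; ring
      exact sub_eq_zero.1 ((mul_eq_zero.1 this).resolve_right (sub_ne_zero.2 hy.symm))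
    subst hx3
    have hy3 : y₃ ^ 2 = y₁ ^ 2 := by rw [e₃, e₁]
    have hy2 : y₂ ^ 2 = y₁ ^ 2 := by rw [e₂, e₁]
    have f1 : y₂ = -y₁ := (sq_eq_sq_iff_eq_or_eq_neg.1 hy2).resolve_left hy.symm
    have f2 : y₃ = -y₁ := (sq_eq_sq_iff_eq_or_eq_neg.1 hy3).resolve_left
      (fun h => by simp [h] at h13)
    simp [f1, f2] at h23
  · rw [add_of_X_ne' hx, neg_add_eq_zero]
    have hsl := WeierstrassCurve.Affine.slope_of_X_ne (W := shortCurve a b) (y₁ := y₁) (y₂ := y₂) hx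
    have hd : x₁ - x₂ ≠ 0 := sub_ne_zero.2 hx
    set m := (y₁ - y₂) / (x₁ - x₂) with hm
    have hm' : m * (x₁ - x₂) = y₁ - y₂ := by rw [hm]; field_simp
    have hy3 : y₃ = m * (x₃ - x₁) + y₁ := by
      have : (x₁ - x₂) * (y₃ - (m * (x₃ - x₁) + y₁)) = 0 := by
        linear_combination -hl - (x₃ - x₁) * hm'
      exact sub_eq_zero.1 ((mul_eq_zero.1 this).resolve_left hd)
    have n13 : x₃ - x₁ ≠ 0 := by
      intro h
      rw [h, mul_zero, zero_add] at hy3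
      simp [sub_eq_zero.1 h, hy3] at h13
    have n23 : x₃ - x₂ ≠ 0 := by
      intro h
      have : y₃ = y₂ := by linear_combination hy3 + m * h - hm'
      simp [sub_eq_zero.1 h, this] at h23
    -- The three abscissas are different roots of a monic cubic whose coefficient of `x²` is `-m²`,
    -- so their sum is `m²`.
    have key : (x₁ - x₂) * ((x₃ - x₁) * (x₃ - x₂)) * (x₃ - (m ^ 2 - x₁ - x₂)) = 0 := by
      have hy2 : y₂ = m * (x₂ - x₁) + y₁ := by linear_combination hm'
      rw [hy3] at e₃
      rw [hy2] at e₂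
      linear_combination -(x₁ - x₂) * (e₃ - e₁) + (x₃ - x₁) * (e₁ - e₂)
    have hx3 : x₃ = m ^ 2 - x₁ - x₂ :=
      sub_eq_zero.1 ((mul_eq_zero.1 key).resolve_left (mul_ne_zero hd (mul_ne_zero n13 n23)))
    symm
    refine some_congr h₃ ?_ ?_
    · rw [hsl, addX_eq, hx3]
    · rw [hsl, negAddY_eq, hy3, hx3]

theorem some_add_some_of_eq {x y₁ y₂ : ℂ} (h₁ : (shortCurve a b).Nonsingular x y₁)
    (h₂ : (shortCurve a b).Nonsingular x y₂) (h : y₁ ≠ y₂) : some x y₁ h₁ + some x y₂ h₂ = 0 := by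
  refine add_of_Y_eq rfl ?_
  rw [negY_eq]
  have e₁ := ((nonsingular_iff _ _).1 h₁).1
  have e₂ := ((nonsingular_iff _ _).1 h₂).1
  exact (sq_eq_sq_iff_eq_or_eq_neg.1 (e₁.trans e₂.symm)).resolve_left h

/-- A nonsingular point of the curve in homogeneous coordinates. -/
structure IsPoint (a b : ℂ) (w : Fin 3 → ℂ) : Prop where
  ne_zero : w ≠ 0
  eq_zero : weierForm a b w = 0
  nonsing : w 2 ≠ 0 → 3 * (w 0 / w 2) ^ 2 + a ≠ 0 ∨ w 1 / w 2 ≠ 0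

theorem IsPoint.nonsingular {w : Fin 3 → ℂ} (h : IsPoint a b w) (h2 : w 2 ≠ 0) :
    (shortCurve a b).Nonsingular (w 0 / w 2) (w 1 / w 2) := by
  rw [nonsingular_iff]
  refine ⟨?_, h.nonsing h2⟩
  have := h.eq_zero
  simp only [weierForm] at this
  field_simp
  linear_combination this

theorem IsPoint.point_eq_some {w : Fin 3 → ℂ} (h : IsPoint a b w) (h2 : w 2 ≠ 0) :
    point a b w = some _ _ (h.nonsingular h2) := by
  rw [point, dif_pos ⟨h.nonsingular h2, h2⟩]

theorem point_eq_zero {w : Fin 3 → ℂ} (h2 : w 2 = 0) : point a b w = 0 := by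
  rw [point, dif_neg fun h => h.2 h2]

theorem IsPoint.zero_of_infinity {w : Fin 3 → ℂ} (h : IsPoint a b w) (h2 : w 2 = 0) :
    w 0 = 0 ∧ w 1 ≠ 0 := by
  have := h.eq_zero
  have h0 : w 0 = 0 := by simpa [weierForm, h2] using this
  refine ⟨h0, fun h1 => h.ne_zero ?_⟩
  ext i; fin_cases i <;> assumption

theorem ne_of_cross_ne_zero {u v : Fin 3 → ℂ} (h : cross u v ≠ 0) (hu : u 2 ≠ 0) (hv : v 2 ≠ 0) :
    u 0 / u 2 ≠ v 0 / v 2 ∨ u 1 / u 2 ≠ v 1 / v 2 := by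
  by_contra! hc
  obtain ⟨h1, h2⟩ := hc
  rw [div_eq_div_iff hu hv] at h1 h2
  apply h
  have h3 : u 0 * v 1 - u 1 * v 0 = 0 := by
    refine (mul_eq_zero.1 (?_ : u 2 * v 2 * _ = 0)).resolve_left (mul_ne_zero hu hv)
    linear_combination (v 1 * u 2) * h1 - (u 2 * v 0) * h2
  ext k
  fin_cases k
  · simp [cross]; linear_combination h2
  · simp [cross]; linear_combination -h1
  · simpa [cross] using h3

/-- A line through the point at infinity is vertical, so the two other points are opposite. -/
theorem point_add_aux {u v w : Fin 3 → ℂ} (hu : IsPoint a b u) (hv : IsPoint a b v)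
    (hw : IsPoint a b w) (huv : cross u v ≠ 0) (huw : cross u w ≠ 0) (hvw : cross v w ≠ 0)
    (h : det3 u v w = 0) (h2 : u 2 = 0) : point a b u + point a b v + point a b w = 0 := by
  obtain ⟨u0, u1⟩ := hu.zero_of_infinity h2
  have v2 : v 2 ≠ 0 := by
    intro v2
    apply huv
    simp [cross, h2, v2, u0, (hv.zero_of_infinity v2).1]
  have w2 : w 2 ≠ 0 := by
    intro w2
    apply huw
    simp [cross, h2, w2, u0, (hw.zero_of_infinity w2).1]
  rw [point_eq_zero h2, zero_add, hv.point_eq_some v2, hw.point_eq_some w2]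
  have e : v 0 / v 2 = w 0 / w 2 := by
    rw [div_eq_div_iff v2 w2]
    refine sub_eq_zero.1 ((mul_eq_zero.1 (?_ : u 1 * _ = 0)).resolve_left u1)
    simp only [det3, u0, h2] at h
    linear_combination -h
  have hne := ne_of_cross_ne_zero hvw v2 w2
  rw [some_congr (hv.nonsingular v2) e rfl]
  exact some_add_some_of_eq _ _ (hne.resolve_left (fun h => h e))

/-- Three different collinear points add up to zero. -/
theorem point_add {u v w : Fin 3 → ℂ} (hu : IsPoint a b u) (hv : IsPoint a b v)
    (hw : IsPoint a b w) (huv : cross u v ≠ 0) (huw : cross u w ≠ 0) (hvw : cross v w ≠ 0)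
    (h : det3 u v w = 0) : point a b u + point a b v + point a b w = 0 := by
  have anti : ∀ {u v : Fin 3 → ℂ}, cross u v ≠ 0 → cross v u ≠ 0 := by
    intro u v huv h0
    apply huv
    have e : cross u v = -cross v u := by ext i; fin_cases i <;> simp [cross] <;> ring
    rw [e, h0, _root_.neg_zero]
  by_cases u2 : u 2 = 0
  · exact point_add_aux hu hv hw huv huw hvw h u2
  by_cases v2 : v 2 = 0
  · have := point_add_aux hv hu hw (anti huv) hvw huw (by rw [det3_swap, h, _root_.neg_zero]) v2
    rwa [add_comm (point a b u)]
  by_cases w2 : w 2 = 0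
  · have := point_add_aux hw hu hv (anti huw) (anti hvw) huv
      (by rw [← det3_rotate, h]) w2
    rwa [add_comm, ← add_assoc]
  rw [hu.point_eq_some u2, hv.point_eq_some v2, hw.point_eq_some w2]
  refine some_add_some_add_some _ _ _ (ne_of_cross_ne_zero huv u2 v2)
    (ne_of_cross_ne_zero huw u2 w2) (ne_of_cross_ne_zero hvw v2 w2) ?_
  have e : ∀ {w : Fin 3 → ℂ} (i : Fin 3), w 2 ≠ 0 → w i = w i / w 2 * w 2 := by
    intro w i hw; field_simp
  refine sub_eq_zero.1 ((mul_eq_zero.1 (?_ : u 2 * v 2 * w 2 * _ = 0)).resolve_left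
    (mul_ne_zero (mul_ne_zero u2 v2) w2))
  simp only [det3] at h
  rw [e (w := u) 0 u2, e (w := u) 1 u2, e (w := v) 0 v2, e (w := v) 1 v2, e (w := w) 0 w2,
    e (w := w) 1 w2] at h
  linear_combination h

theorem cross_eq_zero_of_point_eq {u v : Fin 3 → ℂ} (hu : IsPoint a b u) (hv : IsPoint a b v)
    (h : point a b u = point a b v) : cross u v = 0 := by
  by_contra hc
  by_cases u2 : u 2 = 0
  · by_cases v2 : v 2 = 0
    · apply hc
      simp [cross, u2, v2, (hu.zero_of_infinity u2).1, (hv.zero_of_infinity v2).1]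
    · rw [point_eq_zero u2, hv.point_eq_some v2] at h
      exact some_ne_zero _ h.symm
  · by_cases v2 : v 2 = 0
    · rw [point_eq_zero v2, hu.point_eq_some u2] at h
      exact some_ne_zero _ h
    · rw [hu.point_eq_some u2, hv.point_eq_some v2] at h
      injection h with h1 h2
      have := ne_of_cross_ne_zero hc u2 v2
      tauto

end shortCurve

/-! ### Dual nets on a Weierstrass cubic -/

/-- A Weierstrass form as a cubic form. -/
theorem weierForm_eq_cubicForm (a b : ℂ) (v : Fin 3 → ℂ) :
    weierForm a b v = cubicForm ![-1, 0, 0, 0, 0, -a, 0, 1, 0, -b] v := by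
  simp [weierForm, cubicForm]; ring

/-- A Weierstrass cubic contains no line. -/
theorem exists_weierForm_ne_zero (a b : ℂ) (l : Fin 3 → ℂ) :
    ∃ v, l ⬝ᵥ v = 0 ∧ weierForm a b v ≠ 0 := by
  by_contra! h
  by_cases l1 : l 1 = 0
  · by_cases l0 : l 0 = 0
    · have := h ![1, 0, 0] (by rw [dot3]; simp [l0])
      simp [weierForm] at this
    · have h1 := h ![-l 2 / l 0, 0, 1] (by rw [dot3]; simp; field_simp; simp)
      have h2 := h ![-l 2 / l 0, 1, 1] (by rw [dot3]; simp [l1]; field_simp; simp)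
      simp only [weierForm, Matrix.cons_val] at h1 h2
      have : (1 : ℂ) = 0 := by linear_combination h2 - h1
      exact one_ne_zero this
  · have key : ∀ t : ℂ, (-(l 0 * t + l 2) / l 1) ^ 2 - t ^ 3 - a * t - b = 0 := by
      intro t
      have := h ![t, -(l 0 * t + l 2) / l 1, 1] (by rw [dot3]; simp; field_simp; ring)
      simpa [weierForm] using this
    obtain ⟨m, hm⟩ : ∃ m, m = -l 0 / l 1 := ⟨_, rfl⟩
    obtain ⟨c, hc⟩ : ∃ c, c = -l 2 / l 1 := ⟨_, rfl⟩
    have key' : ∀ t : ℂ, (m * t + c) ^ 2 - t ^ 3 - a * t - b = 0 := by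
      intro t
      rw [← key t, hm, hc]
      congr 4
      field_simp; ring
    have : (12 : ℂ) = 0 := by
      -- A third difference, which annihilates polynomials of degree at most two and leaves `12`
      -- from `-t³`.
      linear_combination -(key' 2) + 2 * key' 1 - 2 * key' (-1) + key' (-2)
    norm_num at this

theorem det3_linearMap (A : (Fin 3 → ℂ) →ₗ[ℂ] (Fin 3 → ℂ)) (u v w : Fin 3 → ℂ) :
    det3 (A u) (A v) (A w) =
      det3 (A ![1, 0, 0]) (A ![0, 1, 0]) (A ![0, 0, 1]) * det3 u v w := by
  simp only [det3, linearMap_apply A u, linearMap_apply A v, linearMap_apply A w]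
  ring

theorem det3_linearEquiv_ne_zero (A : (Fin 3 → ℂ) ≃ₗ[ℂ] (Fin 3 → ℂ)) :
    det3 (A ![1, 0, 0]) (A ![0, 1, 0]) (A ![0, 0, 1]) ≠ 0 := by
  intro h
  have := det3_linearMap A.toLinearMap (A.symm ![1, 0, 0]) (A.symm ![0, 1, 0]) (A.symm ![0, 0, 1])
  simp only [LinearEquiv.coe_coe, A.apply_symm_apply, h, zero_mul] at this
  simp [det3] at this

theorem cross_ne_zero_of_left {u v w : Fin 3 → ℂ} (h : det3 w u v ≠ 0) : cross u v ≠ 0 :=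
  cross_ne_zero (det3_ne_zero_rotate h)

namespace DualNet

open shortCurve

variable {H : Type*} [AddCommGroup H] {p q r : H → Fin 3 → ℂ} {A B : ℂ}

theorem mapEquiv (N : DualNet p q r) (A : (Fin 3 → ℂ) ≃ₗ[ℂ] (Fin 3 → ℂ)) :
    DualNet (fun k => A (p k)) (fun k => A (q k)) (fun k => A (r k)) :=
  N.map A _ (det3_linearEquiv_ne_zero A) (det3_linearMap A.toLinearMap)

/-- The points of a net on a Weierstrass cubic are nonsingular. -/
theorem isPoint (N : DualNet p q r) [Nontrivial H] (hp : ∀ a, weierForm A B (p a) = 0)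
    (hq : ∀ a, weierForm A B (q a) = 0) (hr : ∀ a, weierForm A B (r a) = 0) (x : H) :
    IsPoint A B (p x) := by
  obtain ⟨y, hy⟩ := exists_ne x
  refine ⟨ne_zero_of_det3_ne_zero (N.ppq x y 0 hy.symm), hp x, fun h2 => ?_⟩
  by_contra! hc
  obtain ⟨h3, h1⟩ := hc
  have w1 : p x 1 = 0 := by simpa [h2] using h1
  field_simp at h3
  have hF := hp x
  simp only [weierForm, w1] at hF
  let c : Fin 10 → ℂ := ![-1, 0, 0, 0, 0, -A, 0, 1, 0, -B]
  -- If `p x` were singular, the cubic on the line joining `p x` and `q 0` would reduce to a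
  -- multiple of `s t²`. The third collinear point `r (-x)` has `s t ≠ 0`, so the whole line would
  -- be on the cubic.
  have hD : ∀ u, cubicDeriv c (p x) u = 0 := by
    intro u
    have e2 : p x 2 * (-2 * A * p x 0 - 3 * B * p x 2) = 0 := by
      refine (mul_eq_zero.1 (?_ : p x 2 * _ = 0)).resolve_left h2
      linear_combination 3 * hF + p x 0 * h3
    simp only [cubicDeriv, c, Matrix.cons_val, w1]
    linear_combination -u 0 * h3 + u 2 * e2
  have hd : det3 (p x) (q 0) (p y) ≠ 0 := det3_ne_zero_rotate (N.ppq _ _ _ hy)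
  obtain ⟨s, t, hst⟩ := eq_comb_of_det3_eq_zero hd (N.coll x 0 (-x) (by abel))
  have hs : s ≠ 0 := by
    rintro rfl
    obtain ⟨b', hb'⟩ := exists_ne (0 : H)
    rw [zero_smul, zero_add] at hst
    exact det3_ne_zero_swap (det3_ne_zero_rotate (N.qqr _ _ (-x) hb')) (det3_smul_eq_zero hst)
  have ht : t ≠ 0 := by
    rintro rfl
    rw [zero_smul, add_zero] at hst
    exact det3_ne_zero_swap (det3_ne_zero_rotate (N.ppr _ _ (-x) hy)) (det3_smul_eq_zero hst)
  have hexp : ∀ s t : ℂ, weierForm A B (s • p x + t • q 0) = s * t ^ 2 * cubicDeriv c (q 0) (p x) := by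
    intro s t
    rw [weierForm_eq_cubicForm, cubicForm_smul_add_smul, hD, ← weierForm_eq_cubicForm,
      ← weierForm_eq_cubicForm, hp, hq]
    ring
  have h0 := hr (-x)
  rw [hst, hexp] at h0
  have h0' := (mul_eq_zero.1 h0).resolve_left (mul_ne_zero hs (pow_ne_zero _ ht))
  obtain ⟨v, hv, hv'⟩ := exists_weierForm_ne_zero A B (cross (p x) (q 0))
  rw [cross_dot] at hv
  obtain ⟨s', t', rfl⟩ := eq_comb_of_det3_eq_zero hd hv
  rw [hexp, h0', mul_zero] at hv'
  exact hv' rfl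

/-- A group with a net on a Weierstrass cubic embeds into the group of points of the cubic. -/
theorem exists_hom (N : DualNet p q r) [Nontrivial H] (hp : ∀ a, weierForm A B (p a) = 0)
    (hq : ∀ a, weierForm A B (q a) = 0) (hr : ∀ a, weierForm A B (r a) = 0) :
    ∃ φ : H →+ (shortCurve A B).Point, Function.Injective φ := by
  have ip := N.isPoint hp hq hr
  have iq := N.rotate.isPoint hq hr hp
  have ir := N.rotate.rotate.isPoint hr hp hq
  have hsum : ∀ a b c, a + b + c = 0 →
      point A B (p a) + point A B (q b) + point A B (r c) = 0 := by
    intro a b c h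
    obtain ⟨a', ha'⟩ := exists_ne a
    obtain ⟨b', hb'⟩ := exists_ne b
    refine point_add (ip a) (iq b) (ir c) ?_ ?_ ?_ (N.coll a b c h)
    · exact cross_ne_zero_of_left (N.ppq a' a b ha')
    · exact cross_ne_zero_of_left (N.ppr a' a c ha')
    · exact cross_ne_zero_of_left (N.qqr b' b c hb')
  let P := fun a => point A B (p a)
  let Q := fun a => point A B (q a)
  -- Both sides are opposite to the same point of the third family. This functional equation makes
  -- `P` a homomorphism up to the constant `P 0`.
  have hPQ : ∀ a b, P (a + b) + Q 0 = P a + Q b := by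
    intro a b
    have h1 := hsum (a + b) 0 (-(a + b)) (by abel)
    have h2 := hsum a b (-(a + b)) (by abel)
    exact add_right_cancel (h1.trans h2.symm)
  refine ⟨AddMonoidHom.mk' (fun a => P a - P 0) fun a b => ?_, fun a a' h => ?_⟩
  · have h1 := hPQ a b
    have h2 := hPQ 0 b
    rw [zero_add] at h2
    have e1 : P (a + b) = P a + Q b - Q 0 := by rw [← h1]; abel
    have e2 : P b = P 0 + Q b - Q 0 := by rw [← h2]; abel
    rw [e1, e2]; abel
  · have h' : P a = P a' := sub_left_injective h
    by_contra hne
    exact cross_ne_zero (N.ppq a a' 0 hne) (cross_eq_zero_of_point_eq (ip a) (ip a') h')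

/-- A group with an element of order at least ten that has a dual net is cyclic or embeds into the
group of points of a Weierstrass cubic. -/
theorem isAddCyclic_or_exists_hom [Finite H] (N : DualNet p q r) {h : H}
    (hh : 10 ≤ addOrderOf h) : IsAddCyclic H ∨
      ∃ (A B : ℂ) (φ : H →+ (shortCurve A B).Point), Function.Injective φ := by
  by_cases hc : IsAddCyclic H
  · exact Or.inl hc
  right
  have hnt : Nontrivial H := ⟨h, 0, fun h0 => by simp [h0] at hh⟩
  let K := AddSubgroup.zmultiples h
  have := Fintype.ofFinite K
  let g : K := ⟨h, AddSubgroup.mem_zmultiples h⟩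
  have hinj : Function.Injective K.subtype := K.subtype_injective
  have hg : addOrderOf g = addOrderOf h := by
    rw [← addOrderOf_injective K.subtype hinj]; rfl
  have hgen : ∀ a, a ∈ AddSubgroup.zmultiples g := by
    rintro ⟨a, ha⟩
    obtain ⟨z, rfl⟩ := AddSubgroup.mem_zmultiples_iff.1 ha
    exact AddSubgroup.mem_zmultiples_iff.2 ⟨z, Subtype.ext (by simp [g])⟩
  have hcard : 10 ≤ Fintype.card K := by
    have := addOrderOf_le_card_univ (x := g)
    omega
  -- Every subnet on cosets of `⟨h⟩` lies on a cubic. A cubic that contains a line would make `H`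
  -- cyclic.
  have exF : ∀ α β : H, ∃ F : Fin 10 → ℂ, Lineless F ∧ ∀ k : K,
      cubicForm F (p (α + k)) = 0 ∧ cubicForm F (q (β + k)) = 0 ∧
        cubicForm F (r (-α - β + k)) = 0 := by
    intro α β
    have hs : α + β + (-α - β) = 0 := by abel
    obtain ⟨F, hF, hz⟩ := (N.restrict K.subtype hinj hs).exists_cubicForm (g := g)
      (by omega) hgen (by omega)
    refine ⟨F, fun l hl => ?_, hz⟩
    by_contra! hno
    exact hc (N.isAddCyclic_of_line K.subtype hinj (g := g) (by omega) hs hF (fun k => (hz k).1)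
      (fun k => (hz k).2.1) (fun k => (hz k).2.2) hl hno)
  obtain ⟨F, hF, hz⟩ := exF 0 0
  obtain ⟨T, κ, a, b, hκ, hT⟩ := hF.hasWeierForm
  have hT' : ∀ v, cubicForm F v = 0 → weierForm a b (T.symm v) = 0 := by
    intro v hv
    have := hT (T.symm v)
    rw [T.apply_symm_apply, hv] at this
    exact (mul_eq_zero.1 this.symm).resolve_left hκ
  -- A cubic that shares a coset of at least ten points with `F` is a multiple of `F`. Each
  -- remaining point of the net is then caught by a subnet that keeps one coset of the first subnet.
  have share : ∀ (F' : Fin 10 → ℂ), Lineless F' → ∀ w : K → Fin 3 → ℂ,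
      (∀ i j, i ≠ j → cross (T.symm (w i)) (T.symm (w j)) ≠ 0) → (∀ k, cubicForm F (w k) = 0) →
      (∀ k, cubicForm F' (w k) = 0) → ∀ v, cubicForm F' v = 0 → weierForm a b (T.symm v) = 0 := by
    intro F' hF' w hw h1 h2 v hv
    obtain ⟨G, hG⟩ := exists_cubicForm_comp F' T.toLinearMap
    have hG' : ∀ v, cubicForm G (T.symm v) = cubicForm F' v := by
      intro v; rw [hG]; simp
    have key := cubicForm_eq_mul_weierForm hcard hw (fun k => hT' _ (h1 k))
      (fun k => (hG' _).trans (h2 k))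
    have e := key (T.symm v)
    rw [hG', hv] at e
    refine (mul_eq_zero.1 e.symm).resolve_left fun h0 => ?_
    apply hF'.ne_zero
    refine eq_zero_of_cubicForm_eq_zero fun v => ?_
    rw [← hG', key, h0, zero_mul]
  have N' := N.mapEquiv T.symm
  have crossp : ∀ x y, x ≠ y → cross (T.symm (p x)) (T.symm (p y)) ≠ 0 :=
    fun x y hxy => cross_ne_zero (N'.ppq x y 0 hxy)
  have crossq : ∀ x y, x ≠ y → cross (T.symm (q x)) (T.symm (q y)) ≠ 0 :=
    fun x y hxy => cross_ne_zero (N'.qqr x y 0 hxy)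
  have hcoe : ∀ i j : K, i ≠ j → (0 : H) + i ≠ 0 + j := by
    intro i j hij h; exact hij (Subtype.ext (by simpa using h))
  refine ⟨a, b, N'.exists_hom ?_ ?_ ?_⟩
  · intro x
    obtain ⟨F', hF', hz'⟩ := exF x 0
    refine share F' hF' (fun k => q (0 + k)) (fun i j hij => crossq _ _ (hcoe i j hij))
      (fun k => (hz k).2.1) (fun k => (hz' k).2.1) _ ?_
    simpa using (hz' 0).1
  · intro x
    obtain ⟨F', hF', hz'⟩ := exF 0 x
    refine share F' hF' (fun k => p (0 + k)) (fun i j hij => crossp _ _ (hcoe i j hij))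
      (fun k => (hz k).1) (fun k => (hz' k).1) _ ?_
    simpa using (hz' 0).2.1
  · intro x
    obtain ⟨F', hF', hz'⟩ := exF (-x) 0
    refine share F' hF' (fun k => q (0 + k)) (fun i j hij => crossq _ _ (hcoe i j hij))
      (fun k => (hz k).2.1) (fun k => (hz' k).2.1) _ ?_
    simpa using (hz' 0).2.2

end DualNet

/-! ### Multiplication by `n` on `x`-coordinates and the torsion bound -/

namespace shortCurve

open WeierstrassCurve.Affine.Point

variable {a b : ℂ}

/-- `(α : β)` is the `x`-coordinate of the point, as a point of the projective line. -/
def HasX (P : (shortCurve a b).Point) (α β : ℂ) : Prop :=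
  (P = 0 ∧ β = 0 ∧ α ≠ 0) ∨ ∃ x y h, P = some x y h ∧ β ≠ 0 ∧ x * β = α

theorem hasX_zero {α β : ℂ} (h : HasX (0 : (shortCurve a b).Point) α β) : β = 0 ∧ α ≠ 0 := by
  rcases h with h | ⟨x, y, h, h0, -⟩
  · exact h.2
  · exact absurd h0.symm (some_ne_zero h)

theorem hasX_some {x y α β : ℂ} {h : (shortCurve a b).Nonsingular x y}
    (hX : HasX (some x y h) α β) : β ≠ 0 ∧ x * β = α := by
  rcases hX with h' | ⟨x', y', h', h0, h1, h2⟩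
  · exact absurd h'.1 (some_ne_zero h)
  · injection h0 with e1 e2
    subst e1
    exact ⟨h1, h2⟩

/-- The duplication formula, homogenized to include `0` and the points of order two. In the latter
case nonsingularity, `3 x² + a ≠ 0`, keeps the first coordinate nonzero. -/
theorem HasX.double {P : (shortCurve a b).Point} {α β : ℂ} (h : HasX P α β) :
    HasX (P + P) (α ^ 4 - 2 * a * α ^ 2 * β ^ 2 - 8 * b * α * β ^ 3 + a ^ 2 * β ^ 4)
      (4 * β * (α ^ 3 + a * α * β ^ 2 + b * β ^ 3)) := by
  rcases P with _ | ⟨x, y, hP⟩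
  · obtain ⟨h1, h2⟩ := hasX_zero h
    left
    exact ⟨add_zero 0, by simp [h1], by simpa [h1] using h2⟩
  · obtain ⟨h1, rfl⟩ := hasX_some h
    obtain ⟨e, hn⟩ := (nonsingular_iff _ _).1 hP
    by_cases hy : y = 0
    · left
      refine ⟨add_self_of_Y_eq (by rw [negY_eq, hy]; simp), ?_, ?_⟩
      · rw [hy] at e
        linear_combination -4 * β ^ 4 * e
      · have hx : 3 * x ^ 2 + a ≠ 0 := hn.resolve_right (fun h => h hy)
        have : (x * β) ^ 4 - 2 * a * (x * β) ^ 2 * β ^ 2 - 8 * b * (x * β) * β ^ 3 + a ^ 2 * β ^ 4 =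
            β ^ 4 * (3 * x ^ 2 + a) ^ 2 := by
          rw [hy] at e
          linear_combination 8 * x * β ^ 4 * e
        rw [this]
        exact mul_ne_zero (pow_ne_zero _ h1) (pow_ne_zero _ hx)
    · right
      have hne : y ≠ (shortCurve a b).negY x y := by rw [negY_eq, ne_eq, self_eq_neg]; exact hy
      refine ⟨_, _, _, add_self_of_Y_ne hne, ?_, ?_⟩
      · have : 4 * β * ((x * β) ^ 3 + a * (x * β) * β ^ 2 + b * β ^ 3) = 4 * β ^ 4 * y ^ 2 := by
          rw [e]; ring
        rw [this]
        exact mul_ne_zero (mul_ne_zero (by norm_num) (pow_ne_zero _ h1)) (pow_ne_zero _ hy)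
      · rw [WeierstrassCurve.Affine.slope_of_Y_ne rfl hne, addX_eq, negY_eq]
        simp only [shortCurve]
        have : 4 * β * ((x * β) ^ 3 + a * (x * β) * β ^ 2 + b * β ^ 3) = 4 * β ^ 4 * y ^ 2 := by
          rw [e]; ring
        rw [this]
        have hb : b = y ^ 2 - x ^ 3 - a * x := by linear_combination -e
        rw [hb]
        field_simp
        ring

/-- The formula for `x(P + Q) + x(P - Q)` determines `x(P + Q)` without any `y`-coordinate once `P -
Q` is a known affine point. -/
theorem HasX.add {P Q : (shortCurve a b).Point} {α₁ β₁ α₀ β₀ x y : ℂ} (hP : HasX P α₁ β₁)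
    (hQ : HasX Q α₀ β₀) {h : (shortCurve a b).Nonsingular x y} (hPQ : P = Q + some x y h) :
    HasX (P + Q) (2 * ((α₁ * α₀ + a * β₁ * β₀) * (α₁ * β₀ + α₀ * β₁) + 2 * b * β₁ ^ 2 * β₀ ^ 2) -
      x * (α₁ * β₀ - α₀ * β₁) ^ 2) ((α₁ * β₀ - α₀ * β₁) ^ 2) := by
  rcases Q with _ | ⟨x₀, y₀, h₀⟩
  · have hPQ' : P = some x y h := by rw [hPQ]; exact zero_add _
    subst hPQ'
    obtain ⟨h1, h2⟩ := hasX_zero hQ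
    obtain ⟨h3, rfl⟩ := hasX_some hP
    right
    refine ⟨x, y, h, add_zero _, ?_, ?_⟩
    · simp [h1, h2, h3]
    · rw [h1]; ring
  rcases P with _ | ⟨x₁, y₁, h₁⟩
  · obtain ⟨h1, h2⟩ := hasX_zero hP
    obtain ⟨h3, rfl⟩ := hasX_some hQ
    have e : some x₀ y₀ h₀ = -some x y h := by
      rw [eq_neg_iff_add_eq_zero]; exact hPQ.symm
    have hx : x₀ = x := by rw [neg_some] at e; injection e
    right
    refine ⟨x₀, y₀, h₀, zero_add _, ?_, ?_⟩
    · simp [h1, h2, h3]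
    · rw [h1, hx]; ring
  obtain ⟨h3, rfl⟩ := hasX_some hP
  obtain ⟨h4, rfl⟩ := hasX_some hQ
  have e₀ := ((nonsingular_iff _ _).1 h₀).1
  have e₁ := ((nonsingular_iff _ _).1 h₁).1
  by_cases hx : x₁ = x₀
  · -- here `P = -Q`
    subst hx
    have hy : y₁ ≠ y₀ := by
      rintro rfl
      have : some x y h = 0 := by simp at hPQ
      exact some_ne_zero h this
    have hy' : y₁ = -y₀ := (sq_eq_sq_iff_eq_or_eq_neg.1 (e₁.trans e₀.symm)).resolve_left hy
    left
    refine ⟨some_add_some_of_eq h₁ h₀ hy, by ring, ?_⟩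
    have : 2 * ((x₁ * β₁ * (x₁ * β₀) + a * β₁ * β₀) * (x₁ * β₁ * β₀ + x₁ * β₀ * β₁) +
        2 * b * β₁ ^ 2 * β₀ ^ 2) - x * (x₁ * β₁ * β₀ - x₁ * β₀ * β₁) ^ 2 =
        4 * β₁ ^ 2 * β₀ ^ 2 * y₁ ^ 2 := by rw [e₁]; ring
    rw [this]
    have hy1 : y₁ ≠ 0 := by
      intro h0; apply hy; linear_combination 2 * h0 - hy'
    simp [h3, h4, hy1]
  · have hd : x₁ - x₀ ≠ 0 := sub_ne_zero.2 hx
    right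
    refine ⟨_, _, _, add_of_X_ne hx, ?_, ?_⟩
    · rw [show x₁ * β₁ * β₀ - x₀ * β₀ * β₁ = β₁ * β₀ * (x₁ - x₀) by ring]
      exact pow_ne_zero _ (mul_ne_zero (mul_ne_zero h3 h4) hd)
    · have e : some x y h = some x₁ y₁ h₁ + -some x₀ y₀ h₀ := by rw [hPQ]; abel
      rw [neg_some, add_of_X_ne hx] at e
      injection e with hx' _
      rw [WeierstrassCurve.Affine.slope_of_X_ne hx, addX_eq] at *
      rw [hx', negY_eq]
      field_simp
      linear_combination (2 : ℂ) * e₁ + 2 * e₀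

section
open Polynomial

/-- The polynomial has degree at most `N` and the coefficient of `X ^ N` is `c`. -/
def HasLead (f : ℂ[X]) (N : ℕ) (c : ℂ) : Prop := f.natDegree ≤ N ∧ f.coeff N = c

theorem HasLead.mul {f g : ℂ[X]} {N M : ℕ} {c d : ℂ} (hf : HasLead f N c) (hg : HasLead g M d) :
    HasLead (f * g) (N + M) (c * d) := by
  refine ⟨natDegree_mul_le.trans (add_le_add hf.1 hg.1), ?_⟩
  rw [coeff_mul_add_eq_of_natDegree_le hf.1 hg.1, hf.2, hg.2]

theorem HasLead.pow {f : ℂ[X]} {N : ℕ} {c : ℂ} (hf : HasLead f N c) (k : ℕ) :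
    HasLead (f ^ k) (k * N) (c ^ k) := by
  refine ⟨natDegree_pow_le.trans (Nat.mul_le_mul_left k hf.1), ?_⟩
  rw [mul_comm k N, mul_comm N k, coeff_pow_of_natDegree_le hf.1, hf.2]

theorem HasLead.add {f g : ℂ[X]} {N : ℕ} {c d : ℂ} (hf : HasLead f N c) (hg : HasLead g N d) :
    HasLead (f + g) N (c + d) :=
  ⟨(natDegree_add_le _ _).trans (max_le hf.1 hg.1), by rw [coeff_add, hf.2, hg.2]⟩

theorem HasLead.sub {f g : ℂ[X]} {N : ℕ} {c d : ℂ} (hf : HasLead f N c) (hg : HasLead g N d) :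
    HasLead (f - g) N (c - d) :=
  ⟨(natDegree_sub_le _ _).trans (max_le hf.1 hg.1), by rw [coeff_sub, hf.2, hg.2]⟩

theorem HasLead.const_mul {f : ℂ[X]} {N : ℕ} {c : ℂ} (hf : HasLead f N c) (k : ℂ) :
    HasLead (C k * f) N (k * c) :=
  ⟨(natDegree_C_mul_le _ _).trans hf.1, by rw [coeff_C_mul, hf.2]⟩

theorem HasLead.cast {f : ℂ[X]} {N M : ℕ} {c d : ℂ} (hf : HasLead f N c) (hN : N = M)
    (hc : c = d) : HasLead f M d := hN ▸ hc ▸ hf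

theorem HasLead.of_X_mul {f : ℂ[X]} {N : ℕ} {c : ℂ} (hf : HasLead (X * f) (N + 1) c) :
    HasLead f N c := by
  refine ⟨?_, by rw [← hf.2, coeff_X_mul]⟩
  by_cases h : f = 0
  · simp [h]
  · have := hf.1
    rw [natDegree_X_mul h] at this
    omega

theorem HasLead.of_X_mul' {f : ℂ[X]} {N : ℕ} {c : ℂ} (hf : HasLead (X * f) N c) :
    HasLead f N 0 := by
  by_cases h : f = 0
  · simp [h, HasLead]
  · have := hf.1
    rw [natDegree_X_mul h] at this
    exact ⟨by omega, coeff_eq_zero_of_natDegree_lt (by omega)⟩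

/-- Multiplication by `n` on a Weierstrass cubic in terms of the `x`-coordinate. -/
theorem exists_mul_polynomials (a b : ℂ) (n : ℕ) (hn : 0 < n) : ∃ A B : ℂ[X],
    HasLead A (n ^ 2) 1 ∧ HasLead (X * B) (n ^ 2) ((n : ℂ) ^ 2) ∧
      ∀ (x y : ℂ) (h : (shortCurve a b).Nonsingular x y),
        HasX (n • (some x y h : (shortCurve a b).Point)) (A.eval x) (B.eval x) := by
  induction n using Nat.strong_induction_on with
  | _ n ih =>
  -- Even multiples come from doubling. Odd ones come from adding `m + 1` and `m` times the point,
  -- whose difference is the point itself. The denominator is tracked as `X * B`, which avoids the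
  -- exponent `n ^ 2 - 1`.
  obtain ⟨m, rfl | rfl⟩ := Nat.even_or_odd' n
  · obtain ⟨A, B, hA, hB, hX⟩ := ih m (by omega) (by omega)
    have hB0 := hB.of_X_mul'
    refine ⟨A ^ 4 - C (2 * a) * (A ^ 2 * B ^ 2) - C (8 * b) * (A * B ^ 3) + C (a ^ 2) * B ^ 4,
      C 4 * (B * (A ^ 3 + C a * (A * B ^ 2) + C b * B ^ 3)), ?_, ?_, ?_⟩
    · have t1 : HasLead (A ^ 4) (4 * m ^ 2) 1 := (hA.pow 4).cast rfl (by simp)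
      have t2 : HasLead (C (2 * a) * (A ^ 2 * B ^ 2)) (4 * m ^ 2) 0 :=
        (((hA.pow 2).mul (hB0.pow 2)).const_mul _).cast (by ring) (by simp)
      have t3 : HasLead (C (8 * b) * (A * B ^ 3)) (4 * m ^ 2) 0 :=
        ((hA.mul (hB0.pow 3)).const_mul _).cast (by ring) (by simp)
      have t4 : HasLead (C (a ^ 2) * B ^ 4) (4 * m ^ 2) 0 :=
        ((hB0.pow 4).const_mul _).cast rfl (by simp)
      exact (((t1.sub t2).sub t3).add t4).cast (by ring) (by simp)
    · have t1 : HasLead (A ^ 3) (3 * m ^ 2) 1 := (hA.pow 3).cast rfl (by simp)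
      have t2 : HasLead (C a * (A * B ^ 2)) (3 * m ^ 2) 0 :=
        ((hA.mul (hB0.pow 2)).const_mul _).cast (by ring) (by simp)
      have t3 : HasLead (C b * B ^ 3) (3 * m ^ 2) 0 :=
        ((hB0.pow 3).const_mul _).cast rfl (by simp)
      have t4 := (hB.mul ((t1.add t2).add t3)).const_mul 4
      rw [show X * (C 4 * (B * (A ^ 3 + C a * (A * B ^ 2) + C b * B ^ 3))) =
        C 4 * (X * B * (A ^ 3 + C a * (A * B ^ 2) + C b * B ^ 3)) by ring]
      exact t4.cast (by ring) (by push_cast; ring)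
    · intro x y h
      have := (hX x y h).double
      rw [← two_nsmul, ← mul_nsmul'] at this
      convert this using 1 <;> simp
      · ring
      · ring
  · rcases Nat.eq_zero_or_pos m with rfl | hm
    · refine ⟨X, 1, ?_, ?_, ?_⟩
      · simp [HasLead]
      · simp [HasLead]
      · intro x y h
        right
        exact ⟨x, y, h, by simp, by simp, by simp⟩
    obtain ⟨A₁, B₁, hA₁, hB₁, hX₁⟩ := ih (m + 1) (by omega) (by omega)
    obtain ⟨A₀, B₀, hA₀, hB₀, hX₀⟩ := ih m (by omega) hm
    have hb₁ := hB₁.of_X_mul'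
    have hb₀ := hB₀.of_X_mul'
    have hD : HasLead (A₁ * (X * B₀) - A₀ * (X * B₁)) ((m + 1) ^ 2 + m ^ 2) (-(2 * m + 1)) :=
      ((hA₁.mul hB₀).sub ((hA₀.mul hB₁).cast (add_comm _ _) rfl)).cast rfl (by push_cast; ring)
    have hD2 : HasLead ((A₁ * (X * B₀) - A₀ * (X * B₁)) ^ 2) (2 * ((m + 1) ^ 2 + m ^ 2))
      ((2 * m + 1) ^ 2) := (hD.pow 2).cast rfl (by ring)
    refine ⟨C 2 * ((A₁ * A₀ + C a * (B₁ * B₀)) * (A₁ * B₀ + A₀ * B₁) +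
      C (2 * b) * (B₁ ^ 2 * B₀ ^ 2)) - X * (A₁ * B₀ - A₀ * B₁) ^ 2, (A₁ * B₀ - A₀ * B₁) ^ 2,
      HasLead.of_X_mul ?_, HasLead.of_X_mul ?_, ?_⟩
    -- After multiplication by `X` the degree is `2 ((m + 1)² + m²) = (2 m + 1)² + 1`, and the same
    -- identity gives the leading coefficient `2 ((m + 1)² + m²) - (2 m + 1)² = 1`.
    · have t1 : HasLead (A₁ * A₀ + C a * (B₁ * B₀)) ((m + 1) ^ 2 + m ^ 2) 1 :=
        ((hA₁.mul hA₀).add ((hb₁.mul hb₀).const_mul a)).cast rfl (by simp)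
      have t2 : HasLead (A₁ * (X * B₀) + A₀ * (X * B₁)) ((m + 1) ^ 2 + m ^ 2)
          ((m : ℂ) ^ 2 + (m + 1) ^ 2) :=
        ((hA₁.mul hB₀).add ((hA₀.mul hB₁).cast (add_comm _ _) rfl)).cast rfl (by push_cast; ring)
      have t3 : HasLead (C (2 * b) * (B₁ ^ 2 * (B₀ * (X * B₀)))) (2 * ((m + 1) ^ 2 + m ^ 2)) 0 :=
        (((hb₁.pow 2).mul (hb₀.mul hB₀)).const_mul _).cast (by ring) (by simp)
      have t4 := ((((t1.mul t2).cast (by ring) rfl).add t3).const_mul 2).sub hD2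
      rw [show X * (C 2 * ((A₁ * A₀ + C a * (B₁ * B₀)) * (A₁ * B₀ + A₀ * B₁) +
        C (2 * b) * (B₁ ^ 2 * B₀ ^ 2)) - X * (A₁ * B₀ - A₀ * B₁) ^ 2) =
        C 2 * ((A₁ * A₀ + C a * (B₁ * B₀)) * (A₁ * (X * B₀) + A₀ * (X * B₁)) +
          C (2 * b) * (B₁ ^ 2 * (B₀ * (X * B₀)))) - (A₁ * (X * B₀) - A₀ * (X * B₁)) ^ 2 by ring]
      exact t4.cast (by ring) (by ring)
    · rw [show X * (X * (A₁ * B₀ - A₀ * B₁) ^ 2) = (A₁ * (X * B₀) - A₀ * (X * B₁)) ^ 2 by ring]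
      exact hD2.cast (by ring) (by push_cast; ring)
    · intro x y h
      have := (hX₁ x y h).add (hX₀ x y h) (succ_nsmul _ _)
      rw [← add_nsmul] at this
      convert this using 1
      · congr 1; ring
      · simp; ring
      · simp

/-- The number of points of order dividing `n` on a Weierstrass cubic. -/
theorem card_torsion_le {H : Type*} [AddCommGroup H] (φ : H →+ (shortCurve a b).Point)
    (hφ : Function.Injective φ) {n : ℕ} (hn : 0 < n) (s : Finset H)
    (hs : ∀ h ∈ s, h ≠ 0 ∧ n • h = 0) : s.card ≤ 2 * (n ^ 2 - 1) := by
  classical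
  obtain ⟨A, B, -, hB, hX⟩ := exists_mul_polynomials a b n hn
  have hB0 : B ≠ 0 := by
    rintro rfl
    have := hB.2
    rw [mul_zero, coeff_zero] at this
    exact pow_ne_zero 2 (Nat.cast_ne_zero.2 hn.ne') this.symm
  have hdeg : B.natDegree ≤ n ^ 2 - 1 := by
    have := hB.1
    rw [natDegree_X_mul hB0] at this
    omega
  have hpt : ∀ h ∈ s, ∃ x y hxy, φ h = some x y hxy := by
    intro h hh
    rcases e : φ h with _ | ⟨x, y, hxy⟩
    · exact absurd (hφ (e.trans φ.map_zero.symm)) (hs h hh).1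
    · exact ⟨x, y, hxy, rfl⟩
  choose! X Y hXY heq using hpt
  -- The `x`-coordinate of a nonzero torsion point is a root of the denominator `B`, and at most two
  -- points share an `x`-coordinate.
  have hroot : ∀ h (_ : h ∈ s), X h ∈ B.roots.toFinset := by
    intro h hh
    rw [Multiset.mem_toFinset, mem_roots hB0]
    have h1 := hX _ _ (hXY h hh)
    rw [← heq h hh, ← φ.map_nsmul, (hs h hh).2, φ.map_zero] at h1
    exact (hasX_zero h1).1
  have hcard := Finset.card_le_mul_card_image_of_maps_to hroot 2 (by
    intro u _
    by_contra hc
    push Not at hc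
    obtain ⟨h₁, h₂, h₃, m1, m2, m3, n12, n13, n23⟩ := Finset.two_lt_card_iff.1 hc
    simp only [Finset.mem_filter] at m1 m2 m3
    have hy : ∀ h ∈ s, X h = u → Y h ^ 2 = u ^ 3 + a * u + b := by
      rintro h hh rfl
      exact ((nonsingular_iff _ _).1 (hXY h hh)).1
    have hne : ∀ h ∈ s, ∀ h' ∈ s, X h = u → X h' = u → h ≠ h' → Y h ≠ Y h' := by
      intro h hh h' hh' e e' hne he
      apply hne
      apply hφ
      rw [heq h hh, heq h' hh']
      exact some_congr _ (e.trans e'.symm) he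
    have s12 := (sq_eq_sq_iff_eq_or_eq_neg.1 ((hy _ m1.1 m1.2).trans (hy _ m2.1 m2.2).symm)).resolve_left
      (hne _ m1.1 _ m2.1 m1.2 m2.2 n12)
    have s13 := (sq_eq_sq_iff_eq_or_eq_neg.1 ((hy _ m1.1 m1.2).trans (hy _ m3.1 m3.2).symm)).resolve_left
      (hne _ m1.1 _ m3.1 m1.2 m3.2 n13)
    exact hne _ m2.1 _ m3.1 m2.2 m3.2 n23 (neg_injective (s12.symm.trans s13)))
  refine hcard.trans (Nat.mul_le_mul_left 2 ?_)
  exact (Multiset.toFinset_card_le _).trans ((card_roots' B).trans hdeg)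

end

end shortCurve

/-! ### Invariant factors from a torsion bound -/

/-- In a finite commutative group an element of maximal order generates a direct factor. -/
theorem exists_mulEquiv_zpowers_prod {G : Type*} [CommGroup G] [Finite G] :
    ∃ (c : G) (K : Subgroup G), orderOf c = Monoid.exponent G ∧
      Nonempty (Subgroup.zpowers c × K ≃* G) := by
  obtain ⟨c, hc⟩ := Monoid.exists_orderOf_eq_exponent (G := G) Monoid.ExponentExists.of_finite
  let C := Subgroup.zpowers c
  have hcard : Nat.card C = orderOf c := Nat.card_zpowers c
  have hne : NeZero (orderOf c) := ⟨(orderOf_pos c).ne'⟩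
  obtain ⟨χ, hχ⟩ : ∃ χ : C →* ℂˣ, Function.Injective χ := by
    have e : ZMod (orderOf c) ≃+ Additive C := by
      rw [← hcard]; exact zmodAddCyclicAddEquiv (G := Additive C) inferInstance
    let ψ : Multiplicative (ZMod (orderOf c)) →* ℂˣ :=
      (ZMod.stdAddChar (N := orderOf c)).toMonoidHom.toHomUnits
    refine ⟨ψ.comp (AddMonoidHom.toMultiplicative e.symm.toAddMonoidHom), ?_⟩
    intro x y hxy
    have := congrArg Units.val hxy
    change ZMod.stdAddChar (e.symm (Additive.ofMul x)) =
      ZMod.stdAddChar (e.symm (Additive.ofMul y)) at this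
    exact e.symm.injective (ZMod.injective_stdAddChar this)
  obtain ⟨φ, hφ⟩ := MonoidHom.domRestrict_surjective (M := ℂ) C χ
  have hφ' : ∀ x : C, φ x = χ x := fun x => by rw [← hφ]; rfl
  -- `φ` extends a faithful character of `⟨c⟩` to `G`. Its values are roots of unity of order
  -- dividing the exponent, all of which occur on `⟨c⟩`, so the kernel of `φ` is a complement.
  have hsurj : ∀ g : G, ∃ x : C, χ x = φ g := by
    intro g
    let f : C → rootsOfUnity (orderOf c) ℂ := fun x => ⟨χ x, by
      rw [mem_rootsOfUnity, ← map_pow, ← hcard, pow_card_eq_one', map_one]⟩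
    have hf : Function.Bijective f := by
      refine (Nat.bijective_iff_injective_and_card f).2 ⟨fun x y h => hχ (congrArg Subtype.val h), ?_⟩
      rw [hcard]
      exact (Complex.card_rootsOfUnity _).symm
    obtain ⟨x, hx⟩ := hf.2 ⟨φ g, by
      rw [mem_rootsOfUnity, ← map_pow, hc, Monoid.pow_exponent_eq_one, map_one]⟩
    exact ⟨x, congrArg Subtype.val hx⟩
  refine ⟨c, φ.ker, hc, ⟨MulEquiv.ofBijective (C.subtype.coprod φ.ker.subtype) ⟨?_, ?_⟩⟩⟩
  · rw [injective_iff_map_eq_one]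
    rintro ⟨x, k⟩ h
    simp only [MonoidHom.coprod_apply, Subgroup.subtype_apply] at h
    have hk : φ k = 1 := k.2
    have hx : x = 1 := by
      apply hχ
      have h1 : φ (x * k) = 1 := by rw [h, map_one]
      rw [map_mul, hk, mul_one] at h1
      rw [← hφ', h1, map_one]
    subst hx
    ext
    · rfl
    · simpa using h
  · intro g
    obtain ⟨x, hx⟩ := hsurj g
    refine ⟨⟨x, ⟨(x : G)⁻¹ * g, ?_⟩⟩, by simp⟩
    rw [MonoidHom.mem_ker, map_mul, map_inv, hφ', hx, inv_mul_cancel]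

universe u

/-- Splitting off a cyclic factor whose order kills the group is what makes successive factors
divide one another. -/
theorem exists_addEquiv_zmod_prod {H : Type u} [AddCommGroup H] [Finite H] :
    ∃ (e : ℕ) (K : Type u) (_ : AddCommGroup K) (_ : Finite K),
      0 < e ∧ (∀ h : H, e • h = 0) ∧ Nonempty (H ≃+ ZMod e × K) := by
  obtain ⟨c, K, hc, ⟨f⟩⟩ := exists_mulEquiv_zpowers_prod (G := Multiplicative H)
  refine ⟨orderOf c, Additive K, inferInstance, inferInstance, orderOf_pos c, fun h => ?_, ?_⟩
  · rw [hc]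
    exact Monoid.pow_exponent_eq_one (Multiplicative.ofAdd h)
  · have hcard : Nat.card (Subgroup.zpowers c) = orderOf c := Nat.card_zpowers c
    have e : ZMod (orderOf c) ≃+ Additive (Subgroup.zpowers c) := by
      rw [← hcard]
      exact zmodAddCyclicAddEquiv (G := Additive (Subgroup.zpowers c)) inferInstance
    let g : Additive (Subgroup.zpowers c) × Additive K ≃+ H :=
      { toFun := fun x => Multiplicative.toAdd (f (x.1.toMul, x.2.toMul))
        invFun := fun h => (Additive.ofMul (f.symm (Multiplicative.ofAdd h)).1,
          Additive.ofMul (f.symm (Multiplicative.ofAdd h)).2)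
        left_inv := fun x => by simp
        right_inv := fun h => by simp
        map_add' := fun x y => congrArg Multiplicative.toAdd
          (map_mul f (x.1.toMul, x.2.toMul) (y.1.toMul, y.2.toMul)) }
    exact ⟨((e.prodCongr (AddEquiv.refl _)).trans g).symm⟩

/-- A product of three groups with elements of prime order `p` has at least `p ^ 3` elements of
order dividing `p`. -/
theorem exists_finset_card_torsion {A B C : Type*} [AddCommGroup A] [AddCommGroup B]
    [AddCommGroup C] {p : ℕ} {x : A} {y : B} {z : C} (hp : 0 < p) (hx : addOrderOf x = p)
    (hy : addOrderOf y = p) (hz : addOrderOf z = p) :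
    ∃ s : Finset (A × B × C), s.card = p ^ 3 - 1 ∧ ∀ h ∈ s, h ≠ 0 ∧ p • h = 0 := by
  classical
  let f : ℕ × ℕ × ℕ → A × B × C := fun i => (i.1 • x, i.2.1 • y, i.2.2 • z)
  let t := Finset.range p ×ˢ Finset.range p ×ˢ Finset.range p
  have hinj : Set.InjOn f t := by
    rintro ⟨i, j, k⟩ h ⟨i', j', k'⟩ h' he
    simp only [t, Finset.coe_product, Set.mem_prod, Finset.coe_range, Set.mem_Iio] at h h'
    simp only [f, Prod.mk.injEq] at he
    have e1 := nsmul_injOn_Iio_addOrderOf (x := x) (by simpa [hx] using h.1)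
      (by simpa [hx] using h'.1) he.1
    have e2 := nsmul_injOn_Iio_addOrderOf (x := y) (by simpa [hy] using h.2.1)
      (by simpa [hy] using h'.2.1) he.2.1
    have e3 := nsmul_injOn_Iio_addOrderOf (x := z) (by simpa [hz] using h.2.2)
      (by simpa [hz] using h'.2.2) he.2.2
    rw [e1, e2, e3]
  refine ⟨(t.image f).erase 0, ?_, ?_⟩
  · rw [Finset.card_erase_of_mem, Finset.card_image_of_injOn hinj]
    · simp [t]; ring_nf
    · exact Finset.mem_image.2 ⟨(0, 0, 0), by simp [t, hp], by simp [f]⟩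
  · intro h hh
    obtain ⟨h0, hh⟩ := Finset.mem_erase.1 hh
    obtain ⟨i, -, rfl⟩ := Finset.mem_image.1 hh
    refine ⟨h0, ?_⟩
    have k1 : p • i.1 • x = 0 := by rw [smul_comm, ← hx, addOrderOf_nsmul_eq_zero, smul_zero]
    have k2 : p • i.2.1 • y = 0 := by rw [smul_comm, ← hy, addOrderOf_nsmul_eq_zero, smul_zero]
    have k3 : p • i.2.2 • z = 0 := by rw [smul_comm, ← hz, addOrderOf_nsmul_eq_zero, smul_zero]
    simp only [f, Prod.smul_mk, k1, k2, k3]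
    rfl

theorem isInvariantFactors_one {H : Type*} [AddCommGroup H] {n : ℕ} (hn : 1 < n)
    (f : H ≃+ ZMod n) : IsInvariantFactors H ![n] := by
  refine ⟨fun i => by fin_cases i; exact hn, fun i j _ => ?_, ⟨f.trans ?_⟩⟩
  · fin_cases i; fin_cases j; exact dvd_rfl
  · exact
      { toFun := fun x i => match i with | 0 => x
        invFun := fun y => y 0
        left_inv := fun x => rfl
        right_inv := fun y => by ext i; fin_cases i; rfl
        map_add' := fun x y => by ext i; fin_cases i; rfl }

theorem isInvariantFactors_two {H : Type*} [AddCommGroup H] {m n : ℕ} (hm : 1 < m) (hn : 1 < n)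
    (hmn : m ∣ n) (f : H ≃+ ZMod m × ZMod n) : IsInvariantFactors H ![m, n] := by
  refine ⟨fun i => by fin_cases i <;> assumption, fun i j hij => ?_, ⟨f.trans ?_⟩⟩
  · fin_cases i <;> fin_cases j <;> simp_all
  · exact
      { toFun := fun x i => match i with | 0 => x.1 | 1 => x.2
        invFun := fun y => (y 0, y 1)
        left_inv := fun x => rfl
        right_inv := fun y => by ext i; fin_cases i <;> rfl
        map_add' := fun x y => by ext i; fin_cases i <;> rfl }

/-- A finite commutative group without large `p`-torsion has at most two invariant factors. -/
theorem exists_isInvariantFactors {H : Type u} [AddCommGroup H] [Finite H] [Nontrivial H]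
    (hH : ∀ p : ℕ, p.Prime → ∀ s : Finset H, (∀ h ∈ s, h ≠ 0 ∧ p • h = 0) →
      s.card ≤ 2 * (p ^ 2 - 1)) :
    ∃ r : ℕ, r ≤ 2 ∧ ∃ d : Fin r → ℕ, IsInvariantFactors H d := by
  classical
  obtain ⟨n, K, _, _, hn, hnH, ⟨f⟩⟩ := exists_addEquiv_zmod_prod (H := H)
  have hn1 : 1 < n := by
    by_contra h
    obtain ⟨h, h0⟩ := exists_ne (0 : H)
    have := hnH h
    rw [show n = 1 by omega, one_smul] at this
    exact h0 this
  rcases subsingleton_or_nontrivial K with hK | hK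
  · refine ⟨1, by norm_num, ![n], isInvariantFactors_one hn1 (f.trans ?_)⟩
    exact
      { toFun := fun x => x.1
        invFun := fun y => (y, 0)
        left_inv := fun x => Prod.ext rfl (Subsingleton.elim _ _)
        right_inv := fun y => rfl
        map_add' := fun x y => rfl }
  obtain ⟨m, L, _, _, hm, hmK, ⟨g⟩⟩ := exists_addEquiv_zmod_prod (H := K)
  have hm1 : 1 < m := by
    by_contra h
    obtain ⟨h, h0⟩ := exists_ne (0 : K)
    have := hmK h
    rw [show m = 1 by omega, one_smul] at this
    exact h0 this
  have hnK : ∀ k : K, n • k = 0 := by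
    intro k
    have := congrArg f (hnH (f.symm (0, k)))
    rw [map_nsmul, f.apply_symm_apply, map_zero] at this
    exact congrArg Prod.snd this
  have hmn : m ∣ n := by
    have := congrArg g (hnK (g.symm (1, 0)))
    rw [map_nsmul, g.apply_symm_apply, map_zero] at this
    have h1 : n • (1 : ZMod m) = 0 := congrArg Prod.fst this
    rw [nsmul_one] at h1
    exact (ZMod.natCast_eq_zero_iff n m).1 h1
  rcases subsingleton_or_nontrivial L with hL | hL
  · refine ⟨2, le_rfl, ![m, n], isInvariantFactors_two hm1 hn1 hmn (f.trans ?_)⟩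
    exact
      { toFun := fun x => ((g x.2).1, x.1)
        invFun := fun y => (y.2, g.symm (y.1, 0))
        left_inv := fun x => by
          have : ((g x.2).1, (0 : L)) = g x.2 := Prod.ext rfl (Subsingleton.elim _ _)
          simp [this]
        right_inv := fun y => by simp
        map_add' := fun x y => by simp }
  -- After two cyclic factors the rest `L` is nontrivial. A prime `p` dividing its order divides
  -- `m`, hence `n`, and there are `p ^ 3 - 1 > 2 (p ^ 2 - 1)` nonzero elements killed by `p`.
  exfalso
  have hLc : Nat.card L ≠ 1 := by
    have := Finite.one_lt_card (α := L)
    omega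
  obtain ⟨p, hp, hpL⟩ := Nat.exists_prime_and_dvd hLc
  have := Fact.mk hp
  obtain ⟨z, hz⟩ := exists_prime_addOrderOf_dvd_card' p hpL
  have hpm : p ∣ m := by
    rw [← hz]
    apply addOrderOf_dvd_of_nsmul_eq_zero
    have := congrArg g (hmK (g.symm (0, z)))
    rw [map_nsmul, g.apply_symm_apply, map_zero] at this
    exact congrArg Prod.snd this
  have : NeZero n := ⟨hn.ne'⟩
  have : NeZero m := ⟨hm.ne'⟩
  obtain ⟨x, hx⟩ := exists_prime_addOrderOf_dvd_card' (G := ZMod n) p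
    (by rw [Nat.card_zmod]; exact hpm.trans hmn)
  obtain ⟨y, hy⟩ := exists_prime_addOrderOf_dvd_card' (G := ZMod m) p (by rw [Nat.card_zmod]; exact hpm)
  obtain ⟨s, hs, hs'⟩ := exists_finset_card_torsion hp.pos hx hy hz
  let F : ZMod n × ZMod m × L ≃+ H := (f.trans ((AddEquiv.refl _).prodCongr g)).symm
  have := hH p hp (s.map F.toEquiv.toEmbedding) (by
    intro h hh
    obtain ⟨w, hw, rfl⟩ := Finset.mem_map.1 hh
    obtain ⟨h1, h2⟩ := hs' w hw
    refine ⟨fun h0 => h1 (F.injective (h0.trans F.map_zero.symm)), ?_⟩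
    change p • F w = 0
    rw [← map_nsmul, h2, map_zero])
  rw [Finset.card_map, hs] at this
  have h2 := hp.two_le
  obtain ⟨k, rfl⟩ : ∃ k, p = k + 2 := ⟨p - 2, by omega⟩
  have e1 : (k + 2) ^ 3 = k ^ 3 + 6 * k ^ 2 + 12 * k + 8 := by ring
  have e2 : (k + 2) ^ 2 = k ^ 2 + 4 * k + 4 := by ring
  rw [e1, e2] at this
  omega

/-! ### Cyclic groups and pencils; the bound on the invariant factors -/

/-- The net of three pencils of a finite cyclic group. -/
theorem exists_dualNet_of_isAddCyclic {H : Type*} [AddCommGroup H] [Finite H] (hc : IsAddCyclic H) :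
    ∃ P : Fin 3 → H → Fin 3 → ℂ, DualNet (P 0) (P 1) (P 2) ∧ ∀ a, P 0 a ⬝ᵥ ![0, 0, 1] = 0 := by
  have hne : NeZero (Nat.card H) := ⟨Nat.card_pos.ne'⟩
  let e : ZMod (Nat.card H) ≃+ H := zmodAddCyclicAddEquiv hc
  let ψ : H → ℂ := fun a => ZMod.stdAddChar (e.symm a)
  have hadd : ∀ a b, ψ (a + b) = ψ a * ψ b := by
    intro a b; simp only [ψ, map_add, AddChar.map_add_eq_mul]
  have h0 : ψ 0 = 1 := by simp [ψ]
  have hinj : Function.Injective ψ := fun a b h => e.symm.injective (ZMod.injective_stdAddChar h)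
  have hnz : ∀ a, ψ a ≠ 0 := by
    intro a h
    have := hadd a (-a)
    rw [add_neg_cancel, h0, h, zero_mul] at this
    exact one_ne_zero this
  have hsub : ∀ a b, a ≠ b → ψ a - ψ b ≠ 0 := fun a b h => sub_ne_zero.2 (hinj.ne h)
  -- Points on the three sides of the coordinate triangle. By Menelaus they are collinear exactly
  -- when `ψ a * ψ b * ψ c = 1`.
  refine ⟨![fun a => ![1, -ψ a, 0], fun a => ![0, 1, -ψ a], fun a => ![-ψ a, 0, 1]],
    ⟨?_, ?_, ?_, ?_, ?_, ?_, ?_⟩, fun a => by simp⟩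
  · intro a b c h
    have := hadd (a + b) c
    rw [h, h0, hadd] at this
    simp only [det3, Matrix.cons_val]
    linear_combination this
  · intro a a' b h
    have := mul_ne_zero (hsub a a' h) (hnz b)
    simp only [det3, Matrix.cons_val]
    intro h0; apply this; linear_combination -h0
  · intro a a' b h
    have := hsub a a' h
    simp only [det3, Matrix.cons_val]
    intro h0; apply this; linear_combination h0
  · intro a a' b h
    have := hsub a a' h
    simp only [det3, Matrix.cons_val]
    intro h0; apply this; linear_combination h0
  · intro a a' b h
    have := mul_ne_zero (hsub a a' h) (hnz b)
    simp only [det3, Matrix.cons_val]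
    intro h0; apply this; linear_combination -h0
  · intro a a' b h
    have := mul_ne_zero (hsub a a' h) (hnz b)
    simp only [det3, Matrix.cons_val]
    intro h0; apply this; linear_combination -h0
  · intro a a' b h
    have := hsub a a' h
    simp only [det3, Matrix.cons_val]
    intro h0; apply this; linear_combination h0

/-- A finite group is realized by a net with a pencil exactly if it is cyclic. -/
theorem exists_realizes_isPencil_iff (H : Type*) [AddCommGroup H] [Finite H] [Nontrivial H] :
    (∃ N : PlaneNet 3, N.Realizes H ∧ ∃ i : Fin 3, N.IsPencil i) ↔ IsAddCyclic H := by
  constructor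
  · rintro ⟨N, hN, i, hi⟩
    obtain ⟨P, D, hP⟩ := hN.exists_dualNet
    obtain ⟨x, hx, hx'⟩ := hP i hi
    fin_cases i
    · exact D.isAddCyclic_of_collinear hx hx'
    · exact D.rotate.isAddCyclic_of_collinear hx hx'
    · exact D.rotate.rotate.isAddCyclic_of_collinear hx hx'
  · intro hc
    obtain ⟨P, D, hP⟩ := exists_dualNet_of_isAddCyclic hc
    obtain ⟨N, hN, hN'⟩ := D.exists_realizes
    exact ⟨N, hN, 0, hN' 0 ⟨![0, 0, 1], fun h => by simpa using congrFun h 2, hP⟩⟩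

/-- A realizable group with an element of order at least ten has at most two invariant factors. -/
theorem PlaneNet.Realizes.exists_isInvariantFactors {H : Type*} [AddCommGroup H] [Finite H]
    {N : PlaneNet 3} (hN : N.Realizes H) {h : H} (hh : 10 ≤ addOrderOf h) :
    ∃ r : ℕ, r ≤ 2 ∧ ∃ d : Fin r → ℕ, IsInvariantFactors H d := by
  have hnt : Nontrivial H := ⟨h, 0, fun h0 => by simp [h0] at hh⟩
  obtain ⟨P, D, -⟩ := hN.exists_dualNet
  rcases D.isAddCyclic_or_exists_hom hh with hc | ⟨A, B, φ, hφ⟩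
  · refine ⟨1, by norm_num, ![Nat.card H], isInvariantFactors_one ?_ (zmodAddCyclicAddEquiv hc).symm⟩
    exact Finite.one_lt_card
  · exact _root_.exists_isInvariantFactors fun p hp s hs =>
      shortCurve.card_torsion_le φ hφ hp.pos s hs

/-! ### Torsion of a smooth cubic -/

namespace shortCurve

open WeierstrassCurve.Affine.Point

variable {a b : ℂ}

section
open Polynomial

theorem HasLead.derivative {f : ℂ[X]} {N : ℕ} {c : ℂ} (hf : HasLead f (N + 1) c) :
    HasLead (Polynomial.derivative f) N ((N + 1) * c) := by
  refine ⟨(natDegree_derivative_le f).trans (by have := hf.1; omega), ?_⟩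
  rw [coeff_derivative, hf.2]; ring

/-- Some pencil member `A - c B` of two polynomials is separable. -/
theorem exists_card_roots_eq {A B : ℂ[X]} {N : ℕ} (hN : 0 < N) (hA : HasLead A N 1)
    (hB : HasLead (X * B) N N) (hAB : ∀ x, A.eval x = 0 → B.eval x ≠ 0) :
    ∃ (c : ℂ) (s : Finset ℂ), s.card = N ∧ ∀ x ∈ s, A.eval x = c * B.eval x := by
  obtain ⟨k, rfl⟩ : ∃ k, N = k + 1 := ⟨N - 1, by omega⟩
  -- A double root `x` of `A - c B` is a root of the Wronskian `W`, and then `c = A(x) / B(x)`. So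
  -- all but finitely many `c` are admissible once `W ≠ 0`, which follows from the leading
  -- coefficient `N` of `X * W`.
  let W := derivative A * B - A * derivative B
  have hW : W ≠ 0 := by
    have h1 := ((hA.derivative.mul hB).sub ((hA.mul hB.derivative).cast (add_comm _ _) rfl)).add
      ((hA.mul hB.of_X_mul).cast (add_comm _ _) rfl)
    have e : derivative A * (X * B) - A * derivative (X * B) + A * B = X * W := by
      simp only [W, derivative_mul, derivative_X]; ring
    rw [e] at h1
    rintro h0
    have := h1.2
    rw [h0] at this
    simp at this
    norm_cast at this
  obtain ⟨c, hc⟩ := Infinite.exists_notMem_finset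
    (W.roots.toFinset.image fun x => A.eval x / B.eval x)
  have hP : HasLead (A - C c * B) (k + 1) 1 :=
    (hA.sub (hB.of_X_mul'.const_mul c)).cast rfl (by simp)
  have hP0 : A - C c * B ≠ 0 := by
    intro h0
    have := hP.2
    simp [h0] at this
  have hdeg : (A - C c * B).natDegree = k + 1 :=
    le_antisymm hP.1 (le_natDegree_of_ne_zero (by rw [hP.2]; exact one_ne_zero))
  have hnodup : (A - C c * B).roots.Nodup := by
    rw [Multiset.nodup_iff_count_le_one]
    intro x
    by_contra hlt
    push Not at hlt
    rw [count_roots, one_lt_rootMultiplicity_iff_isRoot hP0] at hlt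
    obtain ⟨h1, h2⟩ := hlt
    simp only [IsRoot, derivative_sub, derivative_mul, derivative_C, eval_sub, eval_mul, eval_C,
      zero_mul, zero_add] at h1 h2
    have hBx : B.eval x ≠ 0 := by
      intro h0
      exact hAB x (by linear_combination h1 + c * h0) h0
    apply hc
    refine Finset.mem_image.2 ⟨x, ?_, ?_⟩
    · rw [Multiset.mem_toFinset, mem_roots hW]
      simp only [W, IsRoot, eval_sub, eval_mul]
      linear_combination B.eval x * h2 - (derivative B).eval x * h1
    · field_simp; linear_combination h1
  refine ⟨c, (A - C c * B).roots.toFinset, ?_, fun x hx => ?_⟩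
  · rw [Multiset.toFinset_card_of_nodup hnodup, ← hdeg]
    exact (IsAlgClosed.splits _).natDegree_eq_card_roots.symm
  · rw [Multiset.mem_toFinset, mem_roots hP0] at hx
    simp only [IsRoot, eval_sub, eval_mul, eval_C] at hx
    linear_combination hx

end

/-- On a smooth curve there is a point over every `x`. -/
theorem exists_nonsingular (hab : ∀ x y, (shortCurve a b).Equation x y →
    (shortCurve a b).Nonsingular x y) (x : ℂ) : ∃ y, (shortCurve a b).Nonsingular x y := by
  obtain ⟨y, hy⟩ := IsAlgClosed.exists_pow_nat_eq (x ^ 3 + a * x + b) (n := 2) (by norm_num)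
  exact ⟨y, hab x y ((equation_iff x y).2 hy)⟩

/-- A smooth Weierstrass cubic has at least `n ^ 2` points of order dividing `n`. -/
theorem exists_torsion (hab : ∀ x y, (shortCurve a b).Equation x y →
    (shortCurve a b).Nonsingular x y) {n : ℕ} (hn : 0 < n) :
    ∃ s : Finset (shortCurve a b).Point, s.card = n ^ 2 ∧ ∀ P ∈ s, n • P = 0 := by
  classical
  obtain ⟨A, B, hA, hB, hX⟩ := exists_mul_polynomials a b n hn
  have hAB : ∀ x, A.eval x = 0 → B.eval x ≠ 0 := by
    intro x h0
    obtain ⟨y, h⟩ := exists_nonsingular hab x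
    rcases hX x y h with h1 | ⟨_, _, _, _, h1, _⟩
    · exact absurd h0 h1.2.2
    · exact h1
  obtain ⟨c, s, hs, hsc⟩ := exists_card_roots_eq (pow_pos hn 2) hA
    (hB.cast rfl (by push_cast; rfl)) hAB
  obtain ⟨d, hd⟩ := exists_nonsingular hab c
  -- Over each of the `n ^ 2` solutions of `A = c B` there is a point whose `n`-th multiple has
  -- `x`-coordinate `c`; a change of sign makes this multiple the fixed point `(c, d)`.
  have hfib : ∀ x ∈ s, ∃ P : (shortCurve a b).Point, n • P = some c d hd ∧
      ∃ y h, P = some x y h := by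
    intro x hx
    obtain ⟨y, h⟩ := exists_nonsingular hab x
    rcases hX x y h with h1 | ⟨x', y', h', e, h1, h2⟩
    · exact absurd (by rw [hsc x hx, h1.2.1, mul_zero]) h1.2.2
    · have hx' : x' = c := by
        rw [hsc x hx] at h2
        exact mul_right_cancel₀ h1 h2
      subst hx'
      by_cases hy : y' = d
      · subst hy
        exact ⟨_, e, y, h, rfl⟩
      · refine ⟨-some x y h, ?_, _, _, neg_some h⟩
        rw [neg_nsmul, e, neg_eq_iff_add_eq_zero]
        exact some_add_some_of_eq _ _ hy
  choose! P hP hPx using hfib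
  have hinj : Set.InjOn P s := by
    intro x hx x' hx' he
    obtain ⟨y, h, e⟩ := hPx x hx
    obtain ⟨y', h', e'⟩ := hPx x' hx'
    rw [e, e'] at he
    injection he
  have hne : s.Nonempty := Finset.card_pos.1 (by rw [hs]; positivity)
  obtain ⟨x₀, hx₀⟩ := hne
  -- Differences of points with the same `n`-th multiple are torsion.
  refine ⟨s.image fun x => P x - P x₀, ?_, ?_⟩
  · rw [Finset.card_image_of_injOn, hs]
    intro x hx x' hx' he
    exact hinj hx hx' (sub_left_injective he)
  · intro Q hQ
    obtain ⟨x, hx, rfl⟩ := Finset.mem_image.1 hQ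
    rw [nsmul_sub, hP x hx, hP x₀ hx₀, sub_self]

/-- No positive integer kills all points of a smooth Weierstrass cubic. -/
theorem exists_nsmul_ne_zero (hab : ∀ x y, (shortCurve a b).Equation x y →
    (shortCurve a b).Nonsingular x y) {n : ℕ} (hn : 0 < n) :
    ∃ P : (shortCurve a b).Point, n • P ≠ 0 := by
  -- There are at least `4 n ^ 2` points killed by `2 n`; if `n` killed every point, they would
  -- exceed the upper bound for `n`.
  obtain ⟨s, hs, hs'⟩ := exists_torsion hab (n := 2 * n) (by omega)
  by_contra! h
  have hcard := card_torsion_le (AddMonoidHom.id (shortCurve a b).Point) Function.injective_id hn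
    (by classical exact s.erase 0) (by
      intro P hP
      exact ⟨(Finset.mem_erase.1 hP).1, h P⟩)
  have h1 := Finset.pred_card_le_card_erase (s := s) (a := 0)
  rw [hs] at h1
  have h2 : (2 * n) ^ 2 = 4 * n ^ 2 := by ring
  have h3 : 0 < n ^ 2 := by positivity
  omega

/-- The `n`-torsion of a smooth Weierstrass cubic. -/
theorem exists_torsion_equiv (hab : ∀ x y, (shortCurve a b).Equation x y →
    (shortCurve a b).Nonsingular x y) {n : ℕ} (hn : 1 < n) :
    ∃ φ : (Fin 2 → ZMod n) →+ (shortCurve a b).Point, Function.Injective φ := by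
  classical
  let K := (nsmulAddMonoidHom (α := (shortCurve a b).Point) n).ker
  have hK : ∀ k : K, n • k = 0 := fun k => Subtype.ext (AddMonoidHom.mem_ker.1 k.2)
  obtain ⟨s, hs, hs'⟩ := exists_torsion hab (n := n) (by omega)
  have hbound : ∀ t : Finset K, t.card ≤ 2 * n ^ 2 := by
    intro t
    have h1 := card_torsion_le K.subtype K.subtype_injective (n := n) (by omega) (t.erase 0)
      (fun h hh => ⟨(Finset.mem_erase.1 hh).1, hK h⟩)
    have h2 := Finset.pred_card_le_card_erase (s := t) (a := 0)
    have h3 : 0 < n ^ 2 := by positivity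
    omega
  have hfin : Finite K := by
    by_contra hinf
    rw [not_finite_iff_infinite] at hinf
    obtain ⟨t, ht⟩ := Infinite.exists_subset_card_eq K (2 * n ^ 2 + 1)
    have := hbound t
    omega
  have hcard : n ^ 2 ≤ Nat.card K := by
    have := Fintype.ofFinite K
    rw [Nat.card_eq_fintype_card, ← hs, ← Finset.card_univ]
    refine Finset.card_le_card_of_injOn (fun P => if h : P ∈ K then ⟨P, h⟩ else 0)
      (fun _ _ => Finset.mem_univ _) ?_
    intro P hP Q hQ h
    have hP' : P ∈ K := AddMonoidHom.mem_ker.2 (hs' P hP)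
    have hQ' : Q ∈ K := AddMonoidHom.mem_ker.2 (hs' Q hQ)
    simp only [hP', hQ', dif_pos, Subtype.mk.injEq] at h
    exact h
  have hnt : Nontrivial K := by
    have : 1 < Nat.card K := lt_of_lt_of_le (by nlinarith) hcard
    exact Finite.one_lt_card_iff_nontrivial.1 this
  obtain ⟨r, hr, d, hd1, hd2, ⟨f⟩⟩ := exists_isInvariantFactors (H := K)
    fun p hp s hs => card_torsion_le K.subtype K.subtype_injective hp.pos s hs
  have hdn : ∀ i, d i ∣ n := by
    intro i
    have h1 := congrArg f (hK (f.symm (Pi.single i 1)))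
    rw [_root_.map_nsmul, f.apply_symm_apply, f.map_zero] at h1
    have h2 := congrFun h1 i
    rw [Pi.smul_apply, Pi.single_eq_same, Pi.zero_apply, nsmul_one] at h2
    exact (ZMod.natCast_eq_zero_iff n _).1 h2
  have hprod : Nat.card K = ∏ i, d i := by
    rw [Nat.card_congr f.toEquiv, Nat.card_pi]
    simp
  have hle : ∀ i, d i ≤ n := fun i => Nat.le_of_dvd (by omega) (hdn i)
  interval_cases r
  -- At most two factors, each dividing `n`, with product at least `n ^ 2`: there are two and both
  -- equal `n`.
  · rw [Fin.prod_univ_zero] at hprod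
    nlinarith
  · rw [Fin.prod_univ_one] at hprod
    have := hle 0
    nlinarith
  · rw [Fin.prod_univ_two] at hprod
    have h0 := hle 0
    have h1 := hle 1
    have e : d = fun _ => n := by
      have e0 : d 0 = n := by
        by_contra hne
        have : d 0 + 1 ≤ n := by omega
        nlinarith
      have e1 : d 1 = n := by
        by_contra hne
        have : d 1 + 1 ≤ n := by omega
        nlinarith
      ext i; fin_cases i <;> assumption
    subst e
    exact ⟨K.subtype.comp f.symm.toAddMonoidHom, K.subtype_injective.comp f.symm.injective⟩

end shortCurve

/-! ### Dual nets from finite groups of points -/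

namespace shortCurve

open WeierstrassCurve.Affine.Point

variable {a b : ℂ}

/-- Homogeneous coordinates of a point of the curve. -/
def coords : (shortCurve a b).Point → Fin 3 → ℂ
  | .zero => ![0, 1, 0]
  | .some x y _ => ![x, y, 1]

theorem coords_zero : coords (0 : (shortCurve a b).Point) = ![0, 1, 0] := rfl

theorem coords_some {x y : ℂ} (h : (shortCurve a b).Nonsingular x y) :
    coords (some x y h) = ![x, y, 1] := rfl

theorem isPoint_coords (P : (shortCurve a b).Point) : IsPoint a b (coords P) := by
  rcases P with _ | ⟨x, y, h⟩
  · change IsPoint a b ![0, 1, 0]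
    exact ⟨fun h => by simpa using congrFun h 1, by simp [weierForm], by simp⟩
  · rw [coords_some]
    obtain ⟨e, hn⟩ := (nonsingular_iff _ _).1 h
    refine ⟨fun h => by simpa using congrFun h 2, ?_, ?_⟩
    · simp [weierForm]; linear_combination e
    · simpa using hn

theorem point_coords (P : (shortCurve a b).Point) : point a b (coords P) = P := by
  rcases P with _ | ⟨x, y, h⟩
  · change point a b ![0, 1, 0] = 0
    exact point_eq_zero (by simp)
  · have h2 : coords (some x y h) 2 ≠ 0 := by simp [coords_some]
    rw [(isPoint_coords _).point_eq_some h2]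
    symm
    exact some_congr h (by simp [coords_some]) (by simp [coords_some])

theorem cross_coords_ne_zero {P Q : (shortCurve a b).Point} (h : P ≠ Q) :
    cross (coords P) (coords Q) ≠ 0 := by
  intro h0
  apply h
  rcases P with _ | ⟨x, y, hP⟩
  · rcases Q with _ | ⟨x', y', hQ⟩
    · rfl
    · have := congrFun h0 0
      simp [cross, coords] at this
  · rcases Q with _ | ⟨x', y', hQ⟩
    · have := congrFun h0 0
      simp [cross, coords] at this
    · have e0 := congrFun h0 0
      have e1 := congrFun h0 1
      simp [cross, coords] at e0 e1
      exact some_congr hP (by linear_combination -e1) (by linear_combination e0)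

theorem add_add_eq_zero_of_det3 {P Q R : (shortCurve a b).Point} (hPQ : P ≠ Q) (hPR : P ≠ R)
    (hQR : Q ≠ R) (h : det3 (coords P) (coords Q) (coords R) = 0) : P + Q + R = 0 := by
  have := point_add (isPoint_coords P) (isPoint_coords Q) (isPoint_coords R)
    (cross_coords_ne_zero hPQ) (cross_coords_ne_zero hPR) (cross_coords_ne_zero hQR) h
  rwa [point_coords, point_coords, point_coords] at this

theorem det3_coords_zero {P Q : (shortCurve a b).Point} (h : P + Q = 0) :
    det3 (coords (0 : (shortCurve a b).Point)) (coords P) (coords Q) = 0 := by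
  have hQ : Q = -P := (neg_eq_of_add_eq_zero_right h).symm
  subst hQ
  rcases P with _ | ⟨x, y, hP⟩
  · change det3 ![0, 1, 0] ![0, 1, 0] ![0, 1, 0] = 0
    simp [det3]
  · change det3 ![0, 1, 0] ![x, y, 1] ![x, (shortCurve a b).negY x y, 1] = 0
    simp [det3]

/-- Three points that add up to zero are collinear. -/
theorem det3_coords {P Q R : (shortCurve a b).Point} (h : P + Q + R = 0) :
    det3 (coords P) (coords Q) (coords R) = 0 := by
  by_cases hP : P = 0
  · subst hP
    exact det3_coords_zero (by rw [← h, zero_add])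
  by_cases hQ : Q = 0
  · subst hQ
    rw [det3_swap, det3_coords_zero (by rw [← h, add_zero]), _root_.neg_zero]
  rcases P with _ | ⟨x₁, y₁, h₁⟩
  · exact absurd rfl hP
  rcases Q with _ | ⟨x₂, y₂, h₂⟩
  · exact absurd rfl hQ
  have hR : R = -(some x₁ y₁ h₁ + some x₂ y₂ h₂) := (neg_eq_of_add_eq_zero_right h).symm
  by_cases hx : x₁ = x₂
  · subst hx
    by_cases hy : y₁ = y₂
    · subst hy
      simp only [det3]; ring
    · rw [some_add_some_of_eq _ _ hy, _root_.neg_zero] at hR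
      rw [hR, coords_some, coords_some, coords_zero]
      simp [det3]
  · rw [add_of_X_ne' hx, neg_neg] at hR
    have hd : x₁ - x₂ ≠ 0 := sub_ne_zero.2 hx
    rw [hR, coords_some, coords_some, coords_some, WeierstrassCurve.Affine.slope_of_X_ne hx,
      addX_eq, negAddY_eq]
    simp only [det3, Matrix.cons_val]
    field_simp
    ring

end shortCurve

open shortCurve in
/-- A finite group of points of a smooth Weierstrass cubic has a dual net. -/
theorem exists_dualNet_of_hom {H : Type*} [AddCommGroup H] [Finite H] {a b : ℂ}
    (hab : ∀ x y, (shortCurve a b).Equation x y → (shortCurve a b).Nonsingular x y)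
    (φ : H →+ (shortCurve a b).Point) (hφ : Function.Injective φ) :
    ∃ P : Fin 3 → H → Fin 3 → ℂ, DualNet (P 0) (P 1) (P 2) := by
  -- The translates are by `s`, `3 • s`, `-(4 • s)`, of sum zero. Their differences, and the sums of
  -- one taken twice with another, are `± 2 • s`, `± 5 • s`, `± 7 • s`. As `70 = 2 · 5 · 7`, no such
  -- multiple is in the image of `φ`, so the points are different and the unwanted triples are not
  -- collinear.
  obtain ⟨s, hs⟩ := exists_nsmul_ne_zero hab (n := 70 * Nat.card H) (by have := Nat.card_pos (α := H); omega)
  have key : ∀ k : ℕ, k ∣ 70 → ∀ h : H, k • s ≠ φ h := by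
    rintro k ⟨m, hm⟩ h he
    apply hs
    rw [hm, show k * m * Nat.card H = m * Nat.card H * k by ring, mul_nsmul', he, ← map_nsmul,
      mul_nsmul', card_nsmul_eq_zero', nsmul_zero, map_zero]
  have hne : ∀ k : ℕ, k ∣ 70 → ∀ {P Q : (shortCurve a b).Point} (h : H), P - Q = k • s + φ h →
      P ≠ Q := by
    rintro k hk P Q h he rfl
    rw [sub_self] at he
    refine key k hk (-h) ?_
    rw [map_neg, eq_neg_iff_add_eq_zero, ← he]
  have hnz : ∀ k : ℕ, k ∣ 70 → ∀ {P : (shortCurve a b).Point} (h : H), P = k • s + φ h →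
      P ≠ 0 := by
    rintro k hk P h rfl h0
    refine key k hk (-h) ?_
    rw [map_neg, eq_neg_iff_add_eq_zero, h0]
  have hnz' : ∀ k : ℕ, k ∣ 70 → ∀ {P : (shortCurve a b).Point} (h : H), P = -(k • s) + φ h →
      P ≠ 0 := by
    rintro k hk P h rfl h0
    refine key k hk h ?_
    rwa [neg_add_eq_zero] at h0
  let t : Fin 3 → (shortCurve a b).Point := ![s, 3 • s, -(4 • s)]
  refine ⟨fun i h => coords (t i + φ h), ?_, ?_, ?_, ?_, ?_, ?_, ?_⟩
  · intro x y z h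
    apply det3_coords
    have e : φ x + φ y + φ z = 0 := by rw [← map_add, ← map_add, h, map_zero]
    calc t 0 + φ x + (t 1 + φ y) + (t 2 + φ z) = (t 0 + t 1 + t 2) + (φ x + φ y + φ z) := by abel
      _ = 0 := by
        rw [e, add_zero]
        change s + 3 • s + -(4 • s) = 0
        abel
  · intro x x' y hx h0
    refine hnz 5 (by norm_num) (x + x' + y) ?_ (add_add_eq_zero_of_det3 ?_ ?_ ?_ h0)
    · change s + φ x + (s + φ x') + (3 • s + φ y) = _
      simp only [map_add]; abel
    · exact fun h => hx (hφ (add_left_cancel h))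
    · refine (hne 2 (by norm_num) (y - x) ?_).symm
      change 3 • s + φ y - (s + φ x) = _
      simp only [map_sub]; abel
    · refine (hne 2 (by norm_num) (y - x') ?_).symm
      change 3 • s + φ y - (s + φ x') = _
      simp only [map_sub]; abel
  · intro x x' y hx h0
    refine hnz' 2 (by norm_num) (x + x' + y) ?_ (add_add_eq_zero_of_det3 ?_ ?_ ?_ h0)
    · change s + φ x + (s + φ x') + (-(4 • s) + φ y) = _
      simp only [map_add]; abel
    · exact fun h => hx (hφ (add_left_cancel h))
    · refine hne 5 (by norm_num) (x - y) ?_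
      change s + φ x - (-(4 • s) + φ y) = _
      simp only [map_sub]; abel
    · refine hne 5 (by norm_num) (x' - y) ?_
      change s + φ x' - (-(4 • s) + φ y) = _
      simp only [map_sub]; abel
  · intro x x' y hx h0
    refine hnz 7 (by norm_num) (x + x' + y) ?_ (add_add_eq_zero_of_det3 ?_ ?_ ?_ h0)
    · change 3 • s + φ x + (3 • s + φ x') + (s + φ y) = _
      simp only [map_add]; abel
    · exact fun h => hx (hφ (add_left_cancel h))
    · refine hne 2 (by norm_num) (x - y) ?_
      change 3 • s + φ x - (s + φ y) = _
      simp only [map_sub]; abel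
    · refine hne 2 (by norm_num) (x' - y) ?_
      change 3 • s + φ x' - (s + φ y) = _
      simp only [map_sub]; abel
  · intro x x' y hx h0
    refine hnz 2 (by norm_num) (x + x' + y) ?_ (add_add_eq_zero_of_det3 ?_ ?_ ?_ h0)
    · change 3 • s + φ x + (3 • s + φ x') + (-(4 • s) + φ y) = _
      simp only [map_add]; abel
    · exact fun h => hx (hφ (add_left_cancel h))
    · refine hne 7 (by norm_num) (x - y) ?_
      change 3 • s + φ x - (-(4 • s) + φ y) = _
      simp only [map_sub]; abel
    · refine hne 7 (by norm_num) (x' - y) ?_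
      change 3 • s + φ x' - (-(4 • s) + φ y) = _
      simp only [map_sub]; abel
  · intro x x' y hx h0
    refine hnz' 7 (by norm_num) (x + x' + y) ?_ (add_add_eq_zero_of_det3 ?_ ?_ ?_ h0)
    · change -(4 • s) + φ x + (-(4 • s) + φ x') + (s + φ y) = _
      simp only [map_add]; abel
    · exact fun h => hx (hφ (add_left_cancel h))
    · refine (hne 5 (by norm_num) (y - x) ?_).symm
      change s + φ y - (-(4 • s) + φ x) = _
      simp only [map_sub]; abel
    · refine (hne 5 (by norm_num) (y - x') ?_).symm
      change s + φ y - (-(4 • s) + φ x') = _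
      simp only [map_sub]; abel
  · intro x x' y hx h0
    refine hnz' 5 (by norm_num) (x + x' + y) ?_ (add_add_eq_zero_of_det3 ?_ ?_ ?_ h0)
    · change -(4 • s) + φ x + (-(4 • s) + φ x') + (3 • s + φ y) = _
      simp only [map_add]; abel
    · exact fun h => hx (hφ (add_left_cancel h))
    · refine (hne 7 (by norm_num) (y - x) ?_).symm
      change 3 • s + φ y - (-(4 • s) + φ x) = _
      simp only [map_sub]; abel
    · refine (hne 7 (by norm_num) (y - x') ?_).symm
      change 3 • s + φ y - (-(4 • s) + φ x') = _
      simp only [map_sub]; abel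

/-! ### Groups with at most two invariant factors, and the conclusion -/

theorem exists_zmod_hom_injective {m n : ℕ} (hn : 0 < n) (h : m ∣ n) :
    ∃ f : ZMod m →+ ZMod n, Function.Injective f := by
  obtain ⟨k, rfl⟩ := h
  have hk : k ≠ 0 := by rintro rfl; simp at hn
  refine ⟨ZMod.lift m ⟨zmultiplesHom _ (k : ZMod (m * k)), ?_⟩, (ZMod.lift_injective m).2 ?_⟩
  · simp only [zmultiplesHom_apply, natCast_zsmul, nsmul_eq_mul]
    rw [← Nat.cast_mul, ZMod.natCast_self]
  · intro z hz
    simp only [zmultiplesHom_apply, zsmul_eq_mul] at hz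
    rw [ZMod.intCast_zmod_eq_zero_iff_dvd]
    have h1 : ((z * k : ℤ) : ZMod (m * k)) = 0 := by push_cast; exact hz
    rw [ZMod.intCast_zmod_eq_zero_iff_dvd] at h1
    push_cast at h1
    exact Int.dvd_of_mul_dvd_mul_right (Int.natCast_ne_zero.2 hk) h1

/-- A nontrivial group with at most two invariant factors has a dual net. -/
theorem IsInvariantFactors.exists_dualNet {H : Type*} [AddCommGroup H] [Finite H] [Nontrivial H]
    {r : ℕ} (hr : r ≤ 2) {d : Fin r → ℕ} (hd : IsInvariantFactors H d) :
    ∃ P : Fin 3 → H → Fin 3 → ℂ, DualNet (P 0) (P 1) (P 2) := by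
  obtain ⟨h1, h2, ⟨f⟩⟩ := hd
  interval_cases r
  · exact absurd f.toEquiv.subsingleton (not_subsingleton H)
  · obtain ⟨P, D, -⟩ := exists_dualNet_of_isAddCyclic (H := H) (by
      let g : ZMod (d 0) →+ H := f.symm.toAddMonoidHom.comp 
        (AddMonoidHom.single (fun i : Fin 1 => ZMod (d i)) 0)
      refine isAddCyclic_of_surjective g fun h => ⟨f h 0, ?_⟩
      apply f.injective
      change f (f.symm (Pi.single 0 (f h 0))) = f h
      rw [f.apply_symm_apply]
      ext i; fin_cases i; rfl)
    exact ⟨P, D⟩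
  -- Any smooth curve would serve; `y² = x³ + 1` is one. As `d 0 ∣ d 1`, the group embeds into `(ℤ/d
  -- 1)²`, hence into the points of the curve.
  · have hab : ∀ x y, (shortCurve 0 1).Equation x y → (shortCurve 0 1).Nonsingular x y := by
      intro x y h
      rw [shortCurve.equation_iff] at h
      refine (shortCurve.nonsingular_iff x y).2 ⟨h, ?_⟩
      by_contra! hc
      obtain ⟨hx, hy⟩ := hc
      have hx0 : x = 0 := by simpa using hx
      simp [hx0, hy] at h
    obtain ⟨φ, hφ⟩ := shortCurve.exists_torsion_equiv hab (h1 1)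
    obtain ⟨g, hg⟩ := exists_zmod_hom_injective (by have := h1 1; omega : 0 < d 1)
      (h2 0 1 (by decide))
    let ψ : H →+ (Fin 2 → ZMod (d 1)) :=
      { toFun := fun h => ![g (f h 0), f h 1]
        map_zero' := by ext i; fin_cases i <;> simp
        map_add' := fun x y => by ext i; fin_cases i <;> simp }
    refine exists_dualNet_of_hom hab (φ.comp ψ) (hφ.comp fun x y hxy => ?_)
    apply f.injective
    have e0 := congrFun hxy 0
    have e1 := congrFun hxy 1
    ext i
    fin_cases i
    · exact hg e0
    · exact e1

theorem corollary5p6 (H : Type*) [AddCommGroup H] [Finite H] :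
    ((∃ h : H, 10 ≤ addOrderOf h) →
      ((∃ N : PlaneNet 3, N.Realizes H) ↔
        ∃ r : ℕ, r ≤ 2 ∧ ∃ d : Fin r → ℕ, IsInvariantFactors H d)) ∧
    ((∃ h : H, 7 ≤ addOrderOf h) →
      ((∃ N : PlaneNet 3, N.Realizes H ∧ ∃ i : Fin 3, N.IsPencil i) ↔ IsAddCyclic H)) := by
  constructor
  · rintro ⟨h, hh⟩
    have hnt : Nontrivial H := ⟨h, 0, fun h0 => by simp [h0] at hh⟩
    constructor
    · rintro ⟨N, hN⟩
      exact hN.exists_isInvariantFactors hh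
    · rintro ⟨r, hr, d, hd⟩
      obtain ⟨P, D⟩ := hd.exists_dualNet hr
      obtain ⟨N, hN, -⟩ := D.exists_realizes
      exact ⟨N, hN⟩
  · rintro ⟨h, hh⟩
    have hnt : Nontrivial H := ⟨h, 0, fun h0 => by simp [h0] at hh⟩
    exact exists_realizes_isPencil_iff H
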